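/- **Setting.** Let $\alpha_0^{1/2}$, $x$, $\mathcal A_j,\mathcal B_j$ ($j\ge 1$) be even formal variables and $\varphi$, $\mathcal M_{j-1/2},\mathcal N_{j-1/2}$ ($j\ge1$) odd (pairwise anticommuting) formal variables; $\alpha_0=(\alpha_0^{1/2})^2$. For a ring $S$ (possibly containing $x^{\pm1},\varphi$), $S[[\mathcal A,\mathcal B]][\mathcal M,\mathcal N]$ denotes all formal (possibly infinite) sums of monomials in the $\mathcal A_j,\mathcal B_j,\mathcal M_{j-1/2},\mathcal N_{j-1/2}$ with coefficients in $S$. All series are elements of $W=\mathbb C[\alpha_0^{\pm1/2}][x,x^{-1},\varphi][[\mathcal A,\mathcal B]][\mathcal M,\mathcal N]$, and all compositions (substitutions for $(x,\varphi)$) are expanded in nonnegative powers of the $\mathcal A_j,\mathcal B_j,\mathcal M_{j-1/2},\mathcal N_{j-1/2}$. For $n\in\mathbb Z$ put $$L_n=-\Bigl(x^{n+1}\tfrac{\partial}{\partial x}+\tfrac{n+1}{2}\varphi x^n\tfrac{\partial}{\partial\varphi}\Bigr),\qquad G_{n-\frac12}=-x^n\Bigl(\tfrac{\partial}{\partial\varphi}-\varphi\tfrac{\partial}{\partial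 x}\Bigr),$$ let $(\alpha_0^{1/2})^{\mp2L_0}$ be the substitution $(x,\varphi)\mapsto(\alpha_0^{\pm1}x,\alpha_0^{\pm1/2}\varphi)$, and let $$T_+=\sum_{j\ge1}\bigl(\mathcal A_jL_j+\mathcal M_{j-\frac12}G_{j-\frac12}\bigr),\quad T_-=\sum_{j\ge1}\bigl(\mathcal B_jL_{-j}+\mathcal N_{j-\frac12}G_{-j+\frac12}\bigr),$$ $$I(x,\varphi)=\Bigl(\tfrac1x,\tfrac{i\varphi}{x}\Bigr),\quad H^{(1)}=e^{-T_+}(\alpha_0^{1/2})^{-2L_0}\cdot(x,\varphi),\quad H^{(2)}=e^{T_-}\cdot\Bigl(\tfrac1x,\tfrac{i\varphi}{x}\Bigr).$$ A pair $H=(f+\varphi\xi,\psi+\varphi g)$ with even first and odd second component ($f,\xi,\psi,g$ free of $\varphi$) is *superconformal* if $\xi=g\psi$, $g^2=f'+\psi\psi'$ and $g+\varphi\psi'\ne0$, where $'=\partial/\partial x$. Put $$g_{\mathcal A}(x)=\sum_{j\ge1}\mathcal A_jx^{j+1},\quad g_{\mathcal M}(x)=\sum_{j\ge1}\mathcal M_{j-\frac12}x^j,\quad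 g_{\mathcal B}(x)=\sum_{j\ge1}\mathcal B_jx^{-j+1},\quad g_{\mathcal N}(x)=\sum_{j\ge1}\mathcal N_{j-\frac12}x^{-j+1},$$ and let $p^-$, $p^+$ denote the parts of $p$ in powers $x^n$ with $n\le0$, respectively $n\ge1$. Call a pair $(\bar F^{(1)},\bar F^{(2)})$ *admissible* if 1. both are superconformal; the components of $\bar F^{(1)}$ lie in $x\,\mathbb C[\alpha_0^{\pm1/2}][x^{-1},\varphi][[\mathcal A,\mathcal B]][\mathcal M,\mathcal N]$; the components of $\bar F^{(2)}$ lie in $xR_2\oplus\varphi R_2$ with $R_2=\mathbb C[\alpha_0^{\pm1/2}][x][[\mathcal A,\mathcal B]][\mathcal M,\mathcal N]$; 2. (formal boundary conditions) $$\bar F^{(1)}|_{(\mathcal A,\mathcal M)=0}=(\alpha_0^{1/2})^{-2L_0}e^{-T_-}(\alpha_0^{1/2})^{2L_0}\cdot(x,\varphi),\qquad \bar F^{(1)}|_{(\mathcal B,\mathcal N)=0}=(x,\varphi),$$ $$\bar F^{(2)}|_{(\mathcal A,\mathcal M)=0}=(\alpha_0^{-1}x,\alpha_0^{-1/2}\varphi),\qquad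 \bar F^{(2)}|_{(\mathcal B,\mathcal N)=0}=(\alpha_0^{1/2})^{2L_0}e^{T_+}\cdot(x,\varphi);$$ 3. (low-order expansions) $\varphi\bar F^{(1)}=\varphi\,\bar F^{(1)}|_{(\mathcal A,\mathcal M)=0}+\varphi Q^{(1)}+\varphi R^{(1)}$ and $\varphi\bar F^{(2)}=\varphi\,\bar F^{(2)}|_{(\mathcal B,\mathcal N)=0}+\varphi Q^{(2)}+\varphi R^{(2)}$, where $Q^{(1)}$ has components $$\alpha_0^{-1}\bigl(g_{\mathcal A}(x)\,\partial_xg_{\mathcal B}(\alpha_0x)-g_{\mathcal B}(\alpha_0x)\,\partial_xg_{\mathcal A}(x)\bigr)^-+2\alpha_0^{-\frac12}\bigl(g_{\mathcal M}(x)g_{\mathcal N}(\alpha_0x)\bigr)^-,$$ $$\alpha_0^{-\frac12}\bigl(g_{\mathcal A}(x)\,\partial_xg_{\mathcal N}(\alpha_0x)-\tfrac12g_{\mathcal N}(\alpha_0x)\,\partial_xg_{\mathcal A}(x)\bigr)^-+\alpha_0^{-1}\bigl(\tfrac12g_{\mathcal M}(x)\,\partial_xg_{\mathcal B}(\alpha_0x)-g_{\mathcal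 B}(\alpha_0x)\,\partial_xg_{\mathcal M}(x)\bigr)^-,$$ $Q^{(2)}$ has components $$\bigl(g_{\mathcal B}(x)\,\partial_xg_{\mathcal A}(\alpha_0^{-1}x)-g_{\mathcal A}(\alpha_0^{-1}x)\,\partial_xg_{\mathcal B}(x)\bigr)^+-2\alpha_0^{-\frac12}\bigl(g_{\mathcal M}(\alpha_0^{-1}x)g_{\mathcal N}(x)\bigr)^+,$$ $$\alpha_0^{\frac12}\bigl(\tfrac12g_{\mathcal N}(x)\,\partial_xg_{\mathcal A}(\alpha_0^{-1}x)-g_{\mathcal A}(\alpha_0^{-1}x)\,\partial_xg_{\mathcal N}(x)\bigr)^++\bigl(g_{\mathcal B}(x)\,\partial_xg_{\mathcal M}(\alpha_0^{-1}x)-\tfrac12g_{\mathcal M}(\alpha_0^{-1}x)\,\partial_xg_{\mathcal B}(x)\bigr)^+,$$ and the components of $R^{(1)}$ (resp. $R^{(2)}$) are series without $\varphi$ in nonpositive (resp. nonnegative) powers of $x$, all of whose terms have total degree at least one in the $\mathcal A_j,\mathcal M_{j-1/2}$, at least one in the $\mathcal B_j,\mathcal N_{j-1/2}$, and at least three in all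 these variables together. **Theorem.** $H^{(2)}$ has a unique two-sided compositional inverse $(H^{(2)})^{-1}$ among the pairs of series in $W$ with even, invertible first and odd second component. The composition $(H^{(2)})^{-1}\circ I\circ H^{(1)}$ exists, and for every admissible pair the composition $\bar F^{(2)}\circ(H^{(2)})^{-1}\circ I\circ H^{(1)}$ exists in $W$. There is exactly one admissible pair $(\bar F^{(1)},\bar F^{(2)})$ which solves the formal sewing equation $$\bar F^{(1)}=\bar F^{(2)}\circ(H^{(2)})^{-1}\circ I\circ H^{(1)},$$ and for it the composition on the right has its components in $x\,\mathbb C[\alpha_0^{\pm1/2}][x^{-1},\varphi][[\mathcal A,\mathcal B]][\mathcal M,\mathcal N]$. -/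

import Mathlib

noncomputable section

open Finset

/-! ## Formal series in odd (pairwise anticommuting) variables

`GrassmannSeries O P` is the algebra of all formal sums `∑ₛ p_s θ_s`, where `s` runs over the finite
subsets of `O`, `p_s ∈ P`, and `θ_s` is the product, in increasing order, of the odd variables
indexed by `s`. -/

def GrassmannSeries (O : Type*) (P : Type*) : Type _ := Finset O → P

namespace GrassmannSeries

variable {O P : Type*} [LinearOrder O] [CommRing P]

/-- The sign with `θ_s θ_t = sgn s t • θ_{s ∪ t}` for disjoint `s`, `t`. -/
def sgn (s t : Finset O) : P := ∏ a ∈ s, ∏ b ∈ t, if b < a then -1 else 1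

instance : AddCommGroup (GrassmannSeries O P) := inferInstanceAs (AddCommGroup (Finset O → P))

instance {K : Type*} [Semiring K] [Module K P] : Module K (GrassmannSeries O P) :=
  inferInstanceAs (Module K (Finset O → P))

/-- The element `p θ_s`. -/
def single (s : Finset O) (p : P) : GrassmannSeries O P := fun t => if t = s then p else 0

instance : One (GrassmannSeries O P) := ⟨single ∅ 1⟩

instance : Mul (GrassmannSeries O P) :=
  ⟨fun f g s => ∑ t ∈ s.powerset, sgn t (s \ t) * f t * g (s \ t)⟩

theorem mul_apply (f g : GrassmannSeries O P) (s : Finset O) :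
    (f * g) s = ∑ t ∈ s.powerset, sgn t (s \ t) * f t * g (s \ t) := rfl

set_option linter.unusedSectionVars false

theorem add_apply (f g : GrassmannSeries O P) (s : Finset O) : (f + g) s = f s + g s := rfl

theorem zero_apply (s : Finset O) : (0 : GrassmannSeries O P) s = 0 := rfl

theorem one_apply (s : Finset O) : (1 : GrassmannSeries O P) s = if s = ∅ then 1 else 0 := rfl

theorem sgn_empty_left (s : Finset O) : (sgn ∅ s : P) = 1 := by simp [sgn]

theorem sgn_empty_right (s : Finset O) : (sgn s ∅ : P) = 1 := by simp [sgn]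

theorem sgn_union_left {s t : Finset O} (h : Disjoint s t) (u : Finset O) :
    (sgn (s ∪ t) u : P) = sgn s u * sgn t u := by
  simp only [sgn]
  exact prod_union h

theorem sgn_union_right (u : Finset O) {s t : Finset O} (h : Disjoint s t) :
    (sgn u (s ∪ t) : P) = sgn u s * sgn u t := by
  simp only [sgn, ← prod_mul_distrib]
  exact prod_congr rfl fun a _ => prod_union h

theorem assoc_aux (f g h : GrassmannSeries O P) : f * g * h = f * (g * h) := by
  funext s
  simp only [mul_apply, mul_sum, sum_mul]
  rw [sum_sigma', sum_sigma']
  refine sum_nbij' (fun p => ⟨p.2, p.1 \ p.2⟩) (fun p => ⟨p.1 ∪ p.2, p.1⟩) ?_ ?_ ?_ ?_ ?_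
  · rintro ⟨t, r⟩ hp
    simp only [mem_sigma, mem_powerset] at hp ⊢
    exact ⟨hp.2.trans hp.1, sdiff_subset_sdiff hp.1 subset_rfl⟩
  · rintro ⟨r, q⟩ hp
    simp only [mem_sigma, mem_powerset] at hp ⊢
    exact ⟨union_subset hp.1 (hp.2.trans sdiff_subset), subset_union_left⟩
  · rintro ⟨t, r⟩ hp
    simp only [mem_sigma, mem_powerset] at hp
    simp [union_sdiff_of_subset hp.2]
  · rintro ⟨r, q⟩ hp
    simp only [mem_sigma, mem_powerset] at hp
    have hd : Disjoint r q := (disjoint_sdiff (s := r) (t := s)).mono_right hp.2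
    simp [union_sdiff_cancel_left hd]
  · rintro ⟨t, r⟩ hp
    simp only [mem_sigma, mem_powerset] at hp
    obtain ⟨ht, hr⟩ := hp
    have e1 : (s \ r) \ (t \ r) = s \ t := by
      ext a; simp only [mem_sdiff]
      have := @hr a
      tauto
    have e2 : (sgn t (s \ t) : P) = sgn r (s \ t) * sgn (t \ r) (s \ t) := by
      rw [← sgn_union_left disjoint_sdiff, union_sdiff_of_subset hr]
    have e3 : (sgn r (s \ r) : P) = sgn r (t \ r) * sgn r (s \ t) := by
      rw [← sgn_union_right]
      · congr 1
        ext a; simp only [mem_sdiff, mem_union]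
        have := @hr a
        have := @ht a
        tauto
      · exact disjoint_sdiff.mono_left sdiff_subset
    simp only [e1, e2, e3]
    ring

instance : Ring (GrassmannSeries O P) where
  __ := (inferInstance : AddCommGroup (GrassmannSeries O P))
  mul := (· * ·)
  one := 1
  mul_assoc := assoc_aux
  left_distrib f g h := by
    funext s
    simp only [mul_apply, add_apply, mul_add, sum_add_distrib]
  right_distrib f g h := by
    funext s
    simp only [mul_apply, add_apply, mul_add, add_mul, sum_add_distrib]
  zero_mul f := by
    funext s
    simp [mul_apply, zero_apply]
  mul_zero f := by
    funext s
    simp [mul_apply, zero_apply]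
  one_mul f := by
    funext s
    rw [mul_apply, sum_eq_single ∅]
    · simp [one_apply, sgn_empty_left]
    · intro t _ ht
      simp [one_apply, ht]
    · simp
  mul_one f := by
    funext s
    rw [mul_apply, sum_eq_single s]
    · simp [one_apply, sgn_empty_right]
    · intro t ht hts
      have : s \ t ≠ ∅ := fun h =>
        hts (subset_antisymm (mem_powerset.1 ht) (sdiff_eq_empty_iff_subset.1 h))
      simp [one_apply, this]
    · simp

end GrassmannSeries

namespace SuperSewing

open GrassmannSeries

/-! ## The variables and the ambient superalgebra -/

/-- The even variables `𝒜_j`, `ℬ_j`, for `j` a positive integer. -/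
inductive EvenVar
  | A (j : ℕ+)
  | B (j : ℕ+)

/-- The odd variables: `φ`, and `ℳ_{j-1/2}` (written `M j`), `𝒩_{j-1/2}` (written `N j`),
for `j` a positive integer. -/
inductive OddVar
  | phi
  | M (j : ℕ+)
  | N (j : ℕ+)

/-- An auxiliary numbering of the odd variables, in which `φ` comes first. -/
def OddVar.rank : OddVar → ℕ
  | .phi => 0
  | .M j => 2 * j
  | .N j => 2 * j + 1

theorem OddVar.rank_injective : Function.Injective OddVar.rank := by
  intro a b h
  cases a <;> cases b <;> simp only [OddVar.rank] at h
  · rfl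
  · rename_i j; have := j.pos; omega
  · omega
  · rename_i j; have := j.pos; omega
  · rename_i j k; congr 1; apply PNat.coe_injective; omega
  · omega
  · omega
  · omega
  · rename_i j k; congr 1; apply PNat.coe_injective; omega

instance : LinearOrder OddVar := LinearOrder.lift' OddVar.rank OddVar.rank_injective

/-- `ℂ[α₀^{1/2}, α₀^{-1/2}]`; the Laurent variable is `α₀^{1/2}`. -/
abbrev Scal : Type := LaurentPolynomial ℂ

/-- `ℂ[α₀^{1/2}, α₀^{-1/2}][x, x⁻¹]`; the outer Laurent variable is `x`. -/
abbrev Laur : Type := LaurentPolynomial Scal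

/-- `ℂ[α₀^{±1/2}][x, x⁻¹, φ][[𝒜, ℬ]][ℳ, 𝒩]`: formal series in the `𝒜_j`, `ℬ_j`, `ℳ_{j-1/2}`,
`𝒩_{j-1/2}`, the coefficient of each monomial being an element of `ℂ[α₀^{±1/2}][x, x⁻¹, φ]`.
The coefficient of a monomial with even exponents `e` and set `s` of odd variables
(`φ` included) of `F` is `F s e`. -/
abbrev Ser : Type := GrassmannSeries OddVar (MvPowerSeries EvenVar Laur)

/-- The coefficient of `x ^ n` in the coefficient of the monomial `(e, s)`. -/
def coef (F : Ser) (s : Finset OddVar) (e : EvenVar →₀ ℕ) (n : ℤ) : Scal :=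
  AddMonoidAlgebra.coeff (F s e) n

/-- A Laurent polynomial in `α₀^{1/2}` and `x` as a constant series. -/
def ofLaur (p : Laur) : Ser := GrassmannSeries.single ∅ (MvPowerSeries.C p)

/-- `(α₀^{1/2}) ^ k`. -/
def sqrtAlpha (k : ℤ) : Ser := ofLaur (LaurentPolynomial.C (LaurentPolynomial.T k))

/-- `x ^ n`. -/
def X (n : ℤ) : Ser := ofLaur (LaurentPolynomial.T n)

/-- A monomial in the `𝒜_j`, `ℬ_j` and odd variables. -/
def mono (e : EvenVar →₀ ℕ) (s : Finset OddVar) : Ser :=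
  GrassmannSeries.single s (MvPowerSeries.monomial e 1)

def evenVar (a : EvenVar) : Ser := mono (Finsupp.single a 1) ∅

def oddVar (θ : OddVar) : Ser := mono 0 {θ}

def cA (j : ℕ+) : Ser := evenVar (.A j)
def cB (j : ℕ+) : Ser := evenVar (.B j)
def cM (j : ℕ+) : Ser := oddVar (.M j)
def cN (j : ℕ+) : Ser := oddVar (.N j)
def phi : Ser := oddVar .phi

/-- Formal sums: for each monomial only finitely many members of the family may contribute. -/
def FormallySummable {ι : Type*} (F : ι → Ser) : Prop :=
  ∀ s e, (Function.support fun i => F i s e).Finite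

/-- The sum of a formally summable family. -/
def formalSum {ι : Type*} (F : ι → Ser) : Ser := fun s e => ∑ᶠ i, F i s e

/-! ## Operators -/

/-- `∑ a_n x^n ↦ ∑ n a_n x^{n-1}`. -/
def derivLaur (p : Laur) : Laur :=
  (AddMonoidAlgebra.coeff p).sum fun n a =>
    LaurentPolynomial.C ((n : Scal) * a) * LaurentPolynomial.T (n - 1)

/-- `p(x) ↦ p(α₀^k x)`. -/
def scaleLaur (k : ℤ) (p : Laur) : Laur :=
  (AddMonoidAlgebra.coeff p).sum fun n a =>
    LaurentPolynomial.C (LaurentPolynomial.T (2 * k * n) * a) * LaurentPolynomial.T n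

/-- `∂/∂x`. -/
def dx (F : Ser) : Ser := fun s e => derivLaur (F s e)

/-- `∂/∂φ` (a left derivative: `φ` is the first of the odd variables). -/
def dphi (F : Ser) : Ser := fun s => if OddVar.phi ∈ s then 0 else F (insert OddVar.phi s)

/-- `F(x) ↦ F(α₀^k x)`. -/
def scaleX (k : ℤ) (F : Ser) : Ser := fun s e => scaleLaur k (F s e)

/-- `((α₀^{1/2})^k)^{2 x ∂/∂x + φ ∂/∂φ}`, that is `(α₀^{1/2})^{-2 k L₀(x,φ)}`: the monomial
`x^n φ^m` is multiplied by `(α₀^{1/2})^{k (2 n + m)}`. -/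
def dil (k : ℤ) (F : Ser) : Ser := fun s e =>
  LaurentPolynomial.C (LaurentPolynomial.T (if OddVar.phi ∈ s then k else 0)) *
    scaleLaur k (F s e)

/-- `L_n(x, φ) = -(x^{n+1} ∂/∂x + ((n+1)/2) φ x^n ∂/∂φ)`. -/
def L (n : ℤ) (F : Ser) : Ser :=
  -(X (n + 1) * dx F + (((n : ℂ) + 1) / 2) • (phi * X n * dphi F))

/-- `G_{n-1/2}(x, φ) = -x^n (∂/∂φ - φ ∂/∂x)`. -/
def G (n : ℤ) (F : Ser) : Ser := -(X n * (dphi F - phi * dx F))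

/-- `∑_{j ≥ 1} (𝒜_j L_j + ℳ_{j-1/2} G_{j-1/2})`. -/
def TAM (F : Ser) : Ser := formalSum fun j : ℕ+ => cA j * L j F + cM j * G j F

/-- `∑_{j ≥ 1} (ℬ_j L_{-j} + 𝒩_{j-1/2} G_{-j+1/2})`. -/
def TBN (F : Ser) : Ser := formalSum fun j : ℕ+ => cB j * L (-j) F + cN j * G (-j + 1) F

/-- `exp(T) · F`, the formal exponential series. -/
def expOp (T : Ser → Ser) (F : Ser) : Ser :=
  formalSum fun n : ℕ => ((n.factorial : ℂ)⁻¹) • (T^[n] F)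

/-! ## Formal superfunctions and their composition -/

/-- A pair `(H⁰, H¹)` of formal series in `(x, φ)`. -/
abbrev SFun : Type := Ser × Ser

def IsEven (F : Ser) : Prop := ∀ s, F s ≠ 0 → Even s.card

def IsOdd (F : Ser) : Prop := ∀ s, F s ≠ 0 → Odd s.card

/-- `H⁰` is even and `H¹` is odd. -/
def IsSuperfunction (H : SFun) : Prop := IsEven H.1 ∧ IsOdd H.2

/-- Apply an operator to both components. -/
def onPair (T : Ser → Ser) (H : SFun) : SFun := (T H.1, T H.2)

/-- `(x, φ)`. -/
def idPair : SFun := (X 1, phi)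

/-- `u ^ n`; for negative `n` meaningful when `u` is a unit. -/
def intPow (u : Ser) (n : ℤ) : Ser :=
  if 0 ≤ n then u ^ n.toNat else Ring.inverse u ^ (-n).toNat

/-- `p(u) = ∑ a_n u^n` for `p = ∑ a_n x^n`. -/
def substLaur (u : Ser) (p : Laur) : Ser :=
  (AddMonoidAlgebra.coeff p).sum fun n a => ofLaur (LaurentPolynomial.C a) * intPow u n

/-- The substitution `x ↦ H⁰`, `φ ↦ H¹` in the part of `F` at the monomial `(e, s)`. -/
def substTerm (F : Ser) (H : SFun) (i : (EvenVar →₀ ℕ) × Finset OddVar) : Ser :=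
  (if OddVar.phi ∈ i.2 then H.2 else 1) * substLaur H.1 (F i.2 i.1) *
    mono i.1 (i.2.erase OddVar.phi)

/-- `F(H⁰, H¹)`, expanded in nonnegative powers of the `𝒜_j`, `ℬ_j`, `ℳ_{j-1/2}`, `𝒩_{j-1/2}`. -/
def subst (F : Ser) (H : SFun) : Ser := formalSum (substTerm F H)

/-- The composition `F ∘ H`. -/
def comp (F H : SFun) : SFun := (subst F.1 H, subst F.2 H)

/-- The composition `F ∘ H` exists: powers of `H⁰` make sense, and the sums are formally summable. -/
def CompExists (F H : SFun) : Prop :=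
  IsUnit H.1 ∧ FormallySummable (substTerm F.1 H) ∧ FormallySummable (substTerm F.2 H)

/-- `K` is a two-sided compositional inverse of `H`. -/
def IsCompInverse (H K : SFun) : Prop :=
  IsSuperfunction K ∧ CompExists H K ∧ CompExists K H ∧ comp H K = idPair ∧ comp K H = idPair

/-- The part of `F` that does not contain `φ`. -/
def noPhi (F : Ser) : Ser := fun s => if OddVar.phi ∈ s then 0 else F s

/-- `H = (f + φ ξ, ψ + φ g)` is superconformal in `(x, φ)`: `ξ = g ψ`, `g² = f' + ψ ψ'`, and
`g + φ ψ'` is not zero. -/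
def IsSuperconformal (H : SFun) : Prop :=
  IsSuperfunction H ∧
    dphi H.1 = dphi H.2 * noPhi H.2 ∧
    dphi H.2 * dphi H.2 = dx (noPhi H.1) + noPhi H.2 * dx (noPhi H.2) ∧
    dphi H.2 + phi * dx (noPhi H.2) ≠ 0

/-! ## The local coordinates -/

/-- `I(x, φ) = (1/x, iφ/x)`. -/
def inversion : SFun := (X (-1), Complex.I • (phi * X (-1)))

/-- `H⁽¹⁾ = exp(-∑ (𝒜_j L_j + ℳ_{j-1/2} G_{j-1/2})) · (α₀^{1/2})^{-2L₀} · (x, φ)`. -/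
def H1 : SFun := onPair (fun F => expOp (fun E => -TAM E) (dil 1 F)) idPair

/-- `H⁽²⁾ = exp(∑ (ℬ_j L_{-j} + 𝒩_{j-1/2} G_{-j+1/2})) · (1/x, iφ/x)`. -/
def H2 : SFun := onPair (expOp TBN) inversion

/-! ## Where the solutions live, boundary conditions, low-order expansions -/

/-- `x ℂ[α₀^{±1/2}][x⁻¹, φ][[𝒜, ℬ]][ℳ, 𝒩]`. -/
def InClass1 (F : Ser) : Prop := ∀ s e n, coef F s e n ≠ 0 → n ≤ 1

/-- `f + φ g` with `f ∈ x ℂ[α₀^{±1/2}][x][[𝒜, ℬ]][ℳ, 𝒩]` and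
`g ∈ ℂ[α₀^{±1/2}][x][[𝒜, ℬ]][ℳ, 𝒩]`. -/
def InClass2 (F : Ser) : Prop :=
  ∀ s e n, coef F s e n ≠ 0 → 0 ≤ n ∧ (OddVar.phi ∉ s → 1 ≤ n)

/-- The total degree of a monomial in the `𝒜_j` and `ℳ_{j-1/2}`. -/
def degAM (s : Finset OddVar) (e : EvenVar →₀ ℕ) : ℕ :=
  (e.sum fun a k => match a with | .A _ => k | .B _ => 0) +
    ∑ θ ∈ s, match θ with | .phi => 0 | .M _ => 1 | .N _ => 0

/-- The total degree of a monomial in the `ℬ_j` and `𝒩_{j-1/2}`. -/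
def degBN (s : Finset OddVar) (e : EvenVar →₀ ℕ) : ℕ :=
  (e.sum fun a k => match a with | .A _ => 0 | .B _ => k) +
    ∑ θ ∈ s, match θ with | .phi => 0 | .M _ => 0 | .N _ => 1

/-- `F|_{(𝒜, ℳ) = 0}`. -/
def atAM0 (F : Ser) : Ser := fun s e => if degAM s e = 0 then F s e else 0

/-- `F|_{(ℬ, 𝒩) = 0}`. -/
def atBN0 (F : Ser) : Ser := fun s e => if degBN s e = 0 then F s e else 0

/-- `(p(x))⁻`, the part in nonpositive powers of `x`. -/
def minusPart (F : Ser) : Ser := fun s e =>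
  AddMonoidAlgebra.ofCoeff ((AddMonoidAlgebra.coeff (F s e)).filter fun n => n ≤ 0)

/-- `(p(x))⁺`, the part in positive powers of `x`. -/
def plusPart (F : Ser) : Ser := fun s e =>
  AddMonoidAlgebra.ofCoeff ((AddMonoidAlgebra.coeff (F s e)).filter fun n => 1 ≤ n)

/-- `g_𝒜(x) = ∑_j 𝒜_j x^{j+1}`. -/
def gA : Ser := formalSum fun j : ℕ+ => cA j * X (j + 1)
/-- `g_ℳ(x) = ∑_j ℳ_{j-1/2} x^j`. -/
def gM : Ser := formalSum fun j : ℕ+ => cM j * X j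
/-- `g_ℬ(x) = ∑_j ℬ_j x^{-j+1}`. -/
def gB : Ser := formalSum fun j : ℕ+ => cB j * X (-j + 1)
/-- `g_𝒩(x) = ∑_j 𝒩_{j-1/2} x^{-j+1}`. -/
def gN : Ser := formalSum fun j : ℕ+ => cN j * X (-j + 1)

/-- The terms of `F̄⁽¹⁾` of degree one in `(𝒜, ℳ)` and degree one in `(ℬ, 𝒩)`, at `φ = 0`. -/
def quad1 : SFun :=
  (minusPart (sqrtAlpha (-2) * (gA * dx (scaleX 1 gB)) - sqrtAlpha (-2) * (scaleX 1 gB * dx gA))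
      + (2 : ℂ) • (sqrtAlpha (-1) * minusPart (gM * scaleX 1 gN)),
    sqrtAlpha (-1) *
        minusPart (gA * dx (scaleX 1 gN) - (1 / 2 : ℂ) • (scaleX 1 gN * dx gA))
      + sqrtAlpha (-2) *
        minusPart ((1 / 2 : ℂ) • (gM * dx (scaleX 1 gB)) - scaleX 1 gB * dx gM))

/-- The terms of `F̄⁽²⁾` of degree one in `(𝒜, ℳ)` and degree one in `(ℬ, 𝒩)`, at `φ = 0`. -/
def quad2 : SFun :=
  (plusPart (gB * dx (scaleX (-1) gA) - scaleX (-1) gA * dx gB)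
      - (2 : ℂ) • (sqrtAlpha (-1) * plusPart (scaleX (-1) gM * gN)),
    sqrtAlpha 1 *
        plusPart ((1 / 2 : ℂ) • (gN * dx (scaleX (-1) gA)) - scaleX (-1) gA * dx gN)
      + plusPart (gB * dx (scaleX (-1) gM) - (1 / 2 : ℂ) • (scaleX (-1) gM * dx gB)))

/-- `R` does not contain `φ`, its powers of `x` lie in `S`, and it contains only terms of degree at
least one in `(𝒜, ℳ)`, at least one in `(ℬ, 𝒩)`, and total degree at least three. -/
def IsRemainder (S : Set ℤ) (R : Ser) : Prop :=
  ∀ s e n, coef R s e n ≠ 0 →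
    OddVar.phi ∉ s ∧ n ∈ S ∧ 1 ≤ degAM s e ∧ 1 ≤ degBN s e ∧ 3 ≤ degAM s e + degBN s e

/-- `F̄⁽¹⁾`, `F̄⁽²⁾` are superconformal formal series in the right spaces which satisfy the formal
boundary conditions and have the prescribed low-order expansions. -/
structure Admissible (F₁ F₂ : SFun) : Prop where
  mem₁ : InClass1 F₁.1 ∧ InClass1 F₁.2
  mem₂ : InClass2 F₂.1 ∧ InClass2 F₂.2
  superconformal₁ : IsSuperconformal F₁
  superconformal₂ : IsSuperconformal F₂
  boundary₁_AM : onPair atAM0 F₁ =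
    onPair (fun F => dil 1 (expOp (fun E => -TBN E) (dil (-1) F))) idPair
  boundary₁_BN : onPair atBN0 F₁ = idPair
  boundary₂_AM : onPair atAM0 F₂ = (sqrtAlpha (-2) * X 1, sqrtAlpha (-1) * phi)
  boundary₂_BN : onPair atBN0 F₂ = onPair (fun F => dil (-1) (expOp TAM F)) idPair
  expansion₁ : ∃ R : SFun, IsRemainder (Set.Iic 0) R.1 ∧ IsRemainder (Set.Iic 0) R.2 ∧
    onPair (phi * ·) F₁ =
      onPair (phi * ·) (onPair atAM0 F₁) + onPair (phi * ·) quad1 + onPair (phi * ·) R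
  expansion₂ : ∃ R : SFun, IsRemainder (Set.Ici 0) R.1 ∧ IsRemainder (Set.Ici 0) R.2 ∧
    onPair (phi * ·) F₂ =
      onPair (phi * ·) (onPair atBN0 F₂) + onPair (phi * ·) quad2 + onPair (phi * ·) R

end SuperSewing

end

noncomputable section

namespace SuperSewing

open GrassmannSeries Finset

/-! ## Coefficients of products -/

/-! The sewing equation is a Birkhoff-type factorization problem which becomes linear once
composition is read as a ring endomorphism. A ring endomorphism σ of `Ser` that fixes all variables
other than x and φ and is local in the monomials (`IsGood`) is the substitution (x, φ) ↦ (σ x, σ φ)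
(`IsGood.subst_eq`). Dilations, inversions and exponentials of the even superconformal vector fields
`vec a m` are of this kind, and T₊, T₋ are the single fields `vec gA gM`, `vec gB gN`. In (H⁽²⁾)⁻¹ ∘
I ∘ H⁽¹⁾ the two inversions cancel, and the equation reads F̄⁽¹⁾ = `sewHom` F̄⁽²⁾ with `sewHom` =
e^{-T₊} · dilation · e^{-T₋}, which is linear in F̄⁽²⁾.

Filter by the total degree in all variables but φ. Then `sewHom` is the dilation, which is
invertible and rescales each monomial, plus a map raising the degree. Hence, for any set Q of pairs
(odd part, power of x) and any series N, there is exactly one F supported in Q with `sewHom` F − N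
supported off Q: existence by a contraction (`exists_of_deform`), uniqueness by looking at the
lowest degree (`eq_zero_of_deform`). Take for Q the powers allowed in F̄⁽²⁾ (`IsPos`). Solve the
second component with N = φ, then the first with N = x + φc, where c is the term of the second
component of F̄⁽¹⁾ free of x and φ. This c is forced: in a superconformal F̄⁽¹⁾ one has g = 1 +
(negative powers), so ξ = gψ has the same x⁰ term as ψ. `IsNormal` records this shape.

The normalized solution is admissible, mostly because of the same rigidity. With D = ∂/∂φ + φ∂/∂x,
superconformality is the vanishing of the defect Df − ψDψ (here f, ψ are the full components). The
chain rule `superD_sewHom` makes the defect of F̄⁽¹⁾ a linear image of that of F̄⁽²⁾ under another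
deformation of a dilation; one has only negative powers, the other only nonnegative ones, so both
vanish. Parity holds because the grading involution carries normalized solutions to normalized
solutions. The boundary values hold because setting variables to zero gives normalized solutions of
a simpler problem whose solution is explicit. The mixed quadratic terms are a commutator of two
vector fields (`bihom_sewHom`), split into its nonpositive and positive powers.

Conversely, the first member of an admissible pair is normalized (`Admissible.isNormal`): the
expansion controls its φ-free parts, and superconformality recovers the rest. Uniqueness for the
linear problem then gives uniqueness of the pair. -/

instance : DecidableEq EvenVar := Classical.decEq _

/-- The coefficient of the monomial with odd part `s` and even exponents `e`. -/
def cf (F : Ser) (s : Finset OddVar) (e : EvenVar →₀ ℕ) : Laur := F s e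

/-- The series with given coefficients. -/
def ofCf (f : Finset OddVar → (EvenVar →₀ ℕ) → Laur) : Ser := f

@[simp] theorem cf_ofCf (f : Finset OddVar → (EvenVar →₀ ℕ) → Laur) (s : Finset OddVar)
    (e : EvenVar →₀ ℕ) : cf (ofCf f) s e = f s e := rfl

theorem ser_ext {F G : Ser} (h : ∀ s e, cf F s e = cf G s e) : F = G :=
  funext fun s => funext (h s)

theorem cf_eq_zero_of_apply {F : Ser} {s : Finset OddVar} (h : F s = 0) (e : EvenVar →₀ ℕ) :
    cf F s e = 0 := congrFun h e

theorem apply_eq_zero_of_cf {F : Ser} {s : Finset OddVar} (h : ∀ e, cf F s e = 0) : F s = 0 :=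
  funext h

@[simp] theorem cf_add_apply (F G : Ser) (s : Finset OddVar) (e : EvenVar →₀ ℕ) :
    cf (F + G) s e = cf F s e + cf G s e := rfl

@[simp] theorem cf_sub_apply (F G : Ser) (s : Finset OddVar) (e : EvenVar →₀ ℕ) :
    cf (F - G) s e = cf F s e - cf G s e := rfl

@[simp] theorem cf_neg_apply (F : Ser) (s : Finset OddVar) (e : EvenVar →₀ ℕ) :
    cf (-F) s e = -cf F s e := rfl

@[simp] theorem cf_zero_apply (s : Finset OddVar) (e : EvenVar →₀ ℕ) : cf 0 s e = 0 := rfl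

@[simp] theorem cf_smul_apply (c : ℂ) (F : Ser) (s : Finset OddVar) (e : EvenVar →₀ ℕ) :
    cf (c • F) s e = c • cf F s e := rfl

theorem cf_sum_apply {ι : Type*} (I : Finset ι) (F : ι → Ser) (s : Finset OddVar)
    (e : EvenVar →₀ ℕ) : cf (∑ i ∈ I, F i) s e = ∑ i ∈ I, cf (F i) s e := by
  have := map_sum (⟨⟨fun F : Ser => cf F s e, rfl⟩, fun _ _ => rfl⟩ : Ser →+ Laur) F I
  exact this

theorem cf_one_apply (s : Finset OddVar) (e : EvenVar →₀ ℕ) :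
    cf 1 s e = if s = ∅ ∧ e = 0 then 1 else 0 := by
  change ((if s = ∅ then 1 else 0 : MvPowerSeries EvenVar Laur)) e = _
  by_cases hs : s = ∅
  · simp only [hs, if_true, true_and]
    exact MvPowerSeries.coeff_one e
  · simp only [hs, if_false, false_and]
    rfl

theorem map_sgn {P Q : Type*} [CommRing P] [CommRing Q] (f : P →+* Q) (s t : Finset OddVar) :
    f (sgn s t) = sgn s t := by
  simp only [sgn, map_prod]
  refine prod_congr rfl fun a _ => prod_congr rfl fun b _ => ?_
  split_ifs <;> simp

theorem sgn_eq_or {P : Type*} [CommRing P] (s t : Finset OddVar) :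
    (sgn s t : P) = 1 ∨ (sgn s t : P) = -1 := by
  simp only [sgn]
  refine prod_induction _ (fun x : P => x = 1 ∨ x = -1) ?_ (Or.inl rfl) fun a _ =>
    prod_induction _ (fun x : P => x = 1 ∨ x = -1) ?_ (Or.inl rfl) fun b _ => ?_
  · rintro _ _ (rfl | rfl) (rfl | rfl) <;> simp
  · rintro _ _ (rfl | rfl) (rfl | rfl) <;> simp
  · split_ifs <;> simp

/-- Each pair of distinct variables contributes −1 to exactly one of the two signs. -/
theorem sgn_comm {P : Type*} [CommRing P] {s t : Finset OddVar} (h : Disjoint s t) :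
    (sgn s t : P) = (-1) ^ (s.card * t.card) * sgn t s := by
  have e : (sgn t s : P) = ∏ a ∈ s, ∏ b ∈ t, if a < b then -1 else 1 := by
    simp only [sgn]
    exact prod_comm
  have e2 : ((-1 : P)) ^ (s.card * t.card) = ∏ a ∈ s, ∏ b ∈ t, (-1) := by
    simp [pow_mul, pow_right_comm]
  rw [e, e2]
  simp only [sgn, ← prod_mul_distrib]
  refine prod_congr rfl fun a ha => prod_congr rfl fun b hb => ?_
  have hab : a ≠ b := fun h' => disjoint_left.1 h ha (h' ▸ hb)
  rcases lt_or_gt_of_ne hab with h' | h'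
  · simp [h', h'.not_gt]
  · simp [h', h'.not_gt]

theorem cf_mul_apply (F G : Ser) (s : Finset OddVar) (e : EvenVar →₀ ℕ) :
    cf (F * G) s e = ∑ t ∈ s.powerset, ∑ p ∈ antidiagonal e,
      sgn t (s \ t) * (cf F t p.1 * cf G (s \ t) p.2) := by
  have h : cf (F * G) s e =
      MvPowerSeries.coeff e (∑ t ∈ s.powerset, sgn t (s \ t) * F t * G (s \ t)) := rfl
  rw [h, map_sum]
  refine sum_congr rfl fun t _ => ?_
  rw [← map_sgn (MvPowerSeries.C : Laur →+* MvPowerSeries EvenVar Laur) t (s \ t), mul_assoc,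
    MvPowerSeries.coeff_C_mul, MvPowerSeries.coeff_mul, mul_sum]
  rfl

theorem ofLaur_apply (p : Laur) (s : Finset OddVar) (e : EvenVar →₀ ℕ) :
    cf (ofLaur p) s e = if s = ∅ ∧ e = 0 then p else 0 := by
  change ((if s = ∅ then MvPowerSeries.C p else 0 : MvPowerSeries EvenVar Laur)) e = _
  by_cases hs : s = ∅
  · simp only [hs, if_true, true_and]
    exact MvPowerSeries.coeff_C e p
  · simp only [hs, if_false, false_and]
    rfl

theorem mono_apply (f : EvenVar →₀ ℕ) (t s : Finset OddVar) (e : EvenVar →₀ ℕ) :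
    cf (mono f t) s e = if s = t ∧ e = f then 1 else 0 := by
  change ((if s = t then MvPowerSeries.monomial f 1 else 0 : MvPowerSeries EvenVar Laur)) e = _
  by_cases hs : s = t
  · simp only [hs, if_true, true_and]
    exact MvPowerSeries.coeff_monomial e f 1
  · simp only [hs, if_false, false_and]
    rfl

theorem ofLaur_mul_apply (p : Laur) (F : Ser) (s : Finset OddVar) (e : EvenVar →₀ ℕ) :
    cf (ofLaur p * F) s e = p * cf F s e := by
  rw [cf_mul_apply, sum_eq_single ∅, sum_eq_single (0, e)]
  · simp [ofLaur_apply, sgn_empty_left]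
  · rintro ⟨a, b⟩ hab hne
    have ha : a ≠ 0 := by
      rintro rfl
      simp only [HasAntidiagonal.mem_antidiagonal, zero_add] at hab
      exact hne (by rw [hab])
    simp [ofLaur_apply, ha]
  · simp
  · intro t _ ht
    simp [ofLaur_apply, ht]
  · simp

theorem mul_ofLaur_apply (p : Laur) (F : Ser) (s : Finset OddVar) (e : EvenVar →₀ ℕ) :
    cf (F * ofLaur p) s e = p * cf F s e := by
  rw [cf_mul_apply, sum_eq_single s, sum_eq_single (e, 0)]
  · simp [ofLaur_apply, sgn_empty_right, mul_comm]
  · rintro ⟨a, b⟩ hab hne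
    have ha : b ≠ 0 := by
      rintro rfl
      simp only [HasAntidiagonal.mem_antidiagonal, add_zero] at hab
      exact hne (by rw [hab])
    simp [ofLaur_apply, ha]
  · simp
  · intro t ht hts
    have : ¬ s ⊆ t := fun h => hts (subset_antisymm (mem_powerset.1 ht) h)
    simp [ofLaur_apply, this]
  · simp

theorem ofLaur_comm (p : Laur) (F : Ser) : ofLaur p * F = F * ofLaur p :=
  ser_ext fun s e => by rw [ofLaur_mul_apply, mul_ofLaur_apply]

theorem ofLaur_mul (p q : Laur) : ofLaur (p * q) = ofLaur p * ofLaur q :=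
  ser_ext fun s e => by
    rw [ofLaur_mul_apply, ofLaur_apply, ofLaur_apply]
    split_ifs <;> simp

theorem ofLaur_add (p q : Laur) : ofLaur (p + q) = ofLaur p + ofLaur q :=
  ser_ext fun s e => by
    rw [cf_add_apply, ofLaur_apply, ofLaur_apply, ofLaur_apply]
    split_ifs <;> simp

theorem ofLaur_one : ofLaur 1 = 1 := ser_ext fun s e => by rw [ofLaur_apply, cf_one_apply]

theorem ofLaur_zero : ofLaur 0 = 0 := ser_ext fun s e => by rw [ofLaur_apply]; simp

/-- Turns complex scalars into central factors, so that their compatibility with products,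
derivations and substitutions follows from multiplicativity. -/
theorem smul_eq_ofLaur (c : ℂ) (F : Ser) :
    c • F = ofLaur (LaurentPolynomial.C (LaurentPolynomial.C c)) * F :=
  ser_ext fun s e => by
    rw [ofLaur_mul_apply, cf_smul_apply, ← LaurentPolynomial.smul_eq_C_mul,
      ← algebraMap_smul Scal c (cf F s e)]
    rfl

instance : IsScalarTower ℂ Ser Ser :=
  ⟨fun c F G => by simp only [smul_eq_mul, smul_eq_ofLaur, mul_assoc]⟩

instance : SMulCommClass ℂ Ser Ser :=
  ⟨fun c F G => by
    simp only [smul_eq_mul, smul_eq_ofLaur]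
    rw [← mul_assoc, ofLaur_comm, mul_assoc]⟩

theorem X_add (m n : ℤ) : X (m + n) = X m * X n := by
  rw [X, LaurentPolynomial.T_add, ofLaur_mul]; rfl

theorem X_zero : X 0 = 1 := by
  rw [X, LaurentPolynomial.T_zero, ofLaur_one]

theorem X_comm (n : ℤ) (F : Ser) : X n * F = F * X n := ofLaur_comm _ _

theorem isUnit_X (n : ℤ) : IsUnit (X n) :=
  ⟨⟨X n, X (-n), by rw [← X_add, add_neg_cancel, X_zero], by rw [← X_add, neg_add_cancel, X_zero]⟩,
    rfl⟩

theorem sqrtAlpha_add (m n : ℤ) : sqrtAlpha (m + n) = sqrtAlpha m * sqrtAlpha n := by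
  rw [sqrtAlpha, LaurentPolynomial.T_add, map_mul, ofLaur_mul]; rfl

theorem sqrtAlpha_zero : sqrtAlpha 0 = 1 := by
  rw [sqrtAlpha, LaurentPolynomial.T_zero, map_one, ofLaur_one]

theorem sqrtAlpha_comm (n : ℤ) (F : Ser) : sqrtAlpha n * F = F * sqrtAlpha n := ofLaur_comm _ _

/-! ## Endomorphisms acting monomial by monomial -/

/-- `w` is multiplicative on products of monomials that do not vanish. -/
structure IsWeight (w : Finset OddVar → (EvenVar →₀ ℕ) → Laur) : Prop where
  empty : w ∅ 0 = 1
  union : ∀ s t e f, Disjoint s t → w (s ∪ t) (e + f) = w s e * w t f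

/-- The ring endomorphism which acts on coefficients by `h` and multiplies each monomial by its
weight. -/
def diag (h : Laur →+* Laur) (w : Finset OddVar → (EvenVar →₀ ℕ) → Laur) (hw : IsWeight w) :
    Ser →+* Ser where
  toFun F := ofCf fun s e => w s e * h (cf F s e)
  map_one' := ser_ext fun s e => by
    change w s e * h (cf 1 s e) = _
    rw [cf_one_apply]
    split_ifs with hs
    · rw [hs.1, hs.2, hw.empty]; simp
    · simp
  map_zero' := ser_ext fun s e => by
    change w s e * h (cf 0 s e) = _
    simp
  map_add' F G := ser_ext fun s e => by
    change w s e * h (cf (F + G) s e) = w s e * h (cf F s e) + w s e * h (cf G s e)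
    simp [mul_add]
  map_mul' F G := ser_ext fun s e => by
    change w s e * h (cf (F * G) s e) = _
    rw [cf_mul_apply, cf_mul_apply, map_sum, mul_sum]
    refine sum_congr rfl fun t ht => ?_
    rw [map_sum, mul_sum]
    refine sum_congr rfl fun p hp => ?_
    have hs : w s e = w t p.1 * w (s \ t) p.2 := by
      rw [← hw.union _ _ _ _ disjoint_sdiff, union_sdiff_of_subset (mem_powerset.1 ht),
        HasAntidiagonal.mem_antidiagonal.1 hp]
    rw [map_mul, map_mul, map_sgn, hs, cf_ofCf, cf_ofCf]
    ring

theorem diag_apply (h : Laur →+* Laur) (w : Finset OddVar → (EvenVar →₀ ℕ) → Laur)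
    (hw : IsWeight w) (F : Ser) (s : Finset OddVar) (e : EvenVar →₀ ℕ) :
    cf (diag h w hw F) s e = w s e * h (cf F s e) := rfl

/-- The sign `(-1) ^ n`. -/
def pSign (n : ℕ) : Laur := if Even n then 1 else -1

theorem ite_even_eq_neg_one_pow {P : Type*} [CommRing P] (n : ℕ) :
    (if Even n then 1 else -1 : P) = (-1) ^ n := by
  split_ifs with h
  · exact h.neg_one_pow.symm
  · exact (Nat.not_even_iff_odd.1 h).neg_one_pow.symm

theorem pSign_eq (n : ℕ) : pSign n = (-1) ^ n := ite_even_eq_neg_one_pow n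

theorem pSign_even {n : ℕ} (h : Even n) : pSign n = 1 := if_pos h

theorem pSign_odd {n : ℕ} (h : Odd n) : pSign n = -1 := if_neg (Nat.not_even_iff_odd.2 h)

theorem pSign_add (m n : ℕ) : pSign (m + n) = pSign m * pSign n := by
  rw [pSign_eq, pSign_eq, pSign_eq, pow_add]

theorem pSign_mul_self (n : ℕ) : pSign n * pSign n = 1 := by
  rw [pSign]; split_ifs <;> ring

/-- The grading involution: multiplication by the parity sign. -/
def gradeInv : Ser →+* Ser :=
  diag (RingHom.id _) (fun s _ => pSign s.card)
    ⟨by simp [pSign], fun s t e f h => by rw [card_union_of_disjoint h, pSign_add]⟩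

theorem gradeInv_apply (F : Ser) (s : Finset OddVar) (e : EvenVar →₀ ℕ) :
    cf (gradeInv F) s e = pSign s.card * cf F s e := rfl

theorem gradeInv_gradeInv (F : Ser) : gradeInv (gradeInv F) = F := ser_ext fun s e => by
  rw [gradeInv_apply, gradeInv_apply, ← mul_assoc, pSign_mul_self, one_mul]

theorem laur_eq_zero_of_eq_neg {p : Laur} (h : p = -p) : p = 0 := by
  have h2 : (2 : ℂ) • p = 0 := by
    rw [two_smul]; nth_rewrite 1 [h]; simp
  exact (smul_eq_zero.1 h2).resolve_left two_ne_zero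

/-- Parity as an eigenvalue condition for a ring endomorphism: parity of sums, products and images
can then be checked by rewriting. -/
theorem isEven_iff {F : Ser} : IsEven F ↔ gradeInv F = F := by
  constructor
  · intro h
    refine ser_ext fun s e => ?_
    rw [gradeInv_apply]
    by_cases hs : F s = 0
    · rw [cf_eq_zero_of_apply hs, mul_zero]
    · rw [pSign_even (h s hs), one_mul]
  · intro h s hs
    by_contra hodd
    rw [Nat.not_even_iff_odd] at hodd
    refine hs (apply_eq_zero_of_cf fun e => laur_eq_zero_of_eq_neg ?_)
    have := congrArg (cf · s e) h
    rw [gradeInv_apply, pSign_odd hodd] at this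
    exact this.symm.trans (by ring)

theorem isOdd_iff {F : Ser} : IsOdd F ↔ gradeInv F = -F := by
  constructor
  · intro h
    refine ser_ext fun s e => ?_
    rw [gradeInv_apply, cf_neg_apply]
    by_cases hs : F s = 0
    · rw [cf_eq_zero_of_apply hs, mul_zero, neg_zero]
    · rw [pSign_odd (h s hs)]; ring
  · intro h s hs
    by_contra hev
    rw [Nat.not_odd_iff_even] at hev
    refine hs (apply_eq_zero_of_cf fun e => laur_eq_zero_of_eq_neg ?_)
    have := congrArg (cf · s e) h
    rw [gradeInv_apply, pSign_even hev, one_mul, cf_neg_apply] at this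
    exact this

/-! ### Supercommutativity -/

theorem mul_apply_swap (F G : Ser) (s : Finset OddVar) (e : EvenVar →₀ ℕ) :
    cf (F * G) s e = ∑ t ∈ s.powerset, ∑ p ∈ antidiagonal e,
      sgn (s \ t) t * (cf F (s \ t) p.2 * cf G t p.1) := by
  rw [cf_mul_apply]
  refine sum_nbij' (fun t => s \ t) (fun t => s \ t) ?_ ?_ ?_ ?_ ?_
  · intro t _; simp
  · intro t _; simp
  · intro t ht; simpa using mem_powerset.1 ht
  · intro t ht; simpa using mem_powerset.1 ht
  · intro t ht
    have : s \ (s \ t) = t := by simpa using mem_powerset.1 ht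
    rw [this]
    refine sum_nbij' Prod.swap Prod.swap ?_ ?_ ?_ ?_ ?_ <;> simp [add_comm]

theorem even_mul_comm {F : Ser} (hF : IsEven F) (G : Ser) : F * G = G * F := by
  refine ser_ext fun s e => ?_
  rw [cf_mul_apply, mul_apply_swap]
  refine sum_congr rfl fun t _ => sum_congr rfl fun p _ => ?_
  by_cases h : F t = 0
  · rw [cf_eq_zero_of_apply h]; ring
  · rw [sgn_comm disjoint_sdiff, ← pSign_eq, pSign_even ((hF t h).mul_right _)]; ring

/-- Moving an odd factor past a monomial with k odd variables costs (−1)^k, which is what the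
grading involution does to that monomial. -/
theorem odd_mul_comm {F : Ser} (hF : IsOdd F) (G : Ser) : F * G = gradeInv G * F := by
  refine ser_ext fun s e => ?_
  rw [cf_mul_apply, mul_apply_swap]
  refine sum_congr rfl fun t _ => sum_congr rfl fun p _ => ?_
  by_cases h : F t = 0
  · rw [cf_eq_zero_of_apply h]; ring
  · have : pSign (t.card * (s \ t).card) = pSign (s \ t).card := by
      simp only [pSign, Nat.even_mul, Nat.not_even_iff_odd.2 (hF t h), false_or]
    rw [sgn_comm disjoint_sdiff, ← pSign_eq, this, gradeInv_apply]; ring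

/-! ## Differentiation and dilation of Laurent polynomials -/

/-- Takes bare functions with additivity hypotheses, so that it applies to `derivLaur` and
`scaleLaur` before they are bundled. -/
theorem laur_ext {M : Type*} [AddCommMonoid M] (f g : Laur → M)
    (hf : ∀ p q, f (p + q) = f p + f q) (hg : ∀ p q, g (p + q) = g p + g q)
    (h : ∀ a n, f (LaurentPolynomial.C a * LaurentPolynomial.T n) =
      g (LaurentPolynomial.C a * LaurentPolynomial.T n)) (p : Laur) : f p = g p := by
  induction p using LaurentPolynomial.induction_on' with
  | add p q hp hq => rw [hf, hg, hp, hq]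
  | C_mul_T n a => exact h a n

theorem derivLaur_add (p q : Laur) : derivLaur (p + q) = derivLaur p + derivLaur q := by
  rw [derivLaur, derivLaur, derivLaur, AddMonoidAlgebra.coeff_add, Finsupp.sum_add_index']
  · intro n; simp
  · intro n a b; rw [mul_add, map_add, add_mul]

theorem derivLaur_C_mul_T (a : Scal) (n : ℤ) :
    derivLaur (LaurentPolynomial.C a * LaurentPolynomial.T n) =
      LaurentPolynomial.C ((n : Scal) * a) * LaurentPolynomial.T (n - 1) := by
  rw [derivLaur, ← LaurentPolynomial.single_eq_C_mul_T, AddMonoidAlgebra.coeff_single,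
    Finsupp.sum_single_index]
  simp

/-- `derivLaur` as an additive map. -/
def derivLaurHom : Laur →+ Laur := AddMonoidHom.mk' derivLaur derivLaur_add

theorem derivLaur_mul (p q : Laur) : derivLaur (p * q) = derivLaur p * q + p * derivLaur q := by
  refine laur_ext (fun p => derivLaur (p * q)) (fun p => derivLaur p * q + p * derivLaur q)
    (fun p p' => by simp only [add_mul, derivLaur_add])
    (fun p p' => by simp only [add_mul, derivLaur_add]; ring) (fun a m => ?_) p
  refine laur_ext (fun q => derivLaur (LaurentPolynomial.C a * LaurentPolynomial.T m * q))
    (fun q => derivLaur (LaurentPolynomial.C a * LaurentPolynomial.T m) * q +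
      LaurentPolynomial.C a * LaurentPolynomial.T m * derivLaur q)
    (fun p p' => by simp only [mul_add, derivLaur_add])
    (fun p p' => by simp only [mul_add, derivLaur_add]; ring) (fun b n => ?_) q
  have h1 : (LaurentPolynomial.C a * LaurentPolynomial.T m *
      (LaurentPolynomial.C b * LaurentPolynomial.T n) : Laur) =
      LaurentPolynomial.C (a * b) * LaurentPolynomial.T (m + n) := by
    rw [map_mul, LaurentPolynomial.T_add]; ring
  have h2 : (LaurentPolynomial.T (m + n - 1) : Laur) =
      LaurentPolynomial.T (m - 1) * LaurentPolynomial.T n := by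
    rw [← LaurentPolynomial.T_add]; congr 1; ring
  have h3 : (LaurentPolynomial.T m * LaurentPolynomial.T (n - 1) : Laur) =
      LaurentPolynomial.T (m - 1) * LaurentPolynomial.T n := by
    rw [← LaurentPolynomial.T_add, ← LaurentPolynomial.T_add]; congr 1; ring
  rw [h1, derivLaur_C_mul_T, derivLaur_C_mul_T, derivLaur_C_mul_T, h2]
  have h4 : (LaurentPolynomial.C a * LaurentPolynomial.T m *
      (LaurentPolynomial.C ((n : Scal) * b) * LaurentPolynomial.T (n - 1)) : Laur) =
      LaurentPolynomial.C a * LaurentPolynomial.C ((n : Scal) * b) *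
        (LaurentPolynomial.T m * LaurentPolynomial.T (n - 1)) := by ring
  rw [h4, h3]
  simp only [map_mul, Int.cast_add, map_add]
  ring

theorem derivLaur_neg (p : Laur) : derivLaur (-p) = -derivLaur p := map_neg derivLaurHom p

theorem derivLaur_zero : derivLaur 0 = 0 := map_zero derivLaurHom

theorem derivLaur_C (a : Scal) : derivLaur (LaurentPolynomial.C a) = 0 := by
  have := derivLaur_C_mul_T a 0
  rw [LaurentPolynomial.T_zero, mul_one] at this
  rw [this]; simp

theorem derivLaur_one : derivLaur 1 = 0 := by
  rw [← map_one LaurentPolynomial.C, derivLaur_C]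

theorem derivLaur_T (n : ℤ) : derivLaur (LaurentPolynomial.T n) =
    LaurentPolynomial.C (n : Scal) * LaurentPolynomial.T (n - 1) := by
  have := derivLaur_C_mul_T 1 n
  rwa [map_one, one_mul, mul_one] at this

theorem derivLaur_C_mul (a : Scal) (p : Laur) :
    derivLaur (LaurentPolynomial.C a * p) = LaurentPolynomial.C a * derivLaur p := by
  rw [derivLaur_mul, derivLaur_C, zero_mul, zero_add]

theorem coeff_derivLaur (p : Laur) (n : ℤ) :
    (derivLaur p).coeff n = ((n + 1 : ℤ) : Scal) * p.coeff (n + 1) := by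
  refine laur_ext (fun p => (derivLaur p).coeff n)
    (fun p => ((n + 1 : ℤ) : Scal) * p.coeff (n + 1))
    (fun p q => by simp only [derivLaur_add, AddMonoidAlgebra.coeff_add, Finsupp.add_apply])
    (fun p q => by simp only [AddMonoidAlgebra.coeff_add, Finsupp.add_apply, mul_add])
    (fun a m => ?_) p
  rw [derivLaur_C_mul_T, ← LaurentPolynomial.single_eq_C_mul_T,
    ← LaurentPolynomial.single_eq_C_mul_T, AddMonoidAlgebra.coeff_single, Finsupp.single_apply,
    AddMonoidAlgebra.coeff_single, Finsupp.single_apply]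
  by_cases h : m = n + 1
  · subst h; simp
  · have : m - 1 ≠ n := by omega
    simp [h, this]

theorem scaleLaur_add (k : ℤ) (p q : Laur) :
    scaleLaur k (p + q) = scaleLaur k p + scaleLaur k q := by
  rw [scaleLaur, scaleLaur, scaleLaur, AddMonoidAlgebra.coeff_add, Finsupp.sum_add_index']
  · intro n; simp
  · intro n a b; rw [mul_add, map_add, add_mul]

theorem scaleLaur_C_mul_T (k : ℤ) (a : Scal) (n : ℤ) :
    scaleLaur k (LaurentPolynomial.C a * LaurentPolynomial.T n) =
      LaurentPolynomial.C (LaurentPolynomial.T (2 * k * n) * a) * LaurentPolynomial.T n := by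
  rw [scaleLaur, ← LaurentPolynomial.single_eq_C_mul_T, AddMonoidAlgebra.coeff_single,
    Finsupp.sum_single_index]
  simp

/-- `scaleLaur` as an additive map. -/
def scaleLaurAddHom (k : ℤ) : Laur →+ Laur := AddMonoidHom.mk' (scaleLaur k) (scaleLaur_add k)

theorem scaleLaur_mul (k : ℤ) (p q : Laur) :
    scaleLaur k (p * q) = scaleLaur k p * scaleLaur k q := by
  refine laur_ext (fun p => scaleLaur k (p * q)) (fun p => scaleLaur k p * scaleLaur k q)
    (fun p p' => by simp only [add_mul, scaleLaur_add])
    (fun p p' => by simp only [add_mul, scaleLaur_add]) (fun a m => ?_) p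
  refine laur_ext (fun q => scaleLaur k (LaurentPolynomial.C a * LaurentPolynomial.T m * q))
    (fun q => scaleLaur k (LaurentPolynomial.C a * LaurentPolynomial.T m) * scaleLaur k q)
    (fun p p' => by simp only [mul_add, scaleLaur_add])
    (fun p p' => by simp only [mul_add, scaleLaur_add]) (fun b n => ?_) q
  have h1 : (LaurentPolynomial.C a * LaurentPolynomial.T m *
      (LaurentPolynomial.C b * LaurentPolynomial.T n) : Laur) =
      LaurentPolynomial.C (a * b) * LaurentPolynomial.T (m + n) := by
    rw [map_mul, LaurentPolynomial.T_add]; ring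
  rw [h1, scaleLaur_C_mul_T, scaleLaur_C_mul_T, scaleLaur_C_mul_T, mul_add,
    LaurentPolynomial.T_add, LaurentPolynomial.T_add]
  simp only [map_mul]
  ring

/-- `scaleLaur` as a ring homomorphism. -/
def scaleLaurHom (k : ℤ) : Laur →+* Laur where
  toFun := scaleLaur k
  map_zero' := map_zero (scaleLaurAddHom k)
  map_add' := scaleLaur_add k
  map_mul' := scaleLaur_mul k
  map_one' := by
    have := scaleLaur_C_mul_T k 1 0
    rw [map_one, one_mul, mul_zero, LaurentPolynomial.T_zero, LaurentPolynomial.T_zero, mul_one,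
      mul_one] at this
    rw [this, map_one]

theorem scaleLaurHom_apply (k : ℤ) (p : Laur) : scaleLaurHom k p = scaleLaur k p := rfl

theorem scaleLaur_C (k : ℤ) (a : Scal) :
    scaleLaur k (LaurentPolynomial.C a) = LaurentPolynomial.C a := by
  have := scaleLaur_C_mul_T k a 0
  rwa [mul_zero, LaurentPolynomial.T_zero, LaurentPolynomial.T_zero, mul_one, one_mul,
    mul_one] at this

theorem scaleLaur_T (k n : ℤ) : scaleLaur k (LaurentPolynomial.T n) =
    LaurentPolynomial.C (LaurentPolynomial.T (2 * k * n)) * LaurentPolynomial.T n := by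
  have := scaleLaur_C_mul_T k 1 n
  rwa [map_one, one_mul, mul_one] at this

theorem coeff_scaleLaur (k : ℤ) (p : Laur) (n : ℤ) :
    (scaleLaur k p).coeff n = LaurentPolynomial.T (2 * k * n) * p.coeff n := by
  refine laur_ext (fun p => (scaleLaur k p).coeff n)
    (fun p => LaurentPolynomial.T (2 * k * n) * p.coeff n)
    (fun p q => by simp only [scaleLaur_add, AddMonoidAlgebra.coeff_add, Finsupp.add_apply])
    (fun p q => by simp only [AddMonoidAlgebra.coeff_add, Finsupp.add_apply, mul_add])
    (fun a m => ?_) p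
  rw [scaleLaur_C_mul_T, ← LaurentPolynomial.single_eq_C_mul_T,
    ← LaurentPolynomial.single_eq_C_mul_T, AddMonoidAlgebra.coeff_single, Finsupp.single_apply,
    AddMonoidAlgebra.coeff_single, Finsupp.single_apply]
  by_cases h : m = n
  · subst h; simp
  · simp [h]

theorem derivLaur_scaleLaur (k : ℤ) (p : Laur) : derivLaur (scaleLaur k p) =
    LaurentPolynomial.C (LaurentPolynomial.T (2 * k)) * scaleLaur k (derivLaur p) := by
  ext1 n
  rw [coeff_derivLaur, coeff_scaleLaur, ← LaurentPolynomial.smul_eq_C_mul,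
    AddMonoidAlgebra.coeff_smul_apply, coeff_scaleLaur, coeff_derivLaur, mul_add, mul_one,
    LaurentPolynomial.T_add, smul_eq_mul]
  ring

theorem ser_neg_mul (F G : Ser) : -F * G = -(F * G) := neg_mul F G
theorem ser_mul_neg (F G : Ser) : F * -G = -(F * G) := mul_neg F G
theorem ser_sub_mul (F G H : Ser) : (F - G) * H = F * H - G * H := sub_mul F G H
theorem ser_mul_sub (F G H : Ser) : F * (G - H) = F * G - F * H := mul_sub F G H

/-! ## The derivations `∂/∂x` and `∂/∂φ` -/

theorem cf_dx (F : Ser) (s : Finset OddVar) (e : EvenVar →₀ ℕ) :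
    cf (dx F) s e = derivLaur (cf F s e) := rfl

theorem cf_dphi (F : Ser) (s : Finset OddVar) (e : EvenVar →₀ ℕ) :
    cf (dphi F) s e = if OddVar.phi ∈ s then 0 else cf F (insert OddVar.phi s) e := by
  change (if OddVar.phi ∈ s then 0 else F (insert OddVar.phi s) : MvPowerSeries EvenVar Laur) e = _
  split_ifs <;> rfl

theorem cf_noPhi (F : Ser) (s : Finset OddVar) (e : EvenVar →₀ ℕ) :
    cf (noPhi F) s e = if OddVar.phi ∈ s then 0 else cf F s e := by
  change (if OddVar.phi ∈ s then 0 else F s : MvPowerSeries EvenVar Laur) e = _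
  split_ifs <;> rfl

theorem dx_add (F G : Ser) : dx (F + G) = dx F + dx G :=
  ser_ext fun s e => by simp [cf_dx, derivLaur_add]

theorem dx_smul (c : ℂ) (F : Ser) : dx (c • F) = c • dx F :=
  ser_ext fun s e => by
    rw [smul_eq_ofLaur, smul_eq_ofLaur, cf_dx, ofLaur_mul_apply, ofLaur_mul_apply,
      derivLaur_C_mul, cf_dx]

theorem dphi_add (F G : Ser) : dphi (F + G) = dphi F + dphi G :=
  ser_ext fun s e => by simp only [cf_dphi, cf_add_apply]; split_ifs <;> simp

theorem dphi_smul (c : ℂ) (F : Ser) : dphi (c • F) = c • dphi F :=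
  ser_ext fun s e => by simp only [cf_dphi, cf_smul_apply]; split_ifs <;> simp

/-- `dx` as a linear map. -/
def dxL : Ser →ₗ[ℂ] Ser := ⟨⟨dx, dx_add⟩, dx_smul⟩

/-- `dphi` as a linear map. -/
def dphiL : Ser →ₗ[ℂ] Ser := ⟨⟨dphi, dphi_add⟩, dphi_smul⟩

theorem dx_neg (F : Ser) : dx (-F) = -dx F := map_neg dxL F
theorem dx_sub (F G : Ser) : dx (F - G) = dx F - dx G := map_sub dxL F G
theorem dx_zero : dx 0 = 0 := map_zero dxL
theorem dphi_neg (F : Ser) : dphi (-F) = -dphi F := map_neg dphiL F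
theorem dphi_sub (F G : Ser) : dphi (F - G) = dphi F - dphi G := map_sub dphiL F G

theorem derivLaur_sgn_mul (s t : Finset OddVar) (p : Laur) :
    derivLaur (sgn s t * p) = sgn s t * derivLaur p := by
  rw [← map_sgn (LaurentPolynomial.C : Scal →+* Laur), derivLaur_C_mul]

theorem dx_mul (F G : Ser) : dx (F * G) = dx F * G + F * dx G := ser_ext fun s e => by
  rw [cf_dx, cf_add_apply, cf_mul_apply, cf_mul_apply, cf_mul_apply, ← sum_add_distrib]
  have h := fun (I : Finset (Finset OddVar)) f => map_sum derivLaurHom f I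
  have h' := fun (I : Finset ((EvenVar →₀ ℕ) × (EvenVar →₀ ℕ))) f => map_sum derivLaurHom f I
  refine (h _ _).trans (sum_congr rfl fun t _ => (h' _ _).trans ?_)
  rw [← sum_add_distrib]
  refine sum_congr rfl fun p _ => ?_
  change derivLaur _ = _
  rw [derivLaur_sgn_mul, derivLaur_mul, cf_dx, cf_dx]
  ring

theorem phi_mul_apply (F : Ser) (s : Finset OddVar) (e : EvenVar →₀ ℕ) :
    cf (phi * F) s e = if OddVar.phi ∈ s then cf F (s.erase OddVar.phi) e else 0 := by
  rw [cf_mul_apply]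
  have hphi : ∀ t f, cf phi t f = if t = {OddVar.phi} ∧ f = 0 then 1 else 0 := fun t f =>
    mono_apply _ _ _ _
  split_ifs with hs
  · rw [sum_eq_single {OddVar.phi}, sum_eq_single (0, e)]
    -- `φ` has rank 0, so no variable precedes it and no sign arises.
    · have h1 : (sgn {OddVar.phi} (s \ {OddVar.phi}) : Laur) = 1 := by
        simp only [sgn, prod_singleton]
        refine prod_eq_one fun b _ => if_neg ?_
        change ¬ (b.rank < 0)
        exact Nat.not_lt_zero _
      rw [h1, hphi, sdiff_singleton_eq_erase]; simp
    · rintro ⟨a, b⟩ hab hne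
      have ha : a ≠ 0 := by
        rintro rfl
        simp only [HasAntidiagonal.mem_antidiagonal, zero_add] at hab
        exact hne (by rw [hab])
      simp [hphi, ha]
    · simp
    · intro t _ ht
      simp [hphi, ht]
    · simp [hs]
  · refine sum_eq_zero fun t ht => sum_eq_zero fun p _ => ?_
    have : t ≠ {OddVar.phi} := by
      rintro rfl
      exact hs (by simpa using ht)
    simp [hphi, this]

/-- The decomposition f + φg; since φ² = 0, identities for `noPhi` and `dphi` are obtained by
expanding it. -/
theorem noPhi_add_phi_mul_dphi (F : Ser) : noPhi F + phi * dphi F = F := ser_ext fun s e => by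
  rw [cf_add_apply, cf_noPhi, phi_mul_apply, cf_dphi]
  split_ifs with h h'
  · simp at h'
  · simp [insert_erase h]
  · simp

theorem dphi_phi_mul (F : Ser) : dphi (phi * F) = noPhi F := ser_ext fun s e => by
  rw [cf_noPhi, cf_dphi, phi_mul_apply]
  split_ifs with h h'
  · rfl
  · simp [erase_insert h]
  · simp at h'

theorem noPhi_phi_mul (F : Ser) : noPhi (phi * F) = 0 := ser_ext fun s e => by
  rw [cf_noPhi, phi_mul_apply]
  split_ifs <;> rfl

theorem dphi_noPhi (F : Ser) : dphi (noPhi F) = 0 := ser_ext fun s e => by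
  rw [cf_dphi, cf_noPhi]
  split_ifs with h h'
  · rfl
  · rfl
  · simp at h'

theorem noPhi_dphi (F : Ser) : noPhi (dphi F) = dphi F := ser_ext fun s e => by
  rw [cf_noPhi, cf_dphi]
  split_ifs <;> rfl

theorem noPhi_noPhi (F : Ser) : noPhi (noPhi F) = noPhi F := ser_ext fun s e => by
  rw [cf_noPhi, cf_noPhi]
  split_ifs <;> rfl

theorem dphi_dphi (F : Ser) : dphi (dphi F) = 0 := by
  rw [← noPhi_dphi F, dphi_noPhi]

theorem noPhi_dx (F : Ser) : noPhi (dx F) = dx (noPhi F) := ser_ext fun s e => by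
  rw [cf_noPhi, cf_dx, cf_dx, cf_noPhi]
  split_ifs
  · rw [derivLaur_zero]
  · rfl

theorem dphi_dx (F : Ser) : dphi (dx F) = dx (dphi F) := ser_ext fun s e => by
  rw [cf_dphi, cf_dx, cf_dx, cf_dphi]
  split_ifs
  · rw [derivLaur_zero]
  · rfl

/-- `noPhi` as a ring homomorphism. -/
def noPhiHom : Ser →+* Ser :=
  diag (RingHom.id _) (fun s _ => if OddVar.phi ∈ s then 0 else 1)
    ⟨by simp, fun s t e f _ => by
      by_cases hs : OddVar.phi ∈ s <;> by_cases ht : OddVar.phi ∈ t <;> simp [hs, ht]⟩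

theorem noPhiHom_apply (F : Ser) : noPhiHom F = noPhi F := ser_ext fun s e => by
  rw [noPhiHom, diag_apply, cf_noPhi]
  split_ifs <;> simp

theorem noPhi_mul (F G : Ser) : noPhi (F * G) = noPhi F * noPhi G := by
  simp only [← noPhiHom_apply, map_mul]

theorem noPhi_add (F G : Ser) : noPhi (F + G) = noPhi F + noPhi G := by
  simp only [← noPhiHom_apply, map_add]

theorem noPhi_sub (F G : Ser) : noPhi (F - G) = noPhi F - noPhi G := by
  simp only [← noPhiHom_apply, map_sub]

theorem noPhi_neg (F : Ser) : noPhi (-F) = -noPhi F := by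
  simp only [← noPhiHom_apply, map_neg]

theorem isOdd_mono_singleton (θ : OddVar) : IsOdd (oddVar θ) := by
  intro s hs
  by_contra h
  refine hs (apply_eq_zero_of_cf fun e => ?_)
  rw [oddVar, mono_apply, if_neg]
  rintro ⟨rfl, -⟩
  simp at h

theorem isOdd_phi : IsOdd phi := isOdd_mono_singleton _

theorem gradeInv_phi : gradeInv phi = -phi := isOdd_iff.1 isOdd_phi

theorem phi_mul_eq (F : Ser) : phi * F = gradeInv F * phi := odd_mul_comm isOdd_phi F

theorem mul_phi_eq (F : Ser) : F * phi = phi * gradeInv F := by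
  rw [phi_mul_eq, gradeInv_gradeInv]

theorem phi_mul_phi : phi * phi = 0 := ser_ext fun s e => by
  rw [phi_mul_apply, phi, oddVar, mono_apply]
  split_ifs with h h'
  · have := h'.1.symm ▸ mem_singleton_self OddVar.phi
    simp at this
  · rfl
  · rfl

theorem gradeInv_noPhi (F : Ser) : gradeInv (noPhi F) = noPhi (gradeInv F) :=
  ser_ext fun s e => by
    rw [gradeInv_apply, cf_noPhi, cf_noPhi, gradeInv_apply]
    split_ifs <;> simp

theorem gradeInv_dphi (F : Ser) : gradeInv (dphi F) = -dphi (gradeInv F) :=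
  ser_ext fun s e => by
    rw [gradeInv_apply, cf_dphi, cf_neg_apply, cf_dphi, gradeInv_apply]
    split_ifs with h
    · simp
    · rw [card_insert_of_notMem h, pSign_add, pSign_odd odd_one]; ring

theorem gradeInv_dx (F : Ser) : gradeInv (dx F) = dx (gradeInv F) :=
  ser_ext fun s e => by
    rw [gradeInv_apply, cf_dx, cf_dx, gradeInv_apply, pSign]
    split_ifs
    · rw [one_mul, one_mul]
    · have : ∀ p : Laur, -1 * p = -p := fun p => by ring
      rw [this, this, derivLaur_neg]

theorem phi_mul_phi_mul (F : Ser) : phi * (phi * F) = 0 := by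
  rw [← mul_assoc, phi_mul_phi, zero_mul]

theorem phi_mul_noPhi (F : Ser) : phi * noPhi F = phi * F := by
  conv_rhs => rw [← noPhi_add_phi_mul_dphi F, mul_add, phi_mul_phi_mul, add_zero]

/-- The operator ∂/∂φ is odd, hence the grading involution where it passes the first factor. Both
sides are expanded in the form f + φg. -/
theorem dphi_mul (F G : Ser) : dphi (F * G) = dphi F * G + gradeInv F * dphi G := by
  have h0 : F * G = noPhi F * noPhi G +
      phi * (dphi F * noPhi G + gradeInv (noPhi F) * dphi G) := by
    conv_lhs => rw [← noPhi_add_phi_mul_dphi F, ← noPhi_add_phi_mul_dphi G]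
    have h1 : noPhi F * (phi * dphi G) = phi * (gradeInv (noPhi F) * dphi G) := by
      rw [← mul_assoc, mul_phi_eq, mul_assoc]
    have h2 : phi * dphi F * (phi * dphi G) = 0 := by
      rw [mul_assoc, ← mul_assoc (dphi F), mul_phi_eq, mul_assoc, phi_mul_phi_mul]
    rw [add_mul, mul_add, mul_add, h1, h2, mul_add, mul_assoc]
    abel
  have h3 : dphi F * G = dphi F * noPhi G + phi * (gradeInv (dphi F) * dphi G) := by
    conv_lhs => rw [← noPhi_add_phi_mul_dphi G]
    rw [mul_add, ← mul_assoc (dphi F), mul_phi_eq, mul_assoc]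
  have h4 : gradeInv F * dphi G = gradeInv (noPhi F) * dphi G -
      phi * (gradeInv (dphi F) * dphi G) := by
    conv_lhs => rw [← noPhi_add_phi_mul_dphi F]
    rw [map_add, map_mul, gradeInv_phi, add_mul, ser_neg_mul, ser_neg_mul, mul_assoc, sub_eq_add_neg]
  rw [h3, h4, h0, dphi_add, ← noPhi_mul, dphi_noPhi, dphi_phi_mul, zero_add, noPhi_add, noPhi_mul,
    noPhi_mul, noPhi_noPhi, noPhi_dphi, gradeInv_noPhi, noPhi_noPhi, noPhi_dphi]
  abel

theorem dx_ofLaur (p : Laur) : dx (ofLaur p) = ofLaur (derivLaur p) := ser_ext fun s e => by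
  rw [cf_dx, ofLaur_apply, ofLaur_apply]
  split_ifs
  · rfl
  · rw [derivLaur_zero]

theorem dphi_ofLaur (p : Laur) : dphi (ofLaur p) = 0 := ser_ext fun s e => by
  rw [cf_dphi, ofLaur_apply]
  split_ifs with h h'
  · rfl
  · exact absurd h'.1 (insert_ne_empty _ _)
  · rfl

theorem dx_mono (e : EvenVar →₀ ℕ) (s : Finset OddVar) : dx (mono e s) = 0 :=
  ser_ext fun t f => by
    rw [cf_dx, mono_apply]
    split_ifs
    · rw [derivLaur_one]; rfl
    · rw [derivLaur_zero]; rfl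

theorem dphi_mono (e : EvenVar →₀ ℕ) {s : Finset OddVar} (hs : OddVar.phi ∉ s) :
    dphi (mono e s) = 0 := ser_ext fun t f => by
  rw [cf_dphi, mono_apply]
  split_ifs with h h'
  · rfl
  · exact absurd (h'.1 ▸ mem_insert_self _ _) hs
  · rfl

theorem dx_phi : dx phi = 0 := dx_mono _ _

theorem dphi_phi : dphi phi = 1 := ser_ext fun s e => by
  rw [cf_dphi, phi, oddVar, mono_apply, cf_one_apply]
  by_cases h : OddVar.phi ∈ s
  · have : s ≠ ∅ := by rintro rfl; simp at h
    simp [h, this]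
  · have : insert OddVar.phi s = {OddVar.phi} ↔ s = ∅ := by
      constructor
      · intro h'
        have := congrArg (fun u => u.erase OddVar.phi) h'
        simpa [erase_insert h] using this
      · rintro rfl; rfl
    simp [h, this]

/-! ## Degrees -/

/-- The total degree in all variables except `φ`. -/
def deg (s : Finset OddVar) (e : EvenVar →₀ ℕ) : ℕ := degAM s e + degBN s e

theorem degAM_union {s t : Finset OddVar} (h : Disjoint s t) (e f : EvenVar →₀ ℕ) :
    degAM (s ∪ t) (e + f) = degAM s e + degAM t f := by
  rw [degAM, degAM, degAM, sum_union h, Finsupp.sum_add_index']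
  · ring
  · intro a; cases a <;> rfl
  · intro a m n; cases a <;> rfl

theorem degBN_union {s t : Finset OddVar} (h : Disjoint s t) (e f : EvenVar →₀ ℕ) :
    degBN (s ∪ t) (e + f) = degBN s e + degBN t f := by
  rw [degBN, degBN, degBN, sum_union h, Finsupp.sum_add_index']
  · ring
  · intro a; cases a <;> rfl
  · intro a m n; cases a <;> rfl

theorem deg_union {s t : Finset OddVar} (h : Disjoint s t) (e f : EvenVar →₀ ℕ) :
    deg (s ∪ t) (e + f) = deg s e + deg t f := by
  rw [deg, deg, deg, degAM_union h, degBN_union h]; ring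

theorem degAM_insert_phi (s : Finset OddVar) (e : EvenVar →₀ ℕ) :
    degAM (insert OddVar.phi s) e = degAM s e := by
  by_cases h : OddVar.phi ∈ s
  · rw [insert_eq_self.2 h]
  · rw [degAM, degAM, sum_insert h]; simp

theorem degBN_insert_phi (s : Finset OddVar) (e : EvenVar →₀ ℕ) :
    degBN (insert OddVar.phi s) e = degBN s e := by
  by_cases h : OddVar.phi ∈ s
  · rw [insert_eq_self.2 h]
  · rw [degBN, degBN, sum_insert h]; simp

theorem deg_insert_phi (s : Finset OddVar) (e : EvenVar →₀ ℕ) :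
    deg (insert OddVar.phi s) e = deg s e := by
  rw [deg, deg, degAM_insert_phi, degBN_insert_phi]

/-- All terms of `F` have degree at least `d`. -/
def Van (d : ℕ) (F : Ser) : Prop := ∀ s e, deg s e < d → cf F s e = 0

theorem Van.mono {d d' : ℕ} {F : Ser} (h : Van d F) (hd : d' ≤ d) : Van d' F :=
  fun s e hs => h s e (hs.trans_le hd)

theorem van_zero (F : Ser) : Van 0 F := fun _ _ h => absurd h (Nat.not_lt_zero _)

theorem Van.add {d : ℕ} {F G : Ser} (hF : Van d F) (hG : Van d G) : Van d (F + G) :=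
  fun s e h => by rw [cf_add_apply, hF s e h, hG s e h, add_zero]

theorem Van.neg {d : ℕ} {F : Ser} (hF : Van d F) : Van d (-F) :=
  fun s e h => by rw [cf_neg_apply, hF s e h]; simp

theorem Van.sub {d : ℕ} {F G : Ser} (hF : Van d F) (hG : Van d G) : Van d (F - G) :=
  fun s e h => by rw [cf_sub_apply, hF s e h, hG s e h, sub_zero]

theorem Van.smul {d : ℕ} {F : Ser} (hF : Van d F) (c : ℂ) : Van d (c • F) :=
  fun s e h => by rw [cf_smul_apply, hF s e h, smul_zero]

theorem Van.mul {d d' : ℕ} {F G : Ser} (hF : Van d F) (hG : Van d' G) : Van (d + d') (F * G) := by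
  intro s e h
  rw [cf_mul_apply]
  refine sum_eq_zero fun t ht => sum_eq_zero fun p hp => ?_
  have hd : deg s e = deg t p.1 + deg (s \ t) p.2 := by
    rw [← deg_union disjoint_sdiff, union_sdiff_of_subset (mem_powerset.1 ht),
      HasAntidiagonal.mem_antidiagonal.1 hp]
  rcases lt_or_ge (deg t p.1) d with h1 | h1
  · rw [hF _ _ h1]; ring
  · rw [hG (s \ t) p.2 (by omega)]; ring

theorem Van.mul_left {d : ℕ} {F : Ser} (hF : Van d F) (G : Ser) : Van d (G * F) := by
  simpa using (van_zero G).mul hF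

theorem Van.dx {d : ℕ} {F : Ser} (hF : Van d F) : Van d (dx F) :=
  fun s e h => by rw [cf_dx, hF s e h, derivLaur_zero]

theorem Van.dphi {d : ℕ} {F : Ser} (hF : Van d F) : Van d (dphi F) := fun s e h => by
  rw [cf_dphi]
  split_ifs
  · rfl
  · exact hF _ _ (by rwa [deg_insert_phi])

theorem eq_zero_of_van {F : Ser} (h : ∀ d, Van d F) : F = 0 :=
  ser_ext fun s e => h (deg s e + 1) s e (Nat.lt_succ_self _)

theorem eq_of_van {F G : Ser} (h : ∀ d, Van d (F - G)) : F = G :=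
  sub_eq_zero.1 (eq_zero_of_van h)

/-- `F` has no term at the divisors of the monomial `(s, e)`, up to powers of `φ`. -/
def VanBelow (s : Finset OddVar) (e : EvenVar →₀ ℕ) (F : Ser) : Prop :=
  ∀ s' e', s' ⊆ insert OddVar.phi s → e' ≤ e → cf F s' e' = 0

/-- The coefficients of `σ F` at a monomial depend only on those of `F` at its divisors. -/
def IsLocal (σ : Ser → Ser) : Prop := ∀ s e F, VanBelow s e F → VanBelow s e (σ F)

theorem VanBelow.add {s : Finset OddVar} {e : EvenVar →₀ ℕ} {F G : Ser} (hF : VanBelow s e F)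
    (hG : VanBelow s e G) : VanBelow s e (F + G) :=
  fun s' e' h h' => by rw [cf_add_apply, hF s' e' h h', hG s' e' h h', add_zero]

theorem VanBelow.neg {s : Finset OddVar} {e : EvenVar →₀ ℕ} {F : Ser} (hF : VanBelow s e F) :
    VanBelow s e (-F) :=
  fun s' e' h h' => by rw [cf_neg_apply, hF s' e' h h']; simp

theorem VanBelow.smul {s : Finset OddVar} {e : EvenVar →₀ ℕ} {F : Ser} (hF : VanBelow s e F)
    (c : ℂ) : VanBelow s e (c • F) :=
  fun s' e' h h' => by rw [cf_smul_apply, hF s' e' h h', smul_zero]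

theorem VanBelow.mul_left {s : Finset OddVar} {e : EvenVar →₀ ℕ} {F : Ser} (hF : VanBelow s e F)
    (G : Ser) : VanBelow s e (G * F) := by
  intro s' e' h h'
  rw [cf_mul_apply]
  refine sum_eq_zero fun t ht => sum_eq_zero fun p hp => ?_
  have h2 : p.2 ≤ e' := by
    rw [← HasAntidiagonal.mem_antidiagonal.1 hp]; exact le_add_self
  rw [hF (s' \ t) p.2 (sdiff_subset.trans h) (h2.trans h')]
  ring

theorem VanBelow.dx {s : Finset OddVar} {e : EvenVar →₀ ℕ} {F : Ser} (hF : VanBelow s e F) :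
    VanBelow s e (dx F) :=
  fun s' e' h h' => by rw [cf_dx, hF s' e' h h', derivLaur_zero]

/-- This is why `VanBelow` adjoins φ to the monomial: ∂/∂φ reads a coefficient at a monomial
containing one more φ. -/
theorem VanBelow.dphi {s : Finset OddVar} {e : EvenVar →₀ ℕ} {F : Ser} (hF : VanBelow s e F) :
    VanBelow s e (dphi F) := fun s' e' h h' => by
  rw [cf_dphi]
  split_ifs
  · rfl
  · exact hF _ _ (insert_subset (mem_insert_self _ _) h) h'

theorem isLocal_diag (h : Laur →+* Laur) (w : Finset OddVar → (EvenVar →₀ ℕ) → Laur)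
    (hw : IsWeight w) : IsLocal (diag h w hw) := fun s e F hF s' e' h h' => by
  rw [diag_apply, hF s' e' h h', map_zero, mul_zero]

/-! ## Formal sums -/

theorem cf_formalSum {ι : Type*} (F : ι → Ser) (s : Finset OddVar) (e : EvenVar →₀ ℕ) :
    cf (formalSum F) s e = ∑ᶠ i, cf (F i) s e := rfl

theorem FormallySummable.add {ι : Type*} {F G : ι → Ser} (hF : FormallySummable F)
    (hG : FormallySummable G) : FormallySummable fun i => F i + G i := fun s e =>
  ((hF s e).union (hG s e)).subset (Function.support_add _ _)

theorem FormallySummable.of_apply_eq_zero {ι : Type*} {F G : ι → Ser} (hF : FormallySummable F)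
    (h : ∀ i s e, cf (F i) s e = 0 → cf (G i) s e = 0) : FormallySummable G := fun s e =>
  (hF s e).subset fun i hi hi' => hi (h i s e hi')

/-- A monomial has finitely many factorizations, and each left factor receives finitely many
contributions. -/
theorem FormallySummable.mul_right {ι : Type*} {F : ι → Ser} (hF : FormallySummable F) (G : Ser) :
    FormallySummable fun i => F i * G := by
  intro s e
  refine ((s.powerset.finite_toSet).biUnion fun t _ =>
    ((antidiagonal e).finite_toSet).biUnion fun p _ => hF t p.1).subset fun i hi => ?_
  by_contra hne
  refine hi ?_
  change cf (F i * G) s e = 0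
  rw [cf_mul_apply]
  refine sum_eq_zero fun t ht => sum_eq_zero fun p hp => ?_
  have : cf (F i) t p.1 = 0 := by
    by_contra h
    exact hne (Set.mem_biUnion ht (Set.mem_biUnion hp h))
  rw [this]; ring

theorem formalSum_mul {ι : Type*} {F : ι → Ser} (hF : FormallySummable F) (G : Ser) :
    formalSum F * G = formalSum fun i => F i * G := ser_ext fun s e => by
  rw [cf_mul_apply, cf_formalSum]
  have hfin : ∀ (t : Finset OddVar) (p : (EvenVar →₀ ℕ) × (EvenVar →₀ ℕ)),
      (Function.support fun i => sgn t (s \ t) *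
      (cf (F i) t p.1 * cf G (s \ t) p.2)).Finite := fun t p =>
    (hF t p.1).subset fun i hi hi' => hi (by
      dsimp only
      rw [show cf (F i) t p.1 = 0 from hi', zero_mul, mul_zero])
  simp only [cf_mul_apply]
  rw [finsum_sum_comm]
  · refine sum_congr rfl fun t _ => ?_
    rw [finsum_sum_comm _ _ fun p _ => hfin t p]
    refine sum_congr rfl fun p _ => ?_
    rw [cf_formalSum, finsum_mul' (fun i => cf (F i) t p.1) _ (hF t p.1), mul_finsum']
    exact (hF t p.1).subset fun i hi hi' => hi (by
      dsimp only
      rw [show cf (F i) t p.1 = 0 from hi', zero_mul])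
  · intro t _
    refine (((antidiagonal e).finite_toSet).biUnion fun p _ => hfin t p).subset fun i hi => ?_
    by_contra hne
    exact hi (sum_eq_zero fun p hp => by
      by_contra h
      exact hne (Set.mem_biUnion hp h))

theorem formalSum_add {ι : Type*} {F G : ι → Ser} (hF : FormallySummable F)
    (hG : FormallySummable G) :
    (formalSum fun i => F i + G i) = formalSum F + formalSum G := ser_ext fun s e => by
  rw [cf_add_apply, cf_formalSum, cf_formalSum, cf_formalSum]
  exact finsum_add_distrib (hF s e) (hG s e)

theorem formalSum_neg {ι : Type*} (F : ι → Ser) :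
    (formalSum fun i => -F i) = -formalSum F := ser_ext fun s e => by
  rw [cf_neg_apply, cf_formalSum, cf_formalSum, ← finsum_neg_distrib]
  rfl

theorem dx_formalSum {ι : Type*} {F : ι → Ser} (hF : FormallySummable F) :
    dx (formalSum F) = formalSum fun i => dx (F i) := ser_ext fun s e => by
  rw [cf_dx, cf_formalSum, cf_formalSum]
  exact derivLaurHom.map_finsum (hF s e)

/-! ## Superconformal vector fields -/

/-- The even superconformal vector field
`-(a ∂/∂x + (1/2) a' φ ∂/∂φ + m (∂/∂φ - φ ∂/∂x))`, for `a` even and `m` odd. -/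
def vec (a m : Ser) : Ser →ₗ[ℂ] Ser where
  toFun F := -(a * dx F + (1 / 2 : ℂ) • (phi * (dx a * dphi F)) + m * (dphi F - phi * dx F))
  map_add' F G := by
    simp only [dx_add, dphi_add, mul_add, smul_add, ser_mul_sub]
    abel
  map_smul' c F := by
    simp only [dx_smul, dphi_smul, mul_smul_comm, RingHom.id_apply, smul_neg, smul_add,
      ser_mul_sub, smul_sub, smul_comm c (1 / 2 : ℂ)]

theorem vec_apply (a m F : Ser) : vec a m F =
    -(a * dx F + (1 / 2 : ℂ) • (phi * (dx a * dphi F)) + m * (dphi F - phi * dx F)) := rfl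

theorem IsEven.dx {F : Ser} (h : IsEven F) : IsEven (dx F) := by
  rw [isEven_iff] at h ⊢; rw [gradeInv_dx, h]

theorem IsOdd.dx {F : Ser} (h : IsOdd F) : IsOdd (dx F) := by
  rw [isOdd_iff] at h ⊢; rw [gradeInv_dx, h, dx_neg]

/-- The field is even, so the Leibniz rule carries no sign: the sign produced by ∂/∂φ passing F is
undone when the odd coefficient φ or m passes F as well. -/
theorem vec_mul {a m : Ser} (ha : IsEven a) (hm : IsOdd m) (F G : Ser) :
    vec a m (F * G) = vec a m F * G + F * vec a m G := by
  have h1 : a * (F * dx G) = F * (a * dx G) := by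
    rw [← mul_assoc, even_mul_comm ha, mul_assoc]
  have h2 : phi * (dx a * (gradeInv F * dphi G)) = F * (phi * (dx a * dphi G)) := by
    rw [← mul_assoc (dx a), even_mul_comm ha.dx, ← mul_assoc, ← mul_assoc, ← mul_phi_eq]
    simp only [mul_assoc]
  have h3 : ∀ K, m * (gradeInv F * K) = F * (m * K) := fun K => by
    rw [← mul_assoc, odd_mul_comm hm, gradeInv_gradeInv, mul_assoc]
  have h4 : phi * (F * dx G) = gradeInv F * (phi * dx G) := by
    rw [← mul_assoc, phi_mul_eq, mul_assoc]
  simp only [vec_apply, dx_mul, dphi_mul, mul_add, add_mul, ser_mul_sub, ser_sub_mul, ser_neg_mul,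
    ser_mul_neg, smul_add, h1, h2, h3, h4, smul_mul_assoc, mul_smul_comm, mul_assoc]
  abel

theorem vec_van {a m : Ser} (ha : Van 1 a) (hm : Van 1 m) {d : ℕ} {F : Ser} (hF : Van d F) :
    Van (d + 1) (vec a m F) := by
  rw [vec_apply, add_comm d]
  exact (((ha.mul hF.dx).add (((ha.dx.mul hF.dphi).mul_left _).smul _)).add
    (hm.mul (hF.dphi.sub (hF.dx.mul_left _)))).neg

theorem vec_local (a m : Ser) : IsLocal (vec a m) := fun s e F hF => by
  rw [vec_apply, sub_eq_add_neg]
  exact (((hF.dx.mul_left _).add (((hF.dphi.mul_left _).mul_left _).smul _)).add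
    ((hF.dphi.add (hF.dx.mul_left _).neg).mul_left _)).neg

theorem vec_mono (a m : Ser) (e : EvenVar →₀ ℕ) {s : Finset OddVar} (hs : OddVar.phi ∉ s) :
    vec a m (mono e s) = 0 := by
  rw [vec_apply, dx_mono, dphi_mono e hs]; simp

theorem vec_ofLaur_C (a m : Ser) (c : Scal) : vec a m (ofLaur (LaurentPolynomial.C c)) = 0 := by
  rw [vec_apply, dx_ofLaur, dphi_ofLaur, derivLaur_C, ofLaur_zero]; simp

theorem gradeInv_vec {a m : Ser} (ha : IsEven a) (hm : IsOdd m) (F : Ser) :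
    gradeInv (vec a m F) = vec a m (gradeInv F) := by
  have hs : ∀ (c : ℂ) G, gradeInv (c • G) = c • gradeInv G := fun c G => ser_ext fun s e => by
    rw [gradeInv_apply, cf_smul_apply, cf_smul_apply, gradeInv_apply, mul_smul_comm]
  rw [vec_apply, vec_apply]
  simp only [map_neg, map_add, map_sub, map_mul, hs, gradeInv_phi, gradeInv_dx, gradeInv_dphi,
    isEven_iff.1 ha, isOdd_iff.1 hm, ser_neg_mul, ser_mul_neg, neg_neg, ser_mul_sub]

/-- The odd derivation `∂/∂φ + φ ∂/∂x`. -/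
def superD : Ser →ₗ[ℂ] Ser where
  toFun F := dphi F + phi * dx F
  map_add' F G := by simp only [dx_add, dphi_add, mul_add]; abel
  map_smul' c F := by
    simp only [dx_smul, dphi_smul, mul_smul_comm, RingHom.id_apply, smul_add]

theorem superD_apply (F : Ser) : superD F = dphi F + phi * dx F := rfl

/-- Infinitesimal superconformality: the commutator of D = ∂/∂φ + φ∂/∂x with the field is a multiple
of D. Exponentiating this gives the chain rule `superD_sewHom`. -/
theorem superD_vec {a m : Ser} (ha : IsEven a) (hm : IsOdd m) (ha' : dphi a = 0) (hm' : dphi m = 0)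
    (F : Ser) : superD (vec a m F) =
      vec a m (superD F) + -((1 / 2 : ℂ) • dx a + phi * dx m) * superD F := by
  have c1 : ∀ K, a * (phi * K) = phi * (a * K) := fun K => by
    rw [← mul_assoc, even_mul_comm ha, mul_assoc]
  have c2 : ∀ K, dx a * (phi * K) = phi * (dx a * K) := fun K => by
    rw [← mul_assoc, even_mul_comm ha.dx, mul_assoc]
  have c3 : ∀ K, m * (phi * K) = -(phi * (m * K)) := fun K => by
    rw [← mul_assoc, mul_phi_eq, isOdd_iff.1 hm, ser_mul_neg, ser_neg_mul, mul_assoc]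
  have c4 : ∀ K, dx m * (phi * K) = -(phi * (dx m * K)) := fun K => by
    rw [← mul_assoc, mul_phi_eq, isOdd_iff.1 hm.dx, ser_mul_neg, ser_neg_mul, mul_assoc]
  have n1 : noPhi (dx a * dphi F) = dx a * dphi F := by
    rw [noPhi_mul, noPhi_dphi, noPhi_dx]
    congr 2
    conv_rhs => rw [← noPhi_add_phi_mul_dphi a, ha', mul_zero, add_zero]
  have n3 : noPhi m = m := by
    conv_rhs => rw [← noPhi_add_phi_mul_dphi m, hm', mul_zero, add_zero]
  have n2 : phi * (dx a * noPhi (dx F)) = phi * (dx a * dx F) := by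
    rw [← c2, phi_mul_noPhi, c2]
  simp only [superD_apply, vec_apply, dphi_add, dphi_neg, dphi_sub, dphi_smul, dphi_mul a,
    dphi_mul m, dphi_phi_mul, dx_add, dx_neg, dx_sub, dx_smul, dx_mul, dphi_dphi, ha', hm',
    isEven_iff.1 ha, isOdd_iff.1 hm, n1, n2, dx_phi, zero_mul, zero_add, mul_add, add_mul,
    ser_neg_mul, ser_mul_neg, ser_mul_sub, phi_mul_phi_mul, c1, c2, c3, c4,
    smul_mul_assoc, mul_smul_comm, smul_add, mul_assoc, mul_zero, sub_zero, zero_sub, dphi_dx,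
    neg_neg, neg_zero, add_zero, smul_zero]
  rw [noPhi_mul, n3]
  -- All products are now in a normal order; naming them leaves a ℂ-linear identity.
  generalize phi * (dx a * dx F) = u
  generalize phi * (m * dx (dphi F)) = v
  generalize phi * (dx m * dphi F) = w
  generalize phi * (a * dx (dx F)) = y
  module

/-! ## Exponentials of degree raising operators -/

/-- `T` raises degrees. -/
def Raising (T : Ser →ₗ[ℂ] Ser) : Prop := ∀ d F, Van d F → Van (d + 1) (T F)

theorem Raising.iterate {T : Ser →ₗ[ℂ] Ser} (hT : Raising T) (n : ℕ) {d : ℕ} {F : Ser}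
    (hF : Van d F) : Van (d + n) (T^[n] F) := by
  induction n with
  | zero => exact hF
  | succ n ih =>
    rw [Function.iterate_succ_apply']
    exact hT _ _ ih

theorem Raising.neg {T : Ser →ₗ[ℂ] Ser} (hT : Raising T) : Raising (-T) :=
  fun d F hF => (hT d F hF).neg

/-- The `n`-th term of the exponential series. -/
def expTerm (T : Ser →ₗ[ℂ] Ser) (F : Ser) (n : ℕ) : Ser := ((n.factorial : ℂ)⁻¹) • (T^[n] F)

theorem expTerm_van {T : Ser →ₗ[ℂ] Ser} (hT : Raising T) {d : ℕ} {F : Ser} (hF : Van d F) (n : ℕ) :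
    Van (d + n) (expTerm T F n) := (hT.iterate n hF).smul _

theorem expTerm_van' {T : Ser →ₗ[ℂ] Ser} (hT : Raising T) (F : Ser) (n : ℕ) :
    Van n (expTerm T F n) := by
  simpa using expTerm_van hT (van_zero F) n

theorem expOp_eq (T : Ser →ₗ[ℂ] Ser) (F : Ser) : expOp T F = formalSum (expTerm T F) := rfl

/-- The n-th term has degree at least n, so a fixed coefficient sees only a finite partial sum. This
reduces the theory of the formal exponential to finite sums. -/
theorem cf_expOp {T : Ser →ₗ[ℂ] Ser} (hT : Raising T) (F : Ser) {s : Finset OddVar}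
    {e : EvenVar →₀ ℕ} {N : ℕ} (hN : deg s e < N) :
    cf (expOp T F) s e = cf (∑ n ∈ range N, expTerm T F n) s e := by
  rw [expOp_eq, cf_formalSum, cf_sum_apply]
  refine finsum_eq_sum_of_support_subset _ fun n hn => ?_
  by_contra h
  exact hn (expTerm_van' hT F n s e (by simp at h; omega))

theorem expOp_sub_van {T : Ser →ₗ[ℂ] Ser} (hT : Raising T) (F : Ser) (N : ℕ) :
    Van N (expOp T F - ∑ n ∈ range N, expTerm T F n) := fun s e h => by
  rw [cf_sub_apply, cf_expOp hT F h, sub_self]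

theorem van_sum {ι : Type*} (I : Finset ι) {F : ι → Ser} {d : ℕ} (h : ∀ i ∈ I, Van d (F i)) :
    Van d (∑ i ∈ I, F i) := fun s e hs => by
  rw [cf_sum_apply]
  exact sum_eq_zero fun i hi => h i hi s e hs

/-- `expOp T` as a linear map. -/
def expLin (T : Ser →ₗ[ℂ] Ser) (hT : Raising T) : Ser →ₗ[ℂ] Ser where
  toFun := expOp T
  map_add' F G := ser_ext fun s e => by
    have h := Nat.lt_succ_self (deg s e)
    rw [cf_add_apply, cf_expOp hT _ h, cf_expOp hT _ h, cf_expOp hT _ h, ← cf_add_apply,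
      ← sum_add_distrib]
    congr 2
    funext n
    rw [expTerm, expTerm, expTerm, ← smul_add, iterate_map_add]
  map_smul' c F := ser_ext fun s e => by
    have h := Nat.lt_succ_self (deg s e)
    rw [RingHom.id_apply, cf_smul_apply, cf_expOp hT _ h, cf_expOp hT _ h, ← cf_smul_apply,
      smul_sum]
    congr 2
    funext n
    rw [expTerm, expTerm, smul_comm c]
    congr 1
    have : ∀ n, T^[n] (c • F) = c • T^[n] F := fun n => by
      induction n with
      | zero => rfl
      | succ n ih =>
        rw [Function.iterate_succ_apply', Function.iterate_succ_apply', ih, map_smul]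
    exact this n

theorem expLin_apply (T : Ser →ₗ[ℂ] Ser) (hT : Raising T) (F : Ser) :
    expLin T hT F = expOp T F := rfl

theorem expOp_sub {T : Ser →ₗ[ℂ] Ser} (hT : Raising T) (F G : Ser) :
    expOp T (F - G) = expOp T F - expOp T G := map_sub (expLin T hT) F G

theorem expOp_van {T : Ser →ₗ[ℂ] Ser} (hT : Raising T) {d : ℕ} {F : Ser} (hF : Van d F) :
    Van d (expOp T F) := fun s e h => by
  rw [cf_expOp hT F h]
  exact van_sum _ (fun n _ => (expTerm_van hT hF n).mono (Nat.le_add_right _ _)) s e h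

/-- Only the term n = 0 fails to raise the degree. All the statements `IsDeform` rest on this. -/
theorem expOp_sub_self_van {T : Ser →ₗ[ℂ] Ser} (hT : Raising T) {d : ℕ} {F : Ser} (hF : Van d F) :
    Van (d + 1) (expOp T F - F) := fun s e h => by
  rw [cf_sub_apply, cf_expOp hT F h, sum_range_succ', cf_add_apply]
  have h0 : expTerm T F 0 = F := by simp [expTerm]
  rw [h0, van_sum _ (fun n _ => (expTerm_van hT hF (n + 1)).mono (by omega)) s e h, zero_add,
    sub_self]

theorem expOp_of_eq_zero {T : Ser →ₗ[ℂ] Ser} (hT : Raising T) {F : Ser} (h : T F = 0) :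
    expOp T F = F := ser_ext fun s e => by
  rw [cf_expOp hT F (Nat.lt_succ_self _), sum_range_succ', sum_eq_zero]
  · simp [expTerm]
  · intro n _
    rw [expTerm, Function.iterate_succ_apply, h]
    have : ∀ n, T^[n] 0 = 0 := fun n => by
      induction n with
      | zero => rfl
      | succ n ih => rw [Function.iterate_succ_apply, map_zero, ih]
    rw [this, smul_zero]

/-- A closed linear condition stable under T passes to the exponential; `hP` says that P is closed
for the topology of the degree filtration. -/
theorem expOp_mem {T : Ser →ₗ[ℂ] Ser} (hT : Raising T) {F : Ser} (P : Ser → Prop)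
    (hP : ∀ G, (∀ N, ∃ G', P G' ∧ Van N (G - G')) → P G) (hadd : ∀ G G', P G → P G' → P (G + G'))
    (hsmul : ∀ (c : ℂ) G, P G → P (c • G)) (hF : P F) (hTP : ∀ G, P G → P (T G)) :
    P (expOp T F) := by
  have hit : ∀ n, P (expTerm T F n) := fun n => by
    refine hsmul _ _ ?_
    induction n with
    | zero => exact hF
    | succ n ih => rw [Function.iterate_succ_apply']; exact hTP _ ih
  refine hP _ fun N => ⟨_, ?_, expOp_sub_van hT F N⟩
  refine sum_induction _ P hadd ?_ fun n _ => hit n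
  simpa using hsmul 0 F hF

theorem expOp_local {T : Ser →ₗ[ℂ] Ser} (hT : Raising T) (hl : IsLocal T) : IsLocal (expOp T) := by
  intro s e F hF
  refine expOp_mem hT (VanBelow s e) ?_ (fun _ _ => VanBelow.add) (fun c _ h => h.smul c) hF
    (fun G => hl s e G)
  intro G hG s' e' h h'
  obtain ⟨G', h1, h2⟩ := hG (deg s' e' + 1)
  have := h2 s' e' (Nat.lt_succ_self _)
  rwa [cf_sub_apply, h1 s' e' h h', sub_zero] at this

/-! ### Products and composites of exponential series -/

theorem sum_range_range_eq {M : Type*} [AddCommMonoid M] (N : ℕ) (f : ℕ → ℕ → M)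
    (hf : ∀ k l, N ≤ k + l → f k l = 0) :
    ∑ k ∈ range N, ∑ l ∈ range N, f k l =
      ∑ n ∈ range N, ∑ p ∈ antidiagonal n, f p.1 p.2 := by
  rw [← sum_product', sum_sigma']
  have : ∑ x ∈ range N ×ˢ range N, f x.1 x.2 =
      ∑ x ∈ (range N ×ˢ range N).filter (fun x => x.1 + x.2 < N), f x.1 x.2 := by
    rw [sum_filter]
    refine sum_congr rfl fun x _ => ?_
    split_ifs with h
    · rfl
    · exact hf _ _ (not_lt.1 h)
  rw [this]
  refine sum_nbij' (fun x => ⟨x.1 + x.2, x⟩) (fun y => y.2) ?_ ?_ ?_ ?_ ?_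
  · rintro ⟨k, l⟩ h; simp at h ⊢; omega
  · rintro ⟨n, k, l⟩ h; simp at h ⊢; omega
  · intro _ _; rfl
  · rintro ⟨n, k, l⟩ h
    simp at h ⊢; omega
  · intro _ _; rfl

/-- The binomial theorem for an operator S that is a derivation along T. Besides S = T, the case S =
`twist a m`, T = −`vec a m` is needed. -/
theorem expTerm_mul {S T : Ser →ₗ[ℂ] Ser} (h : ∀ F G, S (F * G) = T F * G + F * S G) (F G : Ser)
    (n : ℕ) : expTerm S (F * G) n = ∑ p ∈ antidiagonal n, expTerm T F p.1 * expTerm S G p.2 := by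
  have hit : S^[n] (F * G) =
      ∑ p ∈ antidiagonal n, (n.choose p.1) • (T^[p.1] F * S^[p.2] G) := by
    induction n with
    | zero => simp
    | succ n ih =>
      rw [Function.iterate_succ_apply', ih, map_sum,
        sum_antidiagonal_choose_succ_nsmul (fun i j => T^[i] F * S^[j] G) n, ← sum_add_distrib]
      refine sum_congr rfl fun p hp => ?_
      have hp' : n.choose p.2 = n.choose p.1 := by
        rw [← Nat.choose_symm_of_eq_add (HasAntidiagonal.mem_antidiagonal.1 hp).symm]
      rw [map_nsmul, h, hp', Function.iterate_succ_apply', Function.iterate_succ_apply', nsmul_add,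
        add_comm]
  rw [expTerm, hit, smul_sum]
  refine sum_congr rfl fun p hp => ?_
  rw [expTerm, expTerm, smul_mul_smul_comm, ← Nat.cast_smul_eq_nsmul ℂ, smul_smul]
  congr 1
  have hp := HasAntidiagonal.mem_antidiagonal.1 hp
  have h1 : p.1 ≤ n := by omega
  have h2 : n - p.1 = p.2 := by omega
  have h3 : ((n.choose p.1 : ℕ) : ℂ) * p.1.factorial * p.2.factorial = n.factorial := by
    rw [← h2]; exact_mod_cast Nat.choose_mul_factorial_mul_factorial h1
  have f0 : (n.factorial : ℂ) ≠ 0 := by exact_mod_cast n.factorial_ne_zero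
  have f1 : (p.1.factorial : ℂ) ≠ 0 := by exact_mod_cast p.1.factorial_ne_zero
  have f2 : (p.2.factorial : ℂ) ≠ 0 := by exact_mod_cast p.2.factorial_ne_zero
  field_simp
  rw [← h3]

theorem expOp_mul {S T : Ser →ₗ[ℂ] Ser} (hS : Raising S) (hT : Raising T)
    (h : ∀ F G, S (F * G) = T F * G + F * S G) (F G : Ser) :
    expOp S (F * G) = expOp T F * expOp S G := ser_ext fun s e => by
  set N := deg s e + 1 with hN
  have hlt : deg s e < N := Nat.lt_succ_self _
  set A := ∑ n ∈ range N, expTerm T F n with hA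
  set B := ∑ n ∈ range N, expTerm S G n with hB
  have h1 : cf (expOp T F * expOp S G) s e = cf (A * B) s e := by
    have e1 : expOp T F * expOp S G - A * B =
        (expOp T F - A) * expOp S G + A * (expOp S G - B) := by
      rw [ser_sub_mul, ser_mul_sub]; abel
    have e2 : Van N (expOp T F * expOp S G - A * B) := by
      rw [e1]
      exact ((expOp_sub_van hT F N).mul (van_zero _)).add ((expOp_sub_van hS G N).mul_left _)
    exact sub_eq_zero.1 (e2 s e hlt)
  rw [h1, cf_expOp hS _ hlt, hA, hB, sum_mul_sum, cf_sum_apply, cf_sum_apply]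
  simp only [cf_sum_apply, expTerm_mul h]
  refine (sum_range_range_eq N (fun k l => cf (expTerm T F k * expTerm S G l) s e) ?_).symm
  intro k l hkl
  exact ((expTerm_van' hT F k).mul (expTerm_van' hS G l)) s e (by omega)

theorem iterate_neg_apply (T : Ser →ₗ[ℂ] Ser) (n : ℕ) (F : Ser) :
    (-T : Ser →ₗ[ℂ] Ser)^[n] F = ((-1 : ℂ) ^ n) • T^[n] F := by
  induction n with
  | zero => simp
  | succ n ih =>
    rw [Function.iterate_succ_apply', Function.iterate_succ_apply', ih, LinearMap.neg_apply,
      map_smul, pow_succ, ← smul_neg, mul_smul, neg_one_smul]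

/-- Collecting the double series by powers of T, the coefficient of Tⁿ is (1 − 1)ⁿ/n!. -/
theorem expOp_expOp_neg {T : Ser →ₗ[ℂ] Ser} (hT : Raising T) (F : Ser) :
    expOp T (expOp (-T : Ser →ₗ[ℂ] Ser) F) = F := ser_ext fun s e => by
  set N := deg s e + 1 with hN
  have hlt : deg s e < N := Nat.lt_succ_self _
  have h1 : cf (expOp T (expOp (-T : Ser →ₗ[ℂ] Ser) F)) s e =
      cf (expOp T (∑ n ∈ range N, expTerm (-T) F n)) s e := by
    have := expOp_van hT (expOp_sub_van hT.neg F N)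
    rw [← expLin_apply T hT, map_sub] at this
    exact sub_eq_zero.1 (this s e hlt)
  rw [h1, cf_expOp hT _ hlt, cf_sum_apply]
  have h2 : ∀ k, expTerm T (∑ n ∈ range N, expTerm (-T) F n) k =
      ∑ l ∈ range N, (((k.factorial : ℂ)⁻¹ * (l.factorial : ℂ)⁻¹ * (-1) ^ l)) • T^[k + l] F := by
    intro k
    have : T^[k] (∑ n ∈ range N, expTerm (-T) F n) = ∑ n ∈ range N, T^[k] (expTerm (-T) F n) := by
      induction k with
      | zero => rfl
      | succ k ih =>
        rw [Function.iterate_succ_apply', ih, map_sum]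
        simp only [Function.iterate_succ_apply']
    rw [expTerm, this, smul_sum]
    refine sum_congr rfl fun l _ => ?_
    have h3 : ∀ (k : ℕ) (c : ℂ) G, T^[k] (c • G) = c • T^[k] G := fun k c G => by
      induction k with
      | zero => rfl
      | succ k ih =>
        rw [Function.iterate_succ_apply', Function.iterate_succ_apply', ih, map_smul]
    rw [expTerm, iterate_neg_apply, h3, h3, Function.iterate_add_apply, smul_smul, smul_smul,
      mul_assoc]
  simp only [h2, cf_sum_apply]
  rw [sum_range_range_eq N (fun k l =>
    cf ((((k.factorial : ℂ)⁻¹ * (l.factorial : ℂ)⁻¹ * (-1) ^ l)) • T^[k + l] F) s e)]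
  · rw [sum_eq_single 0]
    · simp
    · intro n _ hn
      have h4 : ∀ p ∈ antidiagonal n,
          cf ((((p.1.factorial : ℂ)⁻¹ * (p.2.factorial : ℂ)⁻¹ * (-1) ^ p.2)) • T^[p.1 + p.2] F) s e
          = ((n.factorial : ℂ)⁻¹ * (n.choose p.1 • (1 ^ p.1 * (-1) ^ p.2) : ℂ)) •
            cf (T^[n] F) s e := by
        intro p hp
        have hp := HasAntidiagonal.mem_antidiagonal.1 hp
        rw [hp, cf_smul_apply]
        congr 1
        have h1 : p.1 ≤ n := by omega
        have h2 : n - p.1 = p.2 := by omega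
        have h3 : ((n.choose p.1 : ℕ) : ℂ) * p.1.factorial * p.2.factorial = n.factorial := by
          rw [← h2]; exact_mod_cast Nat.choose_mul_factorial_mul_factorial h1
        have f0 : (n.factorial : ℂ) ≠ 0 := by exact_mod_cast n.factorial_ne_zero
        have f1 : (p.1.factorial : ℂ) ≠ 0 := by exact_mod_cast p.1.factorial_ne_zero
        have f2 : (p.2.factorial : ℂ) ≠ 0 := by exact_mod_cast p.2.factorial_ne_zero
        rw [nsmul_eq_mul, one_pow]
        field_simp
        rw [← h3]; ring
      rw [sum_congr rfl h4, ← sum_smul, ← mul_sum, ← (Commute.all (1 : ℂ) (-1)).add_pow']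
      simp [hn]
    · simp [hN]
  · intro k l hkl
    have := (hT.iterate (k + l) (van_zero F)).smul
      ((k.factorial : ℂ)⁻¹ * (l.factorial : ℂ)⁻¹ * (-1) ^ l)
    exact this s e (by omega)

theorem expOp_neg_expOp {T : Ser →ₗ[ℂ] Ser} (hT : Raising T) (F : Ser) :
    expOp (-T : Ser →ₗ[ℂ] Ser) (expOp T F) = F := by
  have := expOp_expOp_neg hT.neg F
  rwa [neg_neg] at this

/-- An intertwiner of generators that respects the degree filtration intertwines the exponentials.
It is applied with J = D, the grading involution, and the maps setting variables to zero. -/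
theorem expOp_semiconj {S T J : Ser →ₗ[ℂ] Ser} (hS : Raising S) (hT : Raising T)
    (hJ : ∀ d F, Van d F → Van d (J F)) (h : ∀ F, J (T F) = S (J F)) (F : Ser) :
    J (expOp T F) = expOp S (J F) := by
  refine eq_of_van fun N => ?_
  have h1 := hJ _ _ (expOp_sub_van hT F N)
  have h2 := expOp_sub_van hS (J F) N
  have h3 : ∀ n, J (expTerm T F n) = expTerm S (J F) n := fun n => by
    rw [expTerm, expTerm, map_smul]
    congr 1
    induction n with
    | zero => rfl
    | succ n ih => rw [Function.iterate_succ_apply', Function.iterate_succ_apply', h, ih]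
  rw [map_sub, map_sum] at h1
  simp only [h3] at h1
  have := h1.sub h2
  rwa [sub_sub_sub_cancel_right] at this

/-- The exponential of a degree raising derivation, as a ring homomorphism. -/
def expHom (T : Ser →ₗ[ℂ] Ser) (hT : Raising T) (hd : ∀ F G, T (F * G) = T F * G + F * T G) :
    Ser →+* Ser where
  toFun := expOp T
  map_zero' := map_zero (expLin T hT)
  map_add' := map_add (expLin T hT)
  map_mul' := expOp_mul hT hT hd
  map_one' := expOp_of_eq_zero hT (by
    have := hd 1 1
    rw [mul_one, mul_one, one_mul] at this
    simpa using this)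

/-! ## Substitutions as endomorphisms -/

/-- A ring endomorphism fixing all variables except `x` and `φ`, and compatible with infinite
sums. -/
structure IsGood (σ : Ser →+* Ser) : Prop where
  fix_C : ∀ a, σ (ofLaur (LaurentPolynomial.C a)) = ofLaur (LaurentPolynomial.C a)
  fix_mono : ∀ e s, OddVar.phi ∉ s → σ (mono e s) = mono e s
  isLocal : IsLocal σ

theorem IsGood.comp {σ τ : Ser →+* Ser} (hσ : IsGood σ) (hτ : IsGood τ) : IsGood (σ.comp τ) where
  fix_C a := by rw [RingHom.comp_apply, hτ.fix_C, hσ.fix_C]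
  fix_mono e s hs := by rw [RingHom.comp_apply, hτ.fix_mono e s hs, hσ.fix_mono e s hs]
  isLocal s e F hF := hσ.isLocal s e _ (hτ.isLocal s e F hF)

theorem isGood_diag {h : Laur →+* Laur} {w : Finset OddVar → (EvenVar →₀ ℕ) → Laur}
    (hw : IsWeight w) (hC : ∀ a, h (LaurentPolynomial.C a) = LaurentPolynomial.C a)
    (hphi : ∀ s e, OddVar.phi ∉ s → w s e = 1) : IsGood (diag h w hw) where
  fix_C a := ser_ext fun s e => by
    rw [diag_apply, ofLaur_apply]
    split_ifs with hs
    · rw [hC, hphi s e (by simp [hs.1]), one_mul]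
    · rw [map_zero, mul_zero]
  fix_mono f t ht := ser_ext fun s e => by
    rw [diag_apply, mono_apply]
    split_ifs with hs
    · rw [map_one, hphi s e (by rwa [hs.1]), one_mul]
    · rw [map_zero, mul_zero]
  isLocal := isLocal_diag _ _ _

theorem isGood_expHom {T : Ser →ₗ[ℂ] Ser} (hT : Raising T)
    (hd : ∀ F G, T (F * G) = T F * G + F * T G)
    (hC : ∀ a, T (ofLaur (LaurentPolynomial.C a)) = 0)
    (hm : ∀ e s, OddVar.phi ∉ s → T (mono e s) = 0) (hl : IsLocal T) : IsGood (expHom T hT hd) where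
  fix_C a := expOp_of_eq_zero hT (hC a)
  fix_mono e s hs := expOp_of_eq_zero hT (hm e s hs)
  isLocal := expOp_local hT hl

/-- The part of `F` at a monomial. -/
def termAt (F : Ser) (i : (EvenVar →₀ ℕ) × Finset OddVar) : Ser :=
  (if OddVar.phi ∈ i.2 then phi else 1) * ofLaur (cf F i.2 i.1) * mono i.1 (i.2.erase OddVar.phi)

theorem cf_termAt (F : Ser) (i : (EvenVar →₀ ℕ) × Finset OddVar) (s : Finset OddVar)
    (e : EvenVar →₀ ℕ) :
    cf (termAt F i) s e = if s = i.2 ∧ e = i.1 then cf F i.2 i.1 else 0 := by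
  rw [termAt, mul_assoc]
  by_cases h : OddVar.phi ∈ i.2
  · rw [if_pos h, phi_mul_apply]
    by_cases hs : OddVar.phi ∈ s
    · have : s.erase OddVar.phi = i.2.erase OddVar.phi ↔ s = i.2 := by
        constructor
        · intro h'
          rw [← insert_erase hs, h', insert_erase h]
        · intro h'; rw [h']
      rw [if_pos hs, ofLaur_mul_apply, mono_apply]
      simp only [this]
      split_ifs <;> simp
    · rw [if_neg hs, if_neg]
      rintro ⟨rfl, -⟩
      exact hs h
  · rw [if_neg h, one_mul, ofLaur_mul_apply, mono_apply, erase_eq_of_notMem h]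
    split_ifs <;> simp

/-- The image of x⁻¹ is an inverse of the image of x, so `Ring.inverse` takes its genuine value and
not its default. -/
theorem intPow_eq {σ : Ser →+* Ser} (n : ℤ) : intPow (σ (X 1)) n = σ (X n) := by
  have hpow : ∀ (m : ℤ) (k : ℕ), X m ^ k = X (k * m) := fun m k => by
    induction k with
    | zero => simp [X_zero]
    | succ k ih => rw [pow_succ, ih, ← X_add]; congr 1; push_cast; ring
  rw [intPow]
  split_ifs with h
  · rw [← map_pow, hpow]
    congr 2
    rw [mul_one, Int.toNat_of_nonneg h]
  · have hinv : Ring.inverse (σ (X 1)) = σ (X (-1)) := by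
      have h1 : σ (X 1) * σ (X (-1)) = 1 := by rw [← map_mul, ← X_add]; simp [X_zero]
      have h2 : σ (X (-1)) * σ (X 1) = 1 := by rw [← map_mul, ← X_add]; simp [X_zero]
      exact Ring.inverse_unit ⟨σ (X 1), σ (X (-1)), h1, h2⟩
    rw [hinv, ← map_pow, hpow]
    congr 2
    omega

theorem ofLaur_eq_sum (p : Laur) :
    ofLaur p = p.coeff.sum fun n a => ofLaur (LaurentPolynomial.C a) * X n := by
  refine laur_ext ofLaur (fun p => p.coeff.sum fun n a => ofLaur (LaurentPolynomial.C a) * X n)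
    ofLaur_add (fun p q => ?_) (fun a n => ?_) p
  · rw [AddMonoidAlgebra.coeff_add, Finsupp.sum_add_index']
    · intro n; rw [map_zero, ofLaur_zero, zero_mul]
    · intro n a b; rw [map_add, ofLaur_add, add_mul]
  · rw [← LaurentPolynomial.single_eq_C_mul_T, AddMonoidAlgebra.coeff_single,
      Finsupp.sum_single_index, LaurentPolynomial.single_eq_C_mul_T, ofLaur_mul]
    · rfl
    · rw [map_zero, ofLaur_zero, zero_mul]

theorem IsGood.substTerm_eq {σ : Ser →+* Ser} (hσ : IsGood σ) (F : Ser)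
    (i : (EvenVar →₀ ℕ) × Finset OddVar) :
    substTerm F (σ (X 1), σ phi) i = σ (termAt F i) := by
  have h1 : substLaur (σ (X 1)) (F i.2 i.1) = σ (ofLaur (cf F i.2 i.1)) := by
    rw [ofLaur_eq_sum, map_finsuppSum]
    refine Finsupp.sum_congr fun n _ => ?_
    rw [map_mul, hσ.fix_C, intPow_eq]
  rw [substTerm, termAt, map_mul, map_mul, hσ.fix_mono _ _ (notMem_erase _ _), h1]
  congr 2
  split_ifs
  · rfl
  · rw [map_one]

/-- The divisors of a monomial, up to powers of `φ`. -/
def divisors (s : Finset OddVar) (e : EvenVar →₀ ℕ) : Finset ((EvenVar →₀ ℕ) × Finset OddVar) :=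
  (Set.finite_Iic e).toFinset ×ˢ (insert OddVar.phi s).powerset

theorem mem_divisors {s : Finset OddVar} {e : EvenVar →₀ ℕ}
    {i : (EvenVar →₀ ℕ) × Finset OddVar} :
    i ∈ divisors s e ↔ i.1 ≤ e ∧ i.2 ⊆ insert OddVar.phi s := by
  simp [divisors]

/-- Locality: only terms of F at divisors of a monomial contribute to that monomial of σ F. There
are finitely many divisors, whence summability. -/
theorem IsGood.cf_termAt_eq_zero {σ : Ser →+* Ser} (hσ : IsGood σ) (F : Ser) {s : Finset OddVar}
    {e : EvenVar →₀ ℕ} {i : (EvenVar →₀ ℕ) × Finset OddVar} (hi : i ∉ divisors s e) :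
    cf (σ (termAt F i)) s e = 0 := by
  refine hσ.isLocal s e _ (fun s' e' h h' => ?_) s e (subset_insert _ _) le_rfl
  rw [cf_termAt, if_neg]
  rintro ⟨rfl, rfl⟩
  exact hi (mem_divisors.2 ⟨h', h⟩)

theorem IsGood.summable {σ : Ser →+* Ser} (hσ : IsGood σ) (F : Ser) :
    FormallySummable (substTerm F (σ (X 1), σ phi)) := fun s e =>
  (divisors s e).finite_toSet.subset fun i hi => by
    by_contra h
    refine hi ?_
    change cf (substTerm F (σ (X 1), σ phi) i) s e = 0
    rw [hσ.substTerm_eq]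
    exact hσ.cf_termAt_eq_zero F h

/-- The bridge from formal composition to algebra. At a given monomial, F may be replaced by the
finite sum of its terms at the divisors; on these the substitution is σ by multiplicativity, and
locality discards the rest. -/
theorem IsGood.subst_eq {σ : Ser →+* Ser} (hσ : IsGood σ) (F : Ser) :
    subst F (σ (X 1), σ phi) = σ F := ser_ext fun s e => by
  rw [subst, cf_formalSum]
  simp only [hσ.substTerm_eq]
  rw [finsum_eq_sum_of_support_subset (s := divisors s e)]
  -- F minus its terms at the divisors vanishes below the monomial, so locality kills its image
  -- there.
  · rw [← cf_sum_apply, ← map_sum, eq_comm, ← sub_eq_zero, ← cf_sub_apply, ← map_sub]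
    refine hσ.isLocal s e _ (fun s' e' h h' => ?_) s e (subset_insert _ _) le_rfl
    rw [cf_sub_apply, cf_sum_apply, sum_eq_single (e', s'), cf_termAt]
    · simp
    · rintro i - hi
      rw [cf_termAt, if_neg]
      rintro ⟨rfl, rfl⟩
      exact hi rfl
    · intro hi
      exact absurd (mem_divisors.2 ⟨h', h⟩) hi
  · intro i hi
    by_contra h
    exact hi (hσ.cf_termAt_eq_zero F h)

theorem IsGood.compExists {σ : Ser →+* Ser} (hσ : IsGood σ) (F : SFun) :
    CompExists F (σ (X 1), σ phi) :=
  ⟨(isUnit_X 1).map σ, hσ.summable _, hσ.summable _⟩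

theorem IsGood.comp_eq {σ : Ser →+* Ser} (hσ : IsGood σ) (F : SFun) :
    SuperSewing.comp F (σ (X 1), σ phi) = (σ F.1, σ F.2) := by
  rw [SuperSewing.comp, hσ.subst_eq, hσ.subst_eq]

/-! ## The generating series -/

theorem coef_eq (F : Ser) (s : Finset OddVar) (e : EvenVar →₀ ℕ) (n : ℤ) :
    coef F s e n = (cf F s e).coeff n := rfl

theorem coef_formalSum_ne_zero {ι : Type*} {F : ι → Ser} (hF : FormallySummable F)
    {s : Finset OddVar} {e : EvenVar →₀ ℕ} {n : ℤ} (h : coef (formalSum F) s e n ≠ 0) :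
    ∃ i, coef (F i) s e n ≠ 0 := by
  by_contra! hc
  refine h ?_
  rw [coef_eq, cf_formalSum, finsum_eq_sum (fun i => cf (F i) s e) (hF s e), AddMonoidAlgebra.coeff_sum,
    Finsupp.finsetSum_apply]
  exact sum_eq_zero fun i _ => hc i

theorem coef_mono_mul_X (f : EvenVar →₀ ℕ) (t : Finset OddVar) (m : ℤ) (s : Finset OddVar)
    (e : EvenVar →₀ ℕ) (n : ℤ) :
    coef (mono f t * X m) s e n = if s = t ∧ e = f ∧ n = m then 1 else 0 := by
  rw [coef_eq, X, mul_ofLaur_apply, mono_apply]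
  by_cases h : s = t ∧ e = f
  · rw [if_pos h, mul_one, LaurentPolynomial.T_apply]
    simp [h.1, h.2, eq_comm]
  · rw [if_neg h, mul_zero, if_neg]
    · rfl
    · tauto

/-- Distinct indices give distinct monomials, so each monomial meets at most one member of the
family. -/
theorem summable_mono_mul_X {f : ℕ+ → EvenVar →₀ ℕ} {t : ℕ+ → Finset OddVar} (m : ℕ+ → ℤ)
    (h : Function.Injective fun j => (f j, t j)) :
    FormallySummable fun j => mono (f j) (t j) * X (m j) := fun s e =>
  Set.Subsingleton.finite fun i hi j hj => h (by
    have key : ∀ j, cf (mono (f j) (t j) * X (m j)) s e ≠ 0 → s = t j ∧ e = f j := fun j hj => by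
      by_contra hc
      refine hj ?_
      rw [X, mul_ofLaur_apply, mono_apply, if_neg hc, mul_zero]
    have h1 := key i hi
    have h2 := key j hj
    simp only [← h1.1, ← h1.2, ← h2.1, ← h2.2])

theorem injective_single_A : Function.Injective
    fun j : ℕ+ => ((Finsupp.single (EvenVar.A j) 1 : EvenVar →₀ ℕ), (∅ : Finset OddVar)) := by
  intro i j h
  have := Finsupp.single_left_injective one_ne_zero (Prod.ext_iff.1 h).1
  injection this

theorem injective_single_B : Function.Injective
    fun j : ℕ+ => ((Finsupp.single (EvenVar.B j) 1 : EvenVar →₀ ℕ), (∅ : Finset OddVar)) := by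
  intro i j h
  have := Finsupp.single_left_injective one_ne_zero (Prod.ext_iff.1 h).1
  injection this

theorem injective_singleton_M : Function.Injective
    fun j : ℕ+ => ((0 : EvenVar →₀ ℕ), ({OddVar.M j} : Finset OddVar)) := by
  intro i j h
  have := singleton_injective (Prod.ext_iff.1 h).2
  injection this

theorem injective_singleton_N : Function.Injective
    fun j : ℕ+ => ((0 : EvenVar →₀ ℕ), ({OddVar.N j} : Finset OddVar)) := by
  intro i j h
  have := singleton_injective (Prod.ext_iff.1 h).2
  injection this

theorem summable_gA : FormallySummable fun j : ℕ+ => cA j * X (j + 1) :=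
  summable_mono_mul_X _ injective_single_A
theorem summable_gB : FormallySummable fun j : ℕ+ => cB j * X (-j + 1) :=
  summable_mono_mul_X _ injective_single_B
theorem summable_gM : FormallySummable fun j : ℕ+ => cM j * X j :=
  summable_mono_mul_X _ injective_singleton_M
theorem summable_gN : FormallySummable fun j : ℕ+ => cN j * X (-j + 1) :=
  summable_mono_mul_X _ injective_singleton_N

theorem coef_gA_ne_zero {s : Finset OddVar} {e : EvenVar →₀ ℕ} {n : ℤ} (h : coef gA s e n ≠ 0) :
    ∃ j : ℕ+, s = ∅ ∧ e = Finsupp.single (.A j) 1 ∧ n = j + 1 := by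
  obtain ⟨j, hj⟩ := coef_formalSum_ne_zero summable_gA h
  refine ⟨j, ?_⟩
  by_contra hc
  exact hj ((coef_mono_mul_X _ _ _ _ _ _).trans (if_neg hc))

theorem coef_gB_ne_zero {s : Finset OddVar} {e : EvenVar →₀ ℕ} {n : ℤ} (h : coef gB s e n ≠ 0) :
    ∃ j : ℕ+, s = ∅ ∧ e = Finsupp.single (.B j) 1 ∧ n = -j + 1 := by
  obtain ⟨j, hj⟩ := coef_formalSum_ne_zero summable_gB h
  refine ⟨j, ?_⟩
  by_contra hc
  exact hj ((coef_mono_mul_X _ _ _ _ _ _).trans (if_neg hc))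

theorem coef_gM_ne_zero {s : Finset OddVar} {e : EvenVar →₀ ℕ} {n : ℤ} (h : coef gM s e n ≠ 0) :
    ∃ j : ℕ+, s = {.M j} ∧ e = 0 ∧ n = j := by
  obtain ⟨j, hj⟩ := coef_formalSum_ne_zero summable_gM h
  refine ⟨j, ?_⟩
  by_contra hc
  exact hj ((coef_mono_mul_X _ _ _ _ _ _).trans (if_neg hc))

theorem coef_gN_ne_zero {s : Finset OddVar} {e : EvenVar →₀ ℕ} {n : ℤ} (h : coef gN s e n ≠ 0) :
    ∃ j : ℕ+, s = {.N j} ∧ e = 0 ∧ n = -j + 1 := by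
  obtain ⟨j, hj⟩ := coef_formalSum_ne_zero summable_gN h
  refine ⟨j, ?_⟩
  by_contra hc
  exact hj ((coef_mono_mul_X _ _ _ _ _ _).trans (if_neg hc))

theorem exists_coef_ne_zero {F : Ser} {s : Finset OddVar} {e : EvenVar →₀ ℕ} (h : cf F s e ≠ 0) :
    ∃ n, coef F s e n ≠ 0 := by
  by_contra! hc
  exact h (AddMonoidAlgebra.ext (Finsupp.ext hc))

theorem exists_coef_ne_zero_of_apply {F : Ser} {s : Finset OddVar} (h : F s ≠ 0) :
    ∃ e n, coef F s e n ≠ 0 := by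
  by_contra! hc
  exact h (apply_eq_zero_of_cf fun e => AddMonoidAlgebra.ext (Finsupp.ext (hc e)))

theorem isEven_gA : IsEven gA := fun s hs => by
  obtain ⟨e, n, h⟩ := exists_coef_ne_zero_of_apply hs
  obtain ⟨j, rfl, -⟩ := coef_gA_ne_zero h; simp
theorem isEven_gB : IsEven gB := fun s hs => by
  obtain ⟨e, n, h⟩ := exists_coef_ne_zero_of_apply hs
  obtain ⟨j, rfl, -⟩ := coef_gB_ne_zero h; simp
theorem isOdd_gM : IsOdd gM := fun s hs => by
  obtain ⟨e, n, h⟩ := exists_coef_ne_zero_of_apply hs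
  obtain ⟨j, rfl, -⟩ := coef_gM_ne_zero h; simp
theorem isOdd_gN : IsOdd gN := fun s hs => by
  obtain ⟨e, n, h⟩ := exists_coef_ne_zero_of_apply hs
  obtain ⟨j, rfl, -⟩ := coef_gN_ne_zero h; simp

theorem dphi_eq_zero {F : Ser} (h : ∀ s e, cf F s e ≠ 0 → OddVar.phi ∉ s) : dphi F = 0 :=
  ser_ext fun s e => by
    rw [cf_dphi]
    split_ifs
    · rfl
    · by_contra hc
      exact h _ e hc (mem_insert_self _ _)

theorem dphi_gA : dphi gA = 0 := dphi_eq_zero fun s e hs => by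
  obtain ⟨n, h⟩ := exists_coef_ne_zero hs
  obtain ⟨j, rfl, -⟩ := coef_gA_ne_zero h; simp
theorem dphi_gB : dphi gB = 0 := dphi_eq_zero fun s e hs => by
  obtain ⟨n, h⟩ := exists_coef_ne_zero hs
  obtain ⟨j, rfl, -⟩ := coef_gB_ne_zero h; simp
theorem dphi_gM : dphi gM = 0 := dphi_eq_zero fun s e hs => by
  obtain ⟨n, h⟩ := exists_coef_ne_zero hs
  obtain ⟨j, rfl, -⟩ := coef_gM_ne_zero h; simp
theorem dphi_gN : dphi gN = 0 := dphi_eq_zero fun s e hs => by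
  obtain ⟨n, h⟩ := exists_coef_ne_zero hs
  obtain ⟨j, rfl, -⟩ := coef_gN_ne_zero h; simp

/-- All terms of `F` have degree `a` in `(𝒜, ℳ)` and `b` in `(ℬ, 𝒩)`. -/
def HasBideg (a b : ℕ) (F : Ser) : Prop := ∀ s e, cf F s e ≠ 0 → degAM s e = a ∧ degBN s e = b

theorem hasBideg_gA : HasBideg 1 0 gA := fun s e hs => by
  obtain ⟨n, h⟩ := exists_coef_ne_zero hs
  obtain ⟨j, rfl, rfl, -⟩ := coef_gA_ne_zero h; simp [degAM, degBN]
theorem hasBideg_gM : HasBideg 1 0 gM := fun s e hs => by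
  obtain ⟨n, h⟩ := exists_coef_ne_zero hs
  obtain ⟨j, rfl, rfl, -⟩ := coef_gM_ne_zero h; simp [degAM, degBN]
theorem hasBideg_gB : HasBideg 0 1 gB := fun s e hs => by
  obtain ⟨n, h⟩ := exists_coef_ne_zero hs
  obtain ⟨j, rfl, rfl, -⟩ := coef_gB_ne_zero h; simp [degAM, degBN]
theorem hasBideg_gN : HasBideg 0 1 gN := fun s e hs => by
  obtain ⟨n, h⟩ := exists_coef_ne_zero hs
  obtain ⟨j, rfl, rfl, -⟩ := coef_gN_ne_zero h; simp [degAM, degBN]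

theorem HasBideg.van {a b : ℕ} {F : Ser} (h : HasBideg a b F) : Van (a + b) F := fun s e hs => by
  by_contra hc
  have := h s e hc
  rw [deg, this.1, this.2] at hs
  exact lt_irrefl _ hs

/-! ## The vector fields in the exponents -/

/-- Each operator in the sum acts by coefficients depending on j times P, Q, R independent of j; the
sum over j thus moves into the coefficients. -/
theorem formalSum_vec {u v : ℕ+ → Ser} (hu : FormallySummable u) (hv : FormallySummable v)
    (P Q R : Ser) :
    (formalSum fun j => -(u j * P + dx (u j) * Q + v j * R)) =
      -(formalSum u * P + dx (formalSum u) * Q + formalSum v * R) := by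
  have hu' : FormallySummable fun j => dx (u j) := hu.of_apply_eq_zero fun i s e h => by
    rw [cf_dx, h, derivLaur_zero]
  rw [formalSum_neg, formalSum_add ((hu.mul_right P).add (hu'.mul_right Q)) (hv.mul_right R),
    formalSum_add (hu.mul_right P) (hu'.mul_right Q), formalSum_mul hu, dx_formalSum hu,
    formalSum_mul hu', formalSum_mul hv]

theorem dx_mono_mul_X (e : EvenVar →₀ ℕ) (s : Finset OddVar) (n : ℤ) :
    dx (mono e s * X n) = (n : ℂ) • (mono e s * X (n - 1)) := by
  rw [dx_mul, dx_mono, zero_mul, zero_add, X, dx_ofLaur, derivLaur_T, ofLaur_mul,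
    ← mul_smul_comm, smul_eq_ofLaur, map_intCast]
  rfl

theorem mono_mul_L (e : EvenVar →₀ ℕ) (n : ℤ) (F : Ser) :
    mono e ∅ * L n F = -(mono e ∅ * X (n + 1) * dx F +
      dx (mono e ∅ * X (n + 1)) * ((1 / 2 : ℂ) • (phi * dphi F))) := by
  have h : mono e ∅ * (phi * (X n * dphi F)) = mono e ∅ * (X n * (phi * dphi F)) := by
    rw [← mul_assoc phi, ← X_comm, mul_assoc]
  rw [L, ser_mul_neg, dx_mono_mul_X, add_sub_cancel_right, mul_add, mul_smul_comm, smul_mul_smul_comm,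
    mul_assoc, mul_assoc, mul_assoc, h]
  congr 3
  push_cast
  ring

theorem mono_mul_G (θ : OddVar) (n : ℤ) (F : Ser) :
    oddVar θ * G n F = -(oddVar θ * X n * (dphi F - phi * dx F)) := by
  rw [G, ser_mul_neg, mul_assoc]

theorem vec_apply' {a : Ser} (ha : IsEven a) (m F : Ser) : vec a m F =
    -(a * dx F + dx a * ((1 / 2 : ℂ) • (phi * dphi F)) + m * (dphi F - phi * dx F)) := by
  rw [vec_apply, mul_smul_comm, ← mul_assoc, ← even_mul_comm ha.dx, mul_assoc]

theorem TAM_eq : TAM = vec gA gM := funext fun F => by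
  rw [vec_apply' isEven_gA, gA, gM, ← formalSum_vec summable_gA summable_gM, TAM]
  congr 1
  funext j
  rw [cA, evenVar, mono_mul_L, cM, mono_mul_G, ← neg_add]

theorem TBN_eq : TBN = vec gB gN := funext fun F => by
  rw [vec_apply' isEven_gB, gB, gN, ← formalSum_vec summable_gB summable_gN, TBN]
  congr 1
  funext j
  rw [cB, evenVar, mono_mul_L, cN, mono_mul_G, ← neg_add]

theorem raising_AM : Raising (vec gA gM) := fun _ _ h => vec_van hasBideg_gA.van hasBideg_gM.van h

theorem raising_BN : Raising (vec gB gN) := fun _ _ h => vec_van hasBideg_gB.van hasBideg_gN.van h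

theorem isGood_exp_vec {a m : Ser} (ha : IsEven a) (hm : IsOdd m) (h : Raising (vec a m)) :
    IsGood (expHom (vec a m) h (vec_mul ha hm)) :=
  isGood_expHom _ _ (vec_ofLaur_C a m) (fun e _ hs => vec_mono a m e hs) (vec_local a m)

theorem neg_vec_mul {a m : Ser} (ha : IsEven a) (hm : IsOdd m) (F G : Ser) :
    (-vec a m) (F * G) = (-vec a m) F * G + F * (-vec a m) G := by
  rw [LinearMap.neg_apply, LinearMap.neg_apply, LinearMap.neg_apply, vec_mul ha hm, neg_add,
    ser_neg_mul, ser_mul_neg]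

theorem isGood_exp_neg_vec {a m : Ser} (ha : IsEven a) (hm : IsOdd m) (h : Raising (vec a m)) :
    IsGood (expHom (-vec a m) h.neg (neg_vec_mul ha hm)) :=
  isGood_expHom _ _ (fun c => by rw [LinearMap.neg_apply, vec_ofLaur_C, neg_zero])
    (fun e _ hs => by rw [LinearMap.neg_apply, vec_mono a m e hs, neg_zero])
    fun s e F hF => (vec_local a m s e F hF).neg

/-! ## Dilation and inversion -/

/-- φ lies in at most one of two disjoint sets, so c need not be idempotent. -/
theorem isWeight_phi (c : Laur) :
    IsWeight fun s _ => if OddVar.phi ∈ s then c else 1 :=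
  ⟨by simp, fun s t e f h => by
    by_cases hs : OddVar.phi ∈ s <;> by_cases ht : OddVar.phi ∈ t
    · exact absurd ht (disjoint_left.1 h hs)
    all_goals simp [hs, ht]⟩

/-- The endomorphism acting on coefficients by `h`, and multiplying `φ` by `c`. -/
def phiDiag (h : Laur →+* Laur) (c : Laur) : Ser →+* Ser :=
  diag h (fun s _ => if OddVar.phi ∈ s then c else 1) (isWeight_phi c)

theorem cf_phiDiag (h : Laur →+* Laur) (c : Laur) (F : Ser) (s : Finset OddVar)
    (e : EvenVar →₀ ℕ) :
    cf (phiDiag h c F) s e = (if OddVar.phi ∈ s then c else 1) * h (cf F s e) := rfl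

theorem isGood_phiDiag {h : Laur →+* Laur} (c : Laur)
    (hC : ∀ a, h (LaurentPolynomial.C a) = LaurentPolynomial.C a) : IsGood (phiDiag h c) :=
  isGood_diag _ hC fun _ _ hs => if_neg hs

theorem phiDiag_ofLaur (h : Laur →+* Laur) (c p : Laur) :
    phiDiag h c (ofLaur p) = ofLaur (h p) := ser_ext fun s e => by
  rw [cf_phiDiag, ofLaur_apply, ofLaur_apply]
  by_cases hs : s = ∅ ∧ e = 0
  · rw [if_pos hs, if_pos hs, if_neg (by simp [hs.1]), one_mul]
  · rw [if_neg hs, if_neg hs, map_zero, mul_zero]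

theorem phiDiag_phi (h : Laur →+* Laur) (c : Laur) :
    phiDiag h c phi = ofLaur c * phi := ser_ext fun s e => by
  rw [cf_phiDiag, ofLaur_mul_apply, phi, oddVar, mono_apply]
  by_cases hs : s = {OddVar.phi} ∧ e = 0
  · rw [if_pos hs, if_pos (by simp [hs.1]), map_one]
  · rw [if_neg hs, map_zero, mul_zero, mul_zero]

/-- `dil k` as a ring homomorphism. -/
def dilHom (k : ℤ) : Ser →+* Ser :=
  phiDiag (scaleLaurHom k) (LaurentPolynomial.C (LaurentPolynomial.T k))

theorem dilHom_apply (k : ℤ) (F : Ser) : dilHom k F = dil k F := ser_ext fun s e => by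
  rw [dilHom, cf_phiDiag]
  change _ = LaurentPolynomial.C (LaurentPolynomial.T (if OddVar.phi ∈ s then k else 0)) *
    scaleLaur k (cf F s e)
  split_ifs
  · rfl
  · rw [LaurentPolynomial.T_zero, map_one]; rfl

theorem isGood_dilHom (k : ℤ) : IsGood (dilHom k) := isGood_phiDiag _ (scaleLaur_C k)

theorem cf_dil (k : ℤ) (F : Ser) (s : Finset OddVar) (e : EvenVar →₀ ℕ) :
    cf (dil k F) s e =
      LaurentPolynomial.C (LaurentPolynomial.T (if OddVar.phi ∈ s then k else 0)) *
      scaleLaur k (cf F s e) := rfl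

theorem coef_dil (k : ℤ) (F : Ser) (s : Finset OddVar) (e : EvenVar →₀ ℕ) (n : ℤ) :
    coef (dil k F) s e n =
      LaurentPolynomial.T ((if OddVar.phi ∈ s then k else 0) + 2 * k * n) * coef F s e n := by
  rw [coef_eq, cf_dil, ← LaurentPolynomial.smul_eq_C_mul, AddMonoidAlgebra.coeff_smul_apply,
    coeff_scaleLaur, smul_eq_mul, ← mul_assoc, ← LaurentPolynomial.T_add, coef_eq]

theorem coef_ext {F G : Ser} (h : ∀ s e n, coef F s e n = coef G s e n) : F = G :=
  ser_ext fun s e => AddMonoidAlgebra.ext (Finsupp.ext (h s e))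

theorem dil_dil (k l : ℤ) (F : Ser) : dil k (dil l F) = dil (k + l) F := coef_ext fun s e n => by
  rw [coef_dil, coef_dil, coef_dil, ← mul_assoc, ← LaurentPolynomial.T_add]
  congr 2
  split_ifs <;> ring

theorem dil_zero_left (F : Ser) : dil 0 F = F := coef_ext fun s e n => by
  rw [coef_dil]; simp

theorem dil_neg_dil (F : Ser) : dil (-1) (dil 1 F) = F := by
  rw [dil_dil]; exact dil_zero_left F

theorem dil_dil_neg (F : Ser) : dil 1 (dil (-1) F) = F := by
  rw [dil_dil]; exact dil_zero_left F

theorem dil_X (k n : ℤ) : dil k (X n) = sqrtAlpha (2 * k * n) * X n := by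
  rw [← dilHom_apply, X, dilHom, phiDiag_ofLaur, scaleLaurHom_apply, scaleLaur_T, ofLaur_mul]
  rfl

theorem dil_phi (k : ℤ) : dil k phi = sqrtAlpha k * phi := by
  rw [← dilHom_apply, dilHom, phiDiag_phi]
  rfl

theorem dil_smul (k : ℤ) (c : ℂ) (F : Ser) : dil k (c • F) = c • dil k F := by
  rw [smul_eq_ofLaur, smul_eq_ofLaur, ← dilHom_apply, ← dilHom_apply, map_mul,
    (isGood_dilHom k).fix_C]

theorem van_dil (k : ℤ) {d : ℕ} {F : Ser} (h : Van d F) : Van d (dil k F) := fun s e hs => by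
  rw [← dilHom_apply, dilHom, cf_phiDiag, h s e hs, map_zero, mul_zero]

theorem coef_dil_ne_zero {k : ℤ} {F : Ser} {s : Finset OddVar} {e : EvenVar →₀ ℕ} {n : ℤ} :
    coef (dil k F) s e n ≠ 0 ↔ coef F s e n ≠ 0 := by
  rw [coef_dil]
  exact not_congr ((LaurentPolynomial.isUnit_T _).mul_right_eq_zero)

/-- The substitution `x ↦ 1/x`, `φ ↦ cφ/x`. -/
def invHom (c : ℂ) : Ser →+* Ser :=
  phiDiag (LaurentPolynomial.invert (R := Scal) : Laur →+* Laur)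
    (LaurentPolynomial.C (LaurentPolynomial.C c) * LaurentPolynomial.T (-1))

theorem isGood_invHom (c : ℂ) : IsGood (invHom c) :=
  isGood_phiDiag _ fun a => LaurentPolynomial.invert_C a

theorem invHom_X (c : ℂ) (n : ℤ) : invHom c (X n) = X (-n) := by
  rw [X, invHom, phiDiag_ofLaur]
  exact congrArg ofLaur (LaurentPolynomial.invert_T n)

theorem invHom_phi (c : ℂ) : invHom c phi = c • (phi * X (-1)) := by
  rw [invHom, phiDiag_phi, ofLaur_mul, mul_assoc, smul_eq_ofLaur, ← X_comm]
  rfl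

/-- The composite sends φ to cdφ. In particular I is not an involution; its inverse has −i in place
of i. -/
theorem invHom_invHom {c d : ℂ} (h : c * d = 1) (F : Ser) : invHom c (invHom d F) = F := by
  refine ser_ext fun s e => ?_
  rw [invHom, cf_phiDiag, invHom, cf_phiDiag, map_mul]
  have h1 : ∀ p : Laur, ((LaurentPolynomial.invert (R := Scal) : Laur →+* Laur))
      ((LaurentPolynomial.invert (R := Scal) : Laur →+* Laur) p) = p := fun p =>
    LaurentPolynomial.involutive_invert p
  rw [h1]
  split_ifs
  · have h2 : ((LaurentPolynomial.invert (R := Scal) : Laur →+* Laur))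
        (LaurentPolynomial.C (LaurentPolynomial.C d) * LaurentPolynomial.T (-1)) =
        LaurentPolynomial.C (LaurentPolynomial.C d) * LaurentPolynomial.T 1 := by
      rw [map_mul]
      congr 1
      · exact LaurentPolynomial.invert_C _
      · exact LaurentPolynomial.invert_T (-1)
    rw [h2, ← mul_assoc]
    have h3 : (LaurentPolynomial.C (LaurentPolynomial.C c) * LaurentPolynomial.T (-1) *
        (LaurentPolynomial.C (LaurentPolynomial.C d) * LaurentPolynomial.T 1) : Laur) =
        LaurentPolynomial.C (LaurentPolynomial.C (c * d)) *
          (LaurentPolynomial.T (-1) * LaurentPolynomial.T 1) := by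
      rw [map_mul, map_mul]; ring
    rw [h3, h, ← LaurentPolynomial.T_add]
    simp
  · rw [map_one, one_mul, one_mul]

/-! ## The local coordinates as endomorphisms -/

/-- `exp(-∑ (𝒜_j L_j + ℳ_{j-1/2} G_{j-1/2}))`. -/
def expNegAM : Ser →+* Ser :=
  expHom (-vec gA gM) raising_AM.neg (neg_vec_mul isEven_gA isOdd_gM)

/-- `exp(∑ (ℬ_j L_{-j} + 𝒩_{j-1/2} G_{-j+1/2}))`. -/
def expBN : Ser →+* Ser := expHom (vec gB gN) raising_BN (vec_mul isEven_gB isOdd_gN)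

/-- `exp(-∑ (ℬ_j L_{-j} + 𝒩_{j-1/2} G_{-j+1/2}))`. -/
def expNegBN : Ser →+* Ser :=
  expHom (-vec gB gN) raising_BN.neg (neg_vec_mul isEven_gB isOdd_gN)

theorem expNegAM_apply (F : Ser) : expNegAM F = expOp (-vec gA gM : Ser →ₗ[ℂ] Ser) F := rfl
theorem expNegBN_apply (F : Ser) : expNegBN F = expOp (-vec gB gN : Ser →ₗ[ℂ] Ser) F := rfl

theorem expBN_expNegBN (F : Ser) : expBN (expNegBN F) = F := expOp_expOp_neg raising_BN F
theorem expNegBN_expBN (F : Ser) : expNegBN (expBN F) = F := expOp_neg_expOp raising_BN F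

theorem isGood_expNegAM : IsGood expNegAM := isGood_exp_neg_vec isEven_gA isOdd_gM raising_AM
theorem isGood_expNegBN : IsGood expNegBN := isGood_exp_neg_vec isEven_gB isOdd_gN raising_BN
theorem isGood_expBN : IsGood expBN := isGood_exp_vec isEven_gB isOdd_gN raising_BN

theorem neg_TAM_eq : (fun E => -TAM E) = (-vec gA gM : Ser →ₗ[ℂ] Ser) := by
  rw [TAM_eq]; rfl

theorem neg_TBN_eq : (fun E => -TBN E) = (-vec gB gN : Ser →ₗ[ℂ] Ser) := by
  rw [TBN_eq]; rfl

theorem inversion_eq : inversion = (invHom Complex.I (X 1), invHom Complex.I phi) := by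
  rw [invHom_X, invHom_phi, inversion]

theorem H1_eq : H1 = (expNegAM.comp (dilHom 1) (X 1), expNegAM.comp (dilHom 1) phi) := by
  rw [RingHom.comp_apply, RingHom.comp_apply, dilHom_apply, dilHom_apply, H1, neg_TAM_eq]
  rfl

theorem H2_eq : H2 = (expBN.comp (invHom Complex.I) (X 1), expBN.comp (invHom Complex.I) phi) := by
  rw [H2, TBN_eq, inversion_eq]
  rfl

/-- The compositional inverse of `H⁽²⁾`, as an endomorphism. -/
def invH2Hom : Ser →+* Ser := (invHom (-Complex.I)).comp expNegBN

theorem isGood_H2 : IsGood (expBN.comp (invHom Complex.I)) := isGood_expBN.comp (isGood_invHom _)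
theorem isGood_invH2 : IsGood invH2Hom := (isGood_invHom _).comp isGood_expNegBN

theorem invHom_neg_I (F : Ser) : invHom (-Complex.I) (invHom Complex.I F) = F :=
  invHom_invHom (by simp) F

theorem invHom_I_neg (F : Ser) : invHom Complex.I (invHom (-Complex.I) F) = F :=
  invHom_invHom (by simp) F

/-! ### Parity, the inverse of H⁽²⁾, and the sewing endomorphism -/

theorem isEven_X (n : ℤ) : IsEven (X n) := fun s hs => by
  by_contra h
  refine hs (apply_eq_zero_of_cf fun e => ?_)
  rw [X, ofLaur_apply, if_neg]
  rintro ⟨rfl, -⟩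
  simp at h

theorem gradeInv_smul (c : ℂ) (F : Ser) : gradeInv (c • F) = c • gradeInv F := ser_ext fun s e => by
  rw [gradeInv_apply, cf_smul_apply, cf_smul_apply, gradeInv_apply, mul_smul_comm]

/-- The grading involution as a linear map. -/
def gradeInvLin : Ser →ₗ[ℂ] Ser := ⟨⟨gradeInv, map_add _⟩, gradeInv_smul⟩

theorem van_gradeInv {d : ℕ} {F : Ser} (h : Van d F) : Van d (gradeInv F) := fun s e hs => by
  rw [gradeInv_apply, h s e hs, mul_zero]

theorem gradeInv_expNegAM (F : Ser) : gradeInv (expNegAM F) = expNegAM (gradeInv F) :=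
  expOp_semiconj (J := gradeInvLin) raising_AM.neg raising_AM.neg (fun _ _ => van_gradeInv)
    (fun G => by
      change gradeInv (-vec gA gM G) = -vec gA gM (gradeInv G)
      rw [map_neg, gradeInv_vec isEven_gA isOdd_gM]) F

theorem gradeInv_expNegBN (F : Ser) : gradeInv (expNegBN F) = expNegBN (gradeInv F) :=
  expOp_semiconj (J := gradeInvLin) raising_BN.neg raising_BN.neg (fun _ _ => van_gradeInv)
    (fun G => by
      change gradeInv (-vec gB gN G) = -vec gB gN (gradeInv G)
      rw [map_neg, gradeInv_vec isEven_gB isOdd_gN]) F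

theorem gradeInv_phiDiag {h : Laur →+* Laur} (c : Laur)
    (F : Ser) : gradeInv (phiDiag h c F) = phiDiag h c (gradeInv F) := ser_ext fun s e => by
  rw [gradeInv_apply, cf_phiDiag, cf_phiDiag, gradeInv_apply, map_mul]
  have : h (pSign s.card) = pSign s.card := by
    rw [pSign_eq, map_pow, map_neg, map_one]
  rw [this]; ring

/-- The compositional inverse of `H⁽²⁾`. -/
def invH2 : SFun := (invH2Hom (X 1), invH2Hom phi)

theorem gradeInv_invH2Hom (F : Ser) : gradeInv (invH2Hom F) = invH2Hom (gradeInv F) := by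
  rw [invH2Hom, RingHom.comp_apply, invHom, gradeInv_phiDiag, gradeInv_expNegBN]
  rfl

theorem isCompInverse_invH2 : IsCompInverse H2 invH2 := by
  refine ⟨⟨?_, ?_⟩, ?_, ?_, ?_, ?_⟩
  · rw [isEven_iff, invH2, gradeInv_invH2Hom, isEven_iff.1 (isEven_X 1)]
  · rw [isOdd_iff, invH2, gradeInv_invH2Hom, gradeInv_phi, map_neg]
  · exact isGood_invH2.compExists _
  · rw [H2_eq]; exact isGood_H2.compExists _
  · rw [invH2, isGood_invH2.comp_eq, H2_eq, invH2Hom]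
    simp only [RingHom.comp_apply, expNegBN_expBN, invHom_neg_I]
    rfl
  · rw [H2_eq, isGood_H2.comp_eq, invH2, invH2Hom]
    simp only [RingHom.comp_apply, expBN_expNegBN, invHom_I_neg]
    rfl

/-- K ∘ H⁽²⁾ = id says that the endomorphism of H⁽²⁾ maps K to (x, φ); applying the inverse
endomorphism determines K. -/
theorem eq_invH2 {K : SFun} (hK : IsCompInverse H2 K) : K = invH2 := by
  have h := hK.2.2.2.2
  rw [H2_eq, isGood_H2.comp_eq] at h
  have h1 : ∀ F, invH2Hom (expBN.comp (invHom Complex.I) F) = F := fun F => by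
    rw [invH2Hom]
    simp only [RingHom.comp_apply, expNegBN_expBN, invHom_neg_I]
  have h2 := congrArg (fun P : SFun => (invH2Hom P.1, invH2Hom P.2)) h
  dsimp only at h2
  rw [h1, h1] at h2
  exact h2

/-- Composition with `(H⁽²⁾)⁻¹ ∘ I ∘ H⁽¹⁾`, as an endomorphism. -/
def sewHom : Ser →+* Ser := expNegAM.comp ((dilHom 1).comp expNegBN)

theorem isGood_sewHom : IsGood sewHom :=
  isGood_expNegAM.comp ((isGood_dilHom 1).comp isGood_expNegBN)

theorem isGood_H1 : IsGood (expNegAM.comp (dilHom 1)) := isGood_expNegAM.comp (isGood_dilHom 1)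

theorem comp_inversion_H1 : comp inversion H1 =
    ((expNegAM.comp (dilHom 1)).comp (invHom Complex.I) (X 1),
      (expNegAM.comp (dilHom 1)).comp (invHom Complex.I) phi) := by
  rw [H1_eq, isGood_H1.comp_eq, inversion_eq]
  rfl

/-- The inversion I cancels against the one inside (H⁽²⁾)⁻¹. Composing pairs reverses the order of
endomorphisms, which puts e^{-T₊} outermost. -/
theorem comp_invH2_comp : comp invH2 (comp inversion H1) = (sewHom (X 1), sewHom phi) := by
  rw [comp_inversion_H1, (isGood_H1.comp (isGood_invHom _)).comp_eq, invH2, invH2Hom, sewHom]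
  simp only [RingHom.comp_apply, invHom_I_neg]

theorem sewHom_apply (F : Ser) : sewHom F = expNegAM (dil 1 (expNegBN F)) := by
  rw [sewHom, RingHom.comp_apply, RingHom.comp_apply, dilHom_apply]

/-! ## Supports in the powers of `x` -/

theorem coef_add (F G : Ser) (s : Finset OddVar) (e : EvenVar →₀ ℕ) (n : ℤ) :
    coef (F + G) s e n = coef F s e n + coef G s e n := rfl

theorem coef_sub (F G : Ser) (s : Finset OddVar) (e : EvenVar →₀ ℕ) (n : ℤ) :
    coef (F - G) s e n = coef F s e n - coef G s e n := rfl

theorem coef_neg (F : Ser) (s : Finset OddVar) (e : EvenVar →₀ ℕ) (n : ℤ) :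
    coef (-F) s e n = -coef F s e n := rfl

theorem coef_smul (c : ℂ) (F : Ser) (s : Finset OddVar) (e : EvenVar →₀ ℕ) (n : ℤ) :
    coef (c • F) s e n = c • coef F s e n := rfl

theorem coef_mul_ne_zero {F G : Ser} {s : Finset OddVar} {e : EvenVar →₀ ℕ} {n : ℤ}
    (h : coef (F * G) s e n ≠ 0) : ∃ t u e₁ e₂ a b, Disjoint t u ∧ s = t ∪ u ∧ e = e₁ + e₂ ∧
      n = a + b ∧ coef F t e₁ a ≠ 0 ∧ coef G u e₂ b ≠ 0 := by
  by_contra! hc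
  refine h ?_
  rw [coef_eq, cf_mul_apply, AddMonoidAlgebra.coeff_sum, Finsupp.finsetSum_apply]
  refine sum_eq_zero fun t ht => ?_
  rw [AddMonoidAlgebra.coeff_sum, Finsupp.finsetSum_apply]
  refine sum_eq_zero fun p hp => ?_
  have key : (cf F t p.1 * cf G (s \ t) p.2).coeff n = 0 := by
    rw [AddMonoidAlgebra.coeff_mul]
    refine sum_eq_zero fun a ha => sum_eq_zero fun b hb => if_neg fun hab => ?_
    exact Finsupp.mem_support_iff.1 hb
      (hc t (s \ t) p.1 p.2 a b disjoint_sdiff (union_sdiff_of_subset (mem_powerset.1 ht)).symm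
        (HasAntidiagonal.mem_antidiagonal.1 hp).symm hab.symm (Finsupp.mem_support_iff.1 ha))
  rcases sgn_eq_or (P := Laur) t (s \ t) with h1 | h1
  · rw [h1, one_mul, key]
  · have : ∀ p : Laur, -1 * p = -p := fun p => by ring
    rw [h1, this]
    exact neg_eq_zero.2 key

/-- All terms of `F` have odd part `s` and power `n` of `x` with `Q s n`. -/
def SuppIn (Q : Finset OddVar → ℤ → Prop) (F : Ser) : Prop := ∀ s e n, coef F s e n ≠ 0 → Q s n

theorem SuppIn.mono {Q Q' : Finset OddVar → ℤ → Prop} {F : Ser} (h : SuppIn Q F)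
    (hQ : ∀ s n, Q s n → Q' s n) : SuppIn Q' F := fun s e n hn => hQ s n (h s e n hn)

theorem SuppIn.add {Q : Finset OddVar → ℤ → Prop} {F G : Ser} (hF : SuppIn Q F) (hG : SuppIn Q G) :
    SuppIn Q (F + G) := fun s e n hn => by
  by_contra hc
  refine hn ?_
  rw [coef_add, not_not.1 fun h => hc (hF s e n h), not_not.1 fun h => hc (hG s e n h), add_zero]

theorem SuppIn.neg {Q : Finset OddVar → ℤ → Prop} {F : Ser} (hF : SuppIn Q F) :
    SuppIn Q (-F) := fun s e n hn => hF s e n fun h => hn (by rw [coef_neg, h, neg_zero])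

theorem SuppIn.sub {Q : Finset OddVar → ℤ → Prop} {F G : Ser} (hF : SuppIn Q F) (hG : SuppIn Q G) :
    SuppIn Q (F - G) := by
  rw [sub_eq_add_neg]; exact hF.add hG.neg

theorem SuppIn.smul {Q : Finset OddVar → ℤ → Prop} {F : Ser} (hF : SuppIn Q F) (c : ℂ) :
    SuppIn Q (c • F) := fun s e n hn => hF s e n fun h => hn (by rw [coef_smul, h, smul_zero])

theorem suppIn_zero (Q : Finset OddVar → ℤ → Prop) : SuppIn Q 0 := fun _ _ _ h => absurd rfl h

theorem SuppIn.mul {Q Q₁ Q₂ : Finset OddVar → ℤ → Prop} {F G : Ser} (hF : SuppIn Q₁ F)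
    (hG : SuppIn Q₂ G) (h : ∀ s t m n, Disjoint s t → Q₁ s m → Q₂ t n → Q (s ∪ t) (m + n)) :
    SuppIn Q (F * G) := fun s e n hn => by
  obtain ⟨t, u, e₁, e₂, a, b, hd, rfl, rfl, rfl, h1, h2⟩ := coef_mul_ne_zero hn
  exact h t u a b hd (hF _ _ _ h1) (hG _ _ _ h2)

theorem coef_dx (F : Ser) (s : Finset OddVar) (e : EvenVar →₀ ℕ) (n : ℤ) :
    coef (dx F) s e n = ((n + 1 : ℤ) : Scal) * coef F s e (n + 1) := by
  rw [coef_eq, cf_dx, coeff_derivLaur]; rfl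

theorem coef_dphi (F : Ser) (s : Finset OddVar) (e : EvenVar →₀ ℕ) (n : ℤ) :
    coef (dphi F) s e n = if OddVar.phi ∈ s then 0 else coef F (insert OddVar.phi s) e n := by
  rw [coef_eq, cf_dphi]
  split_ifs <;> rfl

theorem coef_noPhi (F : Ser) (s : Finset OddVar) (e : EvenVar →₀ ℕ) (n : ℤ) :
    coef (noPhi F) s e n = if OddVar.phi ∈ s then 0 else coef F s e n := by
  rw [coef_eq, cf_noPhi]
  split_ifs <;> rfl

theorem coef_phi_mul (F : Ser) (s : Finset OddVar) (e : EvenVar →₀ ℕ) (n : ℤ) :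
    coef (phi * F) s e n = if OddVar.phi ∈ s then coef F (s.erase OddVar.phi) e n else 0 := by
  rw [coef_eq, phi_mul_apply]
  split_ifs <;> rfl

theorem SuppIn.dx {Q Q' : Finset OddVar → ℤ → Prop} {F : Ser} (hF : SuppIn Q F)
    (h : ∀ s n, n ≠ 0 → Q s n → Q' s (n - 1)) : SuppIn Q' (dx F) := fun s e n hn => by
  rw [coef_dx] at hn
  have h0 : n + 1 ≠ 0 := fun h0 => hn (by rw [h0]; simp)
  have := h s (n + 1) h0 (hF s e (n + 1) (right_ne_zero_of_mul hn))
  rwa [add_sub_cancel_right] at this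

theorem SuppIn.dphi {Q Q' : Finset OddVar → ℤ → Prop} {F : Ser} (hF : SuppIn Q F)
    (h : ∀ s n, OddVar.phi ∉ s → Q (insert OddVar.phi s) n → Q' s n) :
    SuppIn Q' (dphi F) := fun s e n hn => by
  rw [coef_dphi] at hn
  split_ifs at hn with hs
  · exact absurd rfl hn
  · exact h s n hs (hF _ e n hn)

theorem SuppIn.noPhi {Q Q' : Finset OddVar → ℤ → Prop} {F : Ser} (hF : SuppIn Q F)
    (h : ∀ s n, OddVar.phi ∉ s → Q s n → Q' s n) :
    SuppIn Q' (noPhi F) := fun s e n hn => by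
  rw [coef_noPhi] at hn
  split_ifs at hn with hs
  · exact absurd rfl hn
  · exact h s n hs (hF _ e n hn)

theorem SuppIn.phi_mul {Q Q' : Finset OddVar → ℤ → Prop} {F : Ser} (hF : SuppIn Q F)
    (h : ∀ s n, OddVar.phi ∉ s → Q s n → Q' (insert OddVar.phi s) n) :
    SuppIn Q' (phi * F) := fun s e n hn => by
  rw [coef_phi_mul] at hn
  split_ifs at hn with hs
  · have := h (s.erase OddVar.phi) n (notMem_erase _ _) (hF _ e n hn)
    rwa [insert_erase hs] at this
  · exact absurd rfl hn

theorem SuppIn.dil {Q : Finset OddVar → ℤ → Prop} {F : Ser} (hF : SuppIn Q F) (k : ℤ) :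
    SuppIn Q (dil k F) := fun s e n hn => hF s e n (coef_dil_ne_zero.1 hn)

theorem suppIn_X {Q : Finset OddVar → ℤ → Prop} {m : ℤ} (h : Q ∅ m) : SuppIn Q (X m) :=
  fun s e n hn => by
    rw [coef_eq, X, ofLaur_apply] at hn
    split_ifs at hn with hs
    · rw [LaurentPolynomial.T_apply] at hn
      split_ifs at hn with hm
      · rw [← hm, hs.1]; exact h
      · exact absurd rfl hn
    · exact absurd rfl hn

theorem suppIn_phi {Q : Finset OddVar → ℤ → Prop} (h : Q {OddVar.phi} 0) : SuppIn Q phi :=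
  fun s e n hn => by
    rw [coef_eq, phi, oddVar, mono_apply] at hn
    split_ifs at hn with hs
    · rw [← LaurentPolynomial.T_zero, LaurentPolynomial.T_apply] at hn
      split_ifs at hn with hm
      · rw [← hm, hs.1]; exact h
      · exact absurd rfl hn
    · exact absurd rfl hn

/-! ## A linear factorization problem -/

open Classical in
/-- The part of `F` in the terms satisfying `Q`. -/
def proj (Q : Finset OddVar → ℤ → Prop) (F : Ser) : Ser := ofCf fun s e =>
  AddMonoidAlgebra.ofCoeff ((cf F s e).coeff.filter (Q s))

open Classical in
theorem coef_proj (Q : Finset OddVar → ℤ → Prop) (F : Ser) (s : Finset OddVar) (e : EvenVar →₀ ℕ)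
    (n : ℤ) : coef (proj Q F) s e n = if Q s n then coef F s e n else 0 := by
  rw [coef_eq, proj, cf_ofCf]
  exact Finsupp.filter_apply _ _ _

theorem suppIn_proj (Q : Finset OddVar → ℤ → Prop) (F : Ser) : SuppIn Q (proj Q F) :=
  fun s e n hn => by
    by_contra h
    exact hn (by rw [coef_proj, if_neg h])

theorem proj_sub (Q : Finset OddVar → ℤ → Prop) (F G : Ser) :
    proj Q (F - G) = proj Q F - proj Q G := coef_ext fun s e n => by
  rw [coef_sub, coef_proj, coef_proj, coef_proj, coef_sub]
  split_ifs <;> simp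

theorem van_iff {d : ℕ} {F : Ser} : Van d F ↔ ∀ s e n, deg s e < d → coef F s e n = 0 :=
  ⟨fun h s e n hs => by rw [coef_eq, h s e hs]; rfl,
    fun h s e hs => AddMonoidAlgebra.ext (Finsupp.ext fun n => h s e n hs)⟩

theorem van_proj (Q : Finset OddVar → ℤ → Prop) {d : ℕ} {F : Ser} (h : Van d F) :
    Van d (proj Q F) := van_iff.2 fun s e n hs => by
  rw [coef_proj, van_iff.1 h s e n hs, ite_self]

/-- Contraction principle for the degree filtration, with completeness provided by the formal
series. -/
theorem exists_fixed_point {C : Ser → Ser}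
    (hC : ∀ d F G, Van d (F - G) → Van (d + 1) (C F - C G)) : ∃ F, C F = F := by
  set a : ℕ → Ser := fun k => C^[k] 0 with ha
  have hsucc : ∀ k, a (k + 1) = C (a k) := fun k => Function.iterate_succ_apply' C k 0
  have h1 : ∀ k, Van k (a (k + 1) - a k) := fun k => by
    induction k with
    | zero => exact van_zero _
    | succ k ih => rw [hsucc, hsucc k]; exact hC _ _ _ (by rwa [← hsucc])
  have h2 : ∀ m k, Van m (a (m + k) - a m) := fun m k => by
    induction k with
    | zero => intro s e _; simp
    | succ k ih =>
      have := ((h1 (m + k)).mono (Nat.le_add_right m k)).add ih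
      rwa [sub_add_sub_cancel] at this
  -- The coefficient at a monomial of degree d no longer changes from the iterate d + 1 on.
  set F : Ser := ofCf fun s e => cf (a (deg s e + 1)) s e with hF
  have h3 : ∀ k, Van k (a k - F) := fun k s e hs => by
    obtain ⟨j, rfl⟩ : ∃ j, k = (deg s e + 1) + j := ⟨k - (deg s e + 1), by omega⟩
    have := h2 (deg s e + 1) j s e (Nat.lt_succ_self _)
    rw [cf_sub_apply] at this ⊢
    rw [hF, cf_ofCf]
    exact this
  refine ⟨F, eq_of_van fun d => ?_⟩
  have h4 := (hC d _ _ (h3 d)).mono (Nat.le_succ d)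
  have h5 := (h3 (d + 1)).mono (Nat.le_succ d)
  rw [hsucc] at h5
  have := h5.sub h4
  rwa [sub_sub_sub_cancel_left] at this

/-- `σ` is `δ` up to a degree raising map. -/
def IsDeform (δ σ : Ser → Ser) : Prop := ∀ d F, Van d F → Van (d + 1) (σ F - δ F)

/-- In the lowest degree of F, σ F equals δ F, and δ keeps every monomial. A lowest term would
therefore lie both in and outside Q. -/
theorem eq_zero_of_deform {δ σ : Ser → Ser} (h : IsDeform δ σ)
    (hδ : ∀ F s e n, coef F s e n ≠ 0 → coef (δ F) s e n ≠ 0) {Q : Finset OddVar → ℤ → Prop}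
    {F : Ser} (hF : SuppIn Q F) (hσ : SuppIn (fun s n => ¬ Q s n) (σ F)) : F = 0 := by
  refine eq_zero_of_van fun d => ?_
  induction d with
  | zero => exact van_zero F
  | succ d ih =>
    refine van_iff.2 fun s e n hs => ?_
    by_contra hc
    have h1 := van_iff.1 (h d F ih) s e n hs
    rw [coef_sub, sub_eq_zero] at h1
    exact hσ s e n (h1 ▸ hδ F s e n hc) (hF s e n hc)

theorem exists_of_deform {σ : Ser →+* Ser} (h : IsDeform (dil 1) σ)
    (Q : Finset OddVar → ℤ → Prop) (N : Ser) :
    ∃ F, SuppIn Q F ∧ SuppIn (fun s n => ¬ Q s n) (σ F - N) := by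
  obtain ⟨F, hF⟩ := exists_fixed_point
    -- Since the dilation preserves supports, F is fixed exactly when F is supported in Q and the
    -- Q-part of σ F − N vanishes.
    (C := fun F => dil (-1) (proj Q (N - (σ F - dil 1 F)))) (fun d F G hFG => by
      have h1 := h d _ hFG
      have e1 : dil (-1) (proj Q (N - (σ F - dil 1 F))) - dil (-1) (proj Q (N - (σ G - dil 1 G))) =
          dil (-1) (proj Q (-(σ (F - G) - dil 1 (F - G)))) := by
        rw [← dilHom_apply, ← dilHom_apply, ← dilHom_apply, ← map_sub, ← proj_sub]
        simp only [← dilHom_apply, map_sub]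
        congr 2
        abel
      rw [e1]
      exact van_dil _ (van_proj _ h1.neg))
  refine ⟨F, ?_, fun s e n hn hQ => hn ?_⟩
  · rw [← hF]; exact (suppIn_proj _ _).dil _
  · have h2 := congrArg (dil 1) hF
    rw [dil_dil_neg] at h2
    have h3 := congrArg (coef · s e n) h2
    simp only [coef_proj, if_pos hQ, coef_sub] at h3
    rw [coef_sub]
    linear_combination -h3

/-! ## Deformations of the dilation -/

theorem expNegAM_sub_van {d : ℕ} {F : Ser} (hF : Van d F) : Van (d + 1) (expNegAM F - F) :=
  expOp_sub_self_van raising_AM.neg hF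

theorem expNegBN_sub_van {d : ℕ} {F : Ser} (hF : Van d F) : Van (d + 1) (expNegBN F - F) :=
  expOp_sub_self_van raising_BN.neg hF

theorem expNegBN_van {d : ℕ} {F : Ser} (hF : Van d F) : Van d (expNegBN F) :=
  expOp_van raising_BN.neg hF

theorem dil_mul (k : ℤ) (F G : Ser) : dil k (F * G) = dil k F * dil k G := by
  simp only [← dilHom_apply, map_mul]

theorem dil_add (k : ℤ) (F G : Ser) : dil k (F + G) = dil k F + dil k G := by
  simp only [← dilHom_apply, map_add]

theorem dil_sub (k : ℤ) (F G : Ser) : dil k (F - G) = dil k F - dil k G := by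
  simp only [← dilHom_apply, map_sub]

theorem dil_neg (k : ℤ) (F : Ser) : dil k (-F) = -dil k F := by
  simp only [← dilHom_apply, map_neg]

theorem isDeform_dil_expNegBN : IsDeform (dil 1) ((dilHom 1).comp expNegBN) := fun d F hF => by
  rw [RingHom.comp_apply, dilHom_apply, ← dil_sub]
  exact van_dil 1 (expNegBN_sub_van hF)

theorem isDeform_expNegAM_dil : IsDeform (dil 1) (expNegAM.comp (dilHom 1)) := fun d F hF => by
  rw [RingHom.comp_apply, dilHom_apply]
  exact expNegAM_sub_van (van_dil 1 hF)

theorem isDeform_sewHom : IsDeform (dil 1) sewHom := fun d F hF => by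
  rw [sewHom_apply, ← sub_add_sub_cancel _ (dil 1 (expNegBN F)) (dil 1 F), ← dil_sub]
  exact (expNegAM_sub_van (van_dil 1 (expNegBN_van hF))).add (van_dil 1 (expNegBN_sub_van hF))

/-! ## The chain rule for superconformal changes of variables -/

/-- The factor with which a superconformal vector field acts on `∂/∂φ + φ ∂/∂x`. -/
def vecFactor (a m : Ser) : Ser := (1 / 2 : ℂ) • dx a + phi * dx m

/-- `-vec a m` twisted by the action on `∂/∂φ + φ ∂/∂x`. -/
def twist (a m : Ser) : Ser →ₗ[ℂ] Ser := -vec a m + LinearMap.mulLeft ℂ (vecFactor a m)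

theorem twist_apply (a m F : Ser) : twist a m F = -vec a m F + vecFactor a m * F := rfl

theorem isEven_vecFactor {a m : Ser} (ha : IsEven a) (hm : IsOdd m) : IsEven (vecFactor a m) := by
  rw [isEven_iff, vecFactor, map_add, map_mul, gradeInv_smul, isEven_iff.1 ha.dx, gradeInv_phi,
    isOdd_iff.1 hm.dx, ser_neg_mul, ser_mul_neg, neg_neg]

theorem twist_mul {a m : Ser} (ha : IsEven a) (hm : IsOdd m) (F G : Ser) :
    twist a m (F * G) = (-vec a m : Ser →ₗ[ℂ] Ser) F * G + F * twist a m G := by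
  rw [twist_apply, twist_apply, LinearMap.neg_apply, vec_mul ha hm, mul_add, ← mul_assoc,
    even_mul_comm (isEven_vecFactor ha hm), mul_assoc, ser_neg_mul, ser_mul_neg]
  abel

theorem twist_raising {a m : Ser} (ha : Van 1 a) (hm : Van 1 m) : Raising (twist a m) :=
  fun d F hF => by
    refine (vec_van ha hm hF).neg.add ?_
    rw [add_comm d]
    exact ((ha.dx.smul _).add (hm.dx.mul_left _)).mul hF

theorem superD_neg_vec {a m : Ser} (ha : IsEven a) (hm : IsOdd m) (ha' : dphi a = 0)
    (hm' : dphi m = 0) (F : Ser) :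
    superD ((-vec a m : Ser →ₗ[ℂ] Ser) F) = twist a m (superD F) := by
  rw [LinearMap.neg_apply, map_neg, superD_vec ha hm ha' hm', twist_apply, ser_neg_mul, vecFactor]
  abel

theorem van_superD {d : ℕ} {F : Ser} (h : Van d F) : Van d (superD F) :=
  h.dphi.add (h.dx.mul_left _)

theorem dx_dil (k : ℤ) (F : Ser) : dx (dil k F) = sqrtAlpha (2 * k) * dil k (dx F) :=
  ser_ext fun s e => by
    rw [cf_dx, cf_dil, derivLaur_C_mul, derivLaur_scaleLaur, sqrtAlpha, ofLaur_mul_apply, cf_dil,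
      cf_dx]
    ring

theorem dphi_dil (k : ℤ) (F : Ser) : dphi (dil k F) = sqrtAlpha k * dil k (dphi F) :=
  ser_ext fun s e => by
    rw [cf_dphi, cf_dil, sqrtAlpha, ofLaur_mul_apply, cf_dil, cf_dphi]
    by_cases h : OddVar.phi ∈ s
    · rw [if_pos h, if_pos h, if_pos h, ← scaleLaurHom_apply, map_zero, mul_zero, mul_zero]
    · rw [if_neg h, if_neg h, if_neg h, if_pos (mem_insert_self _ _), LaurentPolynomial.T_zero,
        map_one, one_mul]

/-- φ has half the weight of x, so both summands of D scale by the same factor. -/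
theorem superD_dil (k : ℤ) (F : Ser) : superD (dil k F) = sqrtAlpha k * dil k (superD F) := by
  have h : ∀ K, phi * (sqrtAlpha (2 * k) * K) = sqrtAlpha k * (sqrtAlpha k * phi * K) := fun K => by
    rw [two_mul, sqrtAlpha_add, mul_assoc, ← mul_assoc phi, ← sqrtAlpha_comm k phi, mul_assoc,
      ← mul_assoc phi, ← sqrtAlpha_comm k phi]
  rw [superD_apply, superD_apply, dphi_dil, dx_dil, dil_add, dil_mul, dil_phi, mul_add, h]

/-- The endomorphism of series with which `sewHom` intertwines along `∂/∂φ + φ ∂/∂x`. -/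
def sewTwist (F : Ser) : Ser := expOp (twist gA gM) (sqrtAlpha 1 * dil 1 (expOp (twist gB gN) F))

theorem raising_twist_AM : Raising (twist gA gM) := twist_raising hasBideg_gA.van hasBideg_gM.van
theorem raising_twist_BN : Raising (twist gB gN) := twist_raising hasBideg_gB.van hasBideg_gN.van

theorem sewTwist_sub (F G : Ser) : sewTwist (F - G) = sewTwist F - sewTwist G := by
  rw [sewTwist, expOp_sub raising_twist_BN, dil_sub, ser_mul_sub, expOp_sub raising_twist_AM]
  rfl

/-- Semilinearity along `sewHom`, needed to carry the product ψ Dψ in the defect. -/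
theorem sewTwist_mul (F G : Ser) : sewTwist (F * G) = sewHom F * sewTwist G := by
  rw [sewTwist, expOp_mul raising_twist_BN raising_BN.neg (twist_mul isEven_gB isOdd_gN), dil_mul,
    ← mul_assoc, sqrtAlpha_comm, mul_assoc,
    expOp_mul raising_twist_AM raising_AM.neg (twist_mul isEven_gA isOdd_gM), sewHom_apply,
    expNegAM_apply, expNegBN_apply, sewTwist]

/-- The chain rule for D, assembled from the two exponentials and the dilation. -/
theorem superD_sewHom (F : Ser) : superD (sewHom F) = sewTwist (superD F) := by
  rw [sewHom_apply, expNegAM_apply, expNegBN_apply,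
    expOp_semiconj raising_twist_AM raising_AM.neg (fun _ _ => van_superD)
      (superD_neg_vec isEven_gA isOdd_gM dphi_gA dphi_gM), superD_dil,
    expOp_semiconj raising_twist_BN raising_BN.neg (fun _ _ => van_superD)
      (superD_neg_vec isEven_gB isOdd_gN dphi_gB dphi_gN)]
  rfl

theorem isDeform_sewTwist : IsDeform (fun F => sqrtAlpha 1 * dil 1 F) sewTwist := fun d F hF => by
  have h1 := (van_dil 1 (expOp_sub_self_van raising_twist_BN hF)).mul_left (sqrtAlpha 1)
  rw [dil_sub, ser_mul_sub] at h1
  have h3 := expOp_sub_self_van raising_twist_AM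
    ((van_dil 1 (expOp_van raising_twist_BN hF)).mul_left (sqrtAlpha 1))
  have := h3.add h1
  rwa [sub_add_sub_cancel] at this

theorem coef_sqrtAlpha_mul (k : ℤ) (F : Ser) (s : Finset OddVar) (e : EvenVar →₀ ℕ) (n : ℤ) :
    coef (sqrtAlpha k * F) s e n = LaurentPolynomial.T k * coef F s e n := by
  rw [coef_eq, sqrtAlpha, ofLaur_mul_apply, ← LaurentPolynomial.smul_eq_C_mul,
    AddMonoidAlgebra.coeff_smul_apply, smul_eq_mul]
  rfl

theorem coef_sqrtAlpha_mul_ne_zero {k : ℤ} {F : Ser} {s : Finset OddVar} {e : EvenVar →₀ ℕ}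
    {n : ℤ} : coef (sqrtAlpha k * F) s e n ≠ 0 ↔ coef F s e n ≠ 0 := by
  rw [coef_sqrtAlpha_mul]
  exact not_congr ((LaurentPolynomial.isUnit_T _).mul_right_eq_zero)

/-- The defect of superconformality. -/
def defect (F : SFun) : Ser := superD F.1 - F.2 * superD F.2

theorem defect_sewHom (F : SFun) : defect (sewHom F.1, sewHom F.2) = sewTwist (defect F) := by
  rw [defect, defect, superD_sewHom, superD_sewHom, sewTwist_sub, sewTwist_mul]

theorem isEven_dphi {F : Ser} (h : IsOdd F) : IsEven (dphi F) := by
  rw [isEven_iff, gradeInv_dphi, isOdd_iff.1 h, dphi_neg, neg_neg]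

theorem noPhi_phi : noPhi phi = 0 := by
  have := noPhi_phi_mul 1
  rwa [mul_one] at this

/-- The φ-free part of the defect gives the equation for ξ, its φ-part the equation for g². -/
theorem superconformal_eqs_of_defect {F : SFun} (h2 : IsOdd F.2) (h : defect F = 0) :
    dphi F.1 = dphi F.2 * noPhi F.2 ∧
      dphi F.2 * dphi F.2 = dx (noPhi F.1) + noPhi F.2 * dx (noPhi F.2) := by
  rw [defect, sub_eq_zero] at h
  constructor
  · have h1 := congrArg noPhi h
    rw [superD_apply, superD_apply, noPhi_mul, noPhi_add, noPhi_add, noPhi_phi_mul, noPhi_phi_mul,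
      add_zero, add_zero, noPhi_dphi, noPhi_dphi] at h1
    rw [h1, even_mul_comm (isEven_dphi h2)]
  · have h1 := congrArg (fun K => noPhi (dphi K)) h
    simp only [superD_apply, dphi_add, dphi_dphi, dphi_mul, isOdd_iff.1 h2, gradeInv_phi, noPhi_add,
      noPhi_mul, noPhi_dphi, noPhi_dx, zero_add, noPhi_neg, ser_neg_mul, dphi_phi, noPhi_phi,
      one_mul, zero_mul, add_zero, neg_zero] at h1
    rw [h1]
    abel

/-! ## Normalized solutions -/

/-- The powers of `x` which occur in the second factor. -/
def IsPos (s : Finset OddVar) (n : ℤ) : Prop := (OddVar.phi ∈ s ∧ 0 ≤ n) ∨ (OddVar.phi ∉ s ∧ 1 ≤ n)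

/-- The powers of `x` which occur in the first factor, apart from its leading terms. -/
def IsNeg (s : Finset OddVar) (n : ℤ) : Prop := ¬ IsPos s n

theorem isNeg_iff {s : Finset OddVar} {n : ℤ} :
    IsNeg s n ↔ (OddVar.phi ∈ s ∧ n ≤ -1) ∨ (OddVar.phi ∉ s ∧ n ≤ 0) := by
  rw [IsNeg, IsPos]
  by_cases h : OddVar.phi ∈ s <;> simp [h] <;> omega

theorem inClass2_iff {F : Ser} : InClass2 F ↔ SuppIn IsPos F := by
  refine forall_congr' fun s => forall_congr' fun e => forall_congr' fun n => imp_congr_right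
    fun _ => ?_
  rw [IsPos]
  by_cases h : OddVar.phi ∈ s <;> simp [h]
  omega

/-- The term of `F` without `x` and `φ`. -/
def constPart (F : Ser) : Ser := ofCf fun s e =>
  if OddVar.phi ∈ s then 0 else LaurentPolynomial.C (coef F s e 0)

theorem coef_constPart (F : Ser) (s : Finset OddVar) (e : EvenVar →₀ ℕ) (n : ℤ) :
    coef (constPart F) s e n = if OddVar.phi ∉ s ∧ n = 0 then coef F s e 0 else 0 := by
  rw [coef_eq, constPart, cf_ofCf]
  by_cases h : OddVar.phi ∈ s
  · simp [h]
  · simp only [h, if_false, not_false_eq_true, true_and]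
    exact LaurentPolynomial.C_apply _ _

/-- The first factor, normalized. -/
def IsNormal (F : SFun) : Prop :=
  SuppIn IsNeg (F.2 - phi) ∧ SuppIn IsNeg (F.1 - (X 1 + phi * constPart F.2))

/-- The second components are compared first: the prescribed leading term of the first component
involves the second one. Once they agree, the leading terms cancel in the difference. -/
theorem eq_of_isNormal {σ : Ser →+* Ser} (h : IsDeform (dil 1) σ) {F G : SFun}
    (hF : SuppIn IsPos F.1 ∧ SuppIn IsPos F.2) (hG : SuppIn IsPos G.1 ∧ SuppIn IsPos G.2)
    (hF' : IsNormal (σ F.1, σ F.2)) (hG' : IsNormal (σ G.1, σ G.2)) : F = G := by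
  have hδ : ∀ F s e n, coef F s e n ≠ 0 → coef (dil 1 F) s e n ≠ 0 := fun F s e n =>
    coef_dil_ne_zero.2
  have h2 : F.2 = G.2 := by
    refine sub_eq_zero.1 (eq_zero_of_deform h hδ (hF.2.sub hG.2) ?_)
    have := hF'.1.sub hG'.1
    rwa [sub_sub_sub_cancel_right, ← map_sub] at this
  have h1 : F.1 = G.1 := by
    refine sub_eq_zero.1 (eq_zero_of_deform h hδ (hF.1.sub hG.1) ?_)
    have := hF'.2.sub hG'.2
    dsimp only at this
    rwa [h2, sub_sub_sub_cancel_right, ← map_sub] at this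
  exact Prod.ext h1 h2

theorem exists_isNormal {σ : Ser →+* Ser} (h : IsDeform (dil 1) σ) :
    ∃ F : SFun, SuppIn IsPos F.1 ∧ SuppIn IsPos F.2 ∧ IsNormal (σ F.1, σ F.2) := by
  obtain ⟨F₂, h1, h2⟩ := exists_of_deform h IsPos phi
  obtain ⟨F₁, h3, h4⟩ := exists_of_deform h IsPos (X 1 + phi * constPart (σ F₂))
  exact ⟨(F₁, F₂), h3, h1, h2, h4⟩

/-- In DK the φ-part of K loses its φ, and only the φ-free part, which starts at x¹, is
differentiated in x; no negative power arises. -/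
theorem defect_suppIn_of_pos {F : SFun} (h1 : SuppIn IsPos F.1) (h2 : SuppIn IsPos F.2) :
    SuppIn (fun _ n => 0 ≤ n) (defect F) := by
  have hD : ∀ K, SuppIn IsPos K → SuppIn (fun _ n => 0 ≤ n) (superD K) := fun K hK => by
    refine SuppIn.add (hK.dphi fun s n hs h => ?_) (SuppIn.phi_mul (Q := fun s n =>
      OddVar.phi ∉ s → 0 ≤ n) (hK.dx fun s n _ h hs => ?_) fun s n hs h => h hs)
    · rcases h with h | h <;> omega
    · rcases h with h | h
      · exact absurd h.1 hs
      · omega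
  refine (hD _ h1).sub (SuppIn.mul (Q₁ := fun _ n => 0 ≤ n) (h2.mono fun s n h => ?_) (hD _ h2)
    fun s t m n _ hm hn => add_nonneg hm hn)
  rcases h with h | h <;> omega

theorem dx_X_one : dx (X 1) = 1 := by
  rw [X, dx_ofLaur, derivLaur_T]
  simp [ofLaur_one]

theorem dphi_X (n : ℤ) : dphi (X n) = 0 := dphi_ofLaur _

theorem dx_constPart (F : Ser) : dx (constPart F) = 0 := coef_ext fun s e n => by
  rw [coef_dx, coef_constPart]
  split_ifs with h
  · rw [h.2]; simp; rfl
  · simp; rfl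

theorem noPhi_constPart (F : Ser) : noPhi (constPart F) = constPart F := coef_ext fun s e n => by
  rw [coef_noPhi, coef_constPart]
  split_ifs <;> simp_all

theorem superD_low {K : Ser} (hK : SuppIn IsNeg K) : SuppIn (fun _ n => n ≤ -1) (superD K) := by
  refine SuppIn.add (hK.dphi fun s n hs h => ?_) (SuppIn.phi_mul (Q := fun s n =>
    OddVar.phi ∉ s → n ≤ -1) (hK.dx fun s n _ h hs => ?_) fun s n hs h => h hs)
  · rcases isNeg_iff.1 h with h | h
    · exact h.2
    · exact absurd (mem_insert_self _ _) h.1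
  · rcases isNeg_iff.1 h with h | h
    · exact absurd h.1 hs
    · omega

/-- The leading pair (x + φc, φ) is chosen for this: D(x + φc) = φ + c, and c cancels the x⁰ term of
the second component in the defect. -/
theorem defect_suppIn_of_normal {F : SFun} (h : IsNormal F) :
    SuppIn (fun _ n => n ≤ -1) (defect F) := by
  obtain ⟨h2, h1⟩ := h
  obtain ⟨r₁, hr₁⟩ : ∃ r, r = F.1 - (X 1 + phi * constPart F.2) := ⟨_, rfl⟩
  obtain ⟨r₂, hr₂⟩ : ∃ r, r = F.2 - phi := ⟨_, rfl⟩
  rw [← hr₁] at h1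
  rw [← hr₂] at h2
  have e1 : F.1 = X 1 + phi * constPart F.2 + r₁ := by rw [hr₁]; abel
  have e2 : F.2 = phi + r₂ := by rw [hr₂]; abel
  have d1 : superD F.1 = phi + constPart F.2 + superD r₁ := by
    rw [e1, map_add, map_add]
    congr 1
    rw [superD_apply, superD_apply, dphi_X, dx_X_one, dphi_phi_mul, noPhi_constPart, dx_mul, dx_phi,
      dx_constPart, zero_mul, mul_zero, add_zero, mul_zero, add_zero, zero_add, mul_one]
  have d2 : superD F.2 = 1 + superD r₂ := by
    rw [e2, map_add, superD_apply phi, dphi_phi, dx_phi, mul_zero, add_zero]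
  have e3 : defect F = superD r₁ - (r₂ - constPart F.2) - phi * superD r₂ - r₂ * superD r₂ := by
    rw [defect, d1, d2]
    nth_rewrite 2 [e2]
    rw [add_mul, mul_add, mul_add, mul_one, mul_one]
    abel
  rw [e3]
  refine (((superD_low h1).sub ?_).sub ?_).sub ?_
  -- Without φ, r₂ has powers n ≤ 0, and its x⁰ term is exactly the subtracted one; with φ, it
  -- already has n ≤ −1.
  · intro s e n hn
    rw [coef_sub, coef_constPart] at hn
    by_cases hs : OddVar.phi ∉ s ∧ n = 0
    · rw [if_pos hs, hs.2, e2, coef_add, coef_eq phi, phi, oddVar, mono_apply, if_neg] at hn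
      · simp at hn
      · rintro ⟨rfl, -⟩; simp at hs
    · rw [if_neg hs, sub_zero] at hn
      have := isNeg_iff.1 (h2 s e n hn)
      by_contra hc
      rcases this with h | h
      · omega
      · exact hs ⟨h.1, by omega⟩
  · exact (superD_low h2).phi_mul fun s n _ h => h
  · refine SuppIn.mul (Q₁ := fun _ n => n ≤ 0) (h2.mono fun s n h => ?_) (superD_low h2)
      fun s t m n _ hm hn => ?_
    · rcases isNeg_iff.1 h with h | h <;> omega
    · omega

/-- The defect has powers n ≥ 0 before `sewTwist` and n ≤ −1 after it, while `sewTwist` keeps its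
lowest-degree monomials. -/
theorem defect_eq_zero {F : SFun} (h1 : SuppIn IsPos F.1) (h2 : SuppIn IsPos F.2)
    (h : IsNormal (sewHom F.1, sewHom F.2)) : defect F = 0 := by
  refine eq_zero_of_deform isDeform_sewTwist (fun K s e n hn =>
    coef_sqrtAlpha_mul_ne_zero.2 (coef_dil_ne_zero.2 hn)) (defect_suppIn_of_pos h1 h2) ?_
  rw [← defect_sewHom]
  exact (defect_suppIn_of_normal h).mono fun s n h => by omega

/-! ## Superconformal series are normalized -/

/-- The square root near 1. Induction on the degree in 2h = r − h²: as h has no term of degree 0, h²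
involves in each degree only terms of h of smaller degree. -/
theorem nonpos_of_sq {h r : Ser} (hr : SuppIn (fun _ n => n ≤ -1) r) (h1 : Van 1 h)
    (e : h + h + h * h = r) : SuppIn (fun _ n => n ≤ -1) h := by
  have key : ∀ d s e n, deg s e < d → coef h s e n ≠ 0 → n ≤ -1 := by
    intro d
    induction d with
    | zero => intro s e n hs; omega
    | succ d ih =>
      intro s f n hs hn
      by_contra hc
      have h2 : coef (h * h) s f n = 0 := by
        by_contra hne
        obtain ⟨t, u, e₁, e₂, a, b, hd, rfl, rfl, rfl, ha, hb⟩ := coef_mul_ne_zero hne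
        have ht : 1 ≤ deg t e₁ := by
          by_contra hlt
          exact ha (van_iff.1 h1 t e₁ a (by omega))
        have hu : 1 ≤ deg u e₂ := by
          by_contra hlt
          exact hb (van_iff.1 h1 u e₂ b (by omega))
        rw [deg_union hd] at hs
        have := ih t e₁ a (by omega) ha
        have := ih u e₂ b (by omega) hb
        omega
      have h3 : coef r s f n = 0 := not_not.1 fun hne => hc (hr s f n hne)
      have h4 := congrArg (coef · s f n) e
      simp only [coef_add, h2, h3, add_zero] at h4
      have h5 : (2 : ℂ) • coef h s f n = 0 := by rw [two_smul]; exact h4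
      exact hn ((smul_eq_zero.1 h5).resolve_left two_ne_zero)
  exact fun s e n => key (deg s e + 1) s e n (Nat.lt_succ_self _)

theorem noPhi_X (n : ℤ) : noPhi (X n) = X n := by
  conv_rhs => rw [← noPhi_add_phi_mul_dphi (X n), dphi_X, mul_zero, add_zero]

/-- From g² = f′ + ψψ′ = 1 + (negative powers) follows g = 1 + (negative powers). Then ξ = gψ
differs from ψ by negative powers, so its x⁰ term is that of ψ. -/
theorem isNormal_of_superconformal {F : SFun}
    (hξ : dphi F.1 = dphi F.2 * noPhi F.2)
    (hg : dphi F.2 * dphi F.2 = dx (noPhi F.1) + noPhi F.2 * dx (noPhi F.2))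
    (hf : SuppIn (fun _ n => n ≤ 0) (noPhi F.1 - X 1))
    (hψ : SuppIn (fun _ n => n ≤ 0) (noPhi F.2)) (h0 : Van 1 (dphi F.2 - 1)) : IsNormal F := by
  obtain ⟨h, hh⟩ : ∃ h, h = dphi F.2 - 1 := ⟨_, rfl⟩
  have hg' : dphi F.2 = 1 + h := by rw [hh]; abel
  rw [← hh] at h0
  have hdψ : SuppIn (fun _ n => n ≤ -1) (noPhi F.2 * dx (noPhi F.2)) :=
    hψ.mul (Q₂ := fun _ n => n ≤ -1) (hψ.dx fun s n _ h => by omega) fun s t m n _ h h' => by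
      omega
  have hlow : SuppIn (fun _ n => n ≤ -1) h := by
    refine nonpos_of_sq (r := dx (noPhi F.1 - X 1) + noPhi F.2 * dx (noPhi F.2)) ?_ h0 ?_
    · exact SuppIn.add (hf.dx fun s n _ h => by omega) hdψ
    · rw [hg', add_mul, mul_add, mul_add, one_mul, one_mul, mul_one] at hg
      rw [dx_sub, dx_X_one, sub_add_eq_add_sub, ← hg]
      abel
  have hgψ : SuppIn (fun _ n => n ≤ -1) (h * noPhi F.2) :=
    hlow.mul hψ fun s t m n _ h h' => by omega
  have hc : SuppIn (fun _ n => n ≤ -1) (noPhi F.2 - constPart F.2) := fun s e n hn => by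
    rw [coef_sub, coef_constPart] at hn
    by_cases hs : OddVar.phi ∉ s ∧ n = 0
    · rw [if_pos hs, coef_noPhi, if_neg hs.1, hs.2, sub_self] at hn
      exact absurd rfl hn
    · rw [if_neg hs, sub_zero] at hn
      have h1 := hψ s e n hn
      have h2 : OddVar.phi ∉ s := fun h' => hn (by rw [coef_noPhi, if_pos h'])
      by_contra hlt
      exact hs ⟨h2, by omega⟩
  constructor
  · have e1 : F.2 - phi = noPhi F.2 + phi * h := by
      conv_lhs => rw [← noPhi_add_phi_mul_dphi F.2, hg', mul_add, mul_one]
      abel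
    rw [e1]
    refine SuppIn.add ?_ (hlow.phi_mul fun s n _ h => isNeg_iff.2 (Or.inl ⟨mem_insert_self _ _, h⟩))
    rw [← noPhi_noPhi]
    exact hψ.noPhi fun s n hs h => isNeg_iff.2 (Or.inr ⟨hs, h⟩)
  · have e1 : F.1 - (X 1 + phi * constPart F.2) = noPhi (noPhi F.1 - X 1) +
        phi * ((noPhi F.2 - constPart F.2) + h * noPhi F.2) := by
      conv_lhs => rw [← noPhi_add_phi_mul_dphi F.1, hξ, hg', add_mul, one_mul]
      rw [noPhi_sub, noPhi_noPhi, noPhi_X, mul_add, mul_add, ser_mul_sub]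
      abel
    rw [e1]
    exact SuppIn.add (hf.noPhi fun s n hs h => isNeg_iff.2 (Or.inr ⟨hs, h⟩))
      ((hc.add hgψ).phi_mul fun s n _ h => isNeg_iff.2 (Or.inl ⟨mem_insert_self _ _, h⟩))

/-! ## Setting variables to zero -/

/-- A degree function on monomials which does not see `φ`. -/
structure IsDegree (d : Finset OddVar → (EvenVar →₀ ℕ) → ℕ) : Prop where
  empty : d ∅ 0 = 0
  union : ∀ s t e f, Disjoint s t → d (s ∪ t) (e + f) = d s e + d t f
  insert_phi : ∀ s e, d (insert OddVar.phi s) e = d s e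

theorem isDegree_AM : IsDegree degAM :=
  ⟨by simp [degAM], fun _ _ e f h => degAM_union h e f, degAM_insert_phi⟩

theorem isDegree_BN : IsDegree degBN :=
  ⟨by simp [degBN], fun _ _ e f h => degBN_union h e f, degBN_insert_phi⟩

/-- The terms of degree zero. -/
def cut {d : Finset OddVar → (EvenVar →₀ ℕ) → ℕ} (hd : IsDegree d) : Ser →+* Ser :=
  diag (RingHom.id _) (fun s e => if d s e = 0 then 1 else 0)
    ⟨if_pos hd.empty, fun s t e f h => by
      rw [hd.union s t e f h]
      by_cases h1 : d s e = 0 <;> by_cases h2 : d t f = 0 <;> simp [h1, h2]⟩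

section Cut

variable {d : Finset OddVar → (EvenVar →₀ ℕ) → ℕ} (hd : IsDegree d)

theorem cf_cut (F : Ser) (s : Finset OddVar) (e : EvenVar →₀ ℕ) :
    cf (cut hd F) s e = if d s e = 0 then cf F s e else 0 := by
  rw [cut, diag_apply]
  split_ifs <;> simp

theorem coef_cut (F : Ser) (s : Finset OddVar) (e : EvenVar →₀ ℕ) (n : ℤ) :
    coef (cut hd F) s e n = if d s e = 0 then coef F s e n else 0 := by
  rw [coef_eq, cf_cut]
  split_ifs <;> rfl

theorem SuppIn.cut {Q : Finset OddVar → ℤ → Prop} {F : Ser} (h : SuppIn Q F) :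
    SuppIn Q (cut hd F) := fun s e n hn => h s e n fun h0 => hn (by rw [coef_cut, h0, ite_self])

theorem van_cut {k : ℕ} {F : Ser} (h : Van k F) : Van k (cut hd F) := fun s e hs => by
  rw [cf_cut, h s e hs, ite_self]

theorem cut_smul (c : ℂ) (F : Ser) : cut hd (c • F) = c • cut hd F := ser_ext fun s e => by
  rw [cf_cut, cf_smul_apply, cf_smul_apply, cf_cut]
  split_ifs <;> simp

/-- `cut` as a linear map. -/
def cutLin : Ser →ₗ[ℂ] Ser := ⟨⟨cut hd, map_add _⟩, cut_smul hd⟩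

theorem cut_dx (F : Ser) : cut hd (dx F) = dx (cut hd F) := ser_ext fun s e => by
  rw [cf_cut, cf_dx, cf_dx, cf_cut]
  split_ifs
  · rfl
  · rw [derivLaur_zero]

theorem cut_dphi (F : Ser) : cut hd (dphi F) = dphi (cut hd F) := ser_ext fun s e => by
  rw [cf_cut, cf_dphi, cf_dphi, cf_cut, hd.insert_phi]
  split_ifs <;> rfl

theorem cut_eq_self {F : Ser} (h : ∀ s e, cf F s e ≠ 0 → d s e = 0) : cut hd F = F :=
  ser_ext fun s e => by
    rw [cf_cut]
    split_ifs with h'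
    · rfl
    · by_contra hc
      exact h' (h s e (Ne.symm hc))

theorem cut_eq_zero {F : Ser} (h : ∀ s e, cf F s e ≠ 0 → d s e ≠ 0) : cut hd F = 0 :=
  ser_ext fun s e => by
    rw [cf_cut]
    split_ifs with h'
    · by_contra hc
      exact h s e hc h'
    · rfl

theorem cut_X (n : ℤ) : cut hd (X n) = X n := cut_eq_self hd fun s e h => by
  rw [X, ofLaur_apply] at h
  split_ifs at h with hs
  · rw [hs.1, hs.2, hd.empty]
  · exact absurd rfl h

theorem cut_phi : cut hd phi = phi := cut_eq_self hd fun s e h => by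
  rw [phi, oddVar, mono_apply] at h
  split_ifs at h with hs
  · rw [hs.1, hs.2, ← insert_empty_eq, hd.insert_phi, hd.empty]
  · exact absurd rfl h

theorem cut_vec (a m F : Ser) :
    cut hd (vec a m F) = vec (cut hd a) (cut hd m) (cut hd F) := by
  simp only [vec_apply, map_neg, map_add, map_mul, map_sub, cut_smul, cut_dx, cut_dphi, cut_phi]

theorem cut_dil (k : ℤ) (F : Ser) : cut hd (dil k F) = dil k (cut hd F) := coef_ext fun s e n => by
  rw [coef_cut, coef_dil, coef_dil, coef_cut]
  split_ifs <;> simp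

theorem cut_constPart (F : Ser) : cut hd (constPart F) = constPart (cut hd F) :=
  coef_ext fun s e n => by
    rw [coef_cut, coef_constPart, coef_constPart, coef_cut]
    split_ifs <;> rfl

theorem IsNormal.cut {F : SFun} (h : IsNormal F) : IsNormal (cut hd F.1, cut hd F.2) := by
  constructor
  · have := h.1.cut hd
    rwa [map_sub, cut_phi] at this
  · have := h.2.cut hd
    rwa [map_sub, map_add, map_mul, cut_phi, cut_X, cut_constPart] at this

theorem vec_zero_zero (F : Ser) : vec 0 0 F = 0 := by
  rw [vec_apply, dx_zero]; simp

/-- Truncation intertwines the vector field with the zero operator, whose exponential is the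
identity. -/
theorem cut_exp_eq_self {a m : Ser} (hr : Raising (vec a m)) (ha : cut hd a = 0)
    (hm : cut hd m = 0) (F : Ser) :
    cut hd (expOp (-vec a m : Ser →ₗ[ℂ] Ser) F) = cut hd F := by
  have h0 : Raising 0 := fun d F _ s e _ => rfl
  have := expOp_semiconj (J := cutLin hd) h0 hr.neg (fun _ _ => van_cut hd) (fun G => by
    change cut hd (-vec a m G) = 0
    rw [map_neg, cut_vec, ha, hm, vec_zero_zero, neg_zero]) F
  exact this.trans (expOp_of_eq_zero h0 rfl)

theorem cut_exp_comm {a m : Ser} (hr : Raising (vec a m)) (ha : cut hd a = a)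
    (hm : cut hd m = m) (F : Ser) :
    cut hd (expOp (-vec a m : Ser →ₗ[ℂ] Ser) F) =
      expOp (-vec a m : Ser →ₗ[ℂ] Ser) (cut hd F) :=
  expOp_semiconj (J := cutLin hd) hr.neg hr.neg (fun _ _ => van_cut hd) (fun G => by
    change cut hd (-vec a m G) = -vec a m (cut hd G)
    rw [map_neg, cut_vec, ha, hm]) F

end Cut

theorem atAM0_eq (F : Ser) : atAM0 F = cut isDegree_AM F := ser_ext fun s e => (cf_cut _ F s e).symm

theorem atBN0_eq (F : Ser) : atBN0 F = cut isDegree_BN F := ser_ext fun s e => (cf_cut _ F s e).symm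

theorem atAM0_sewHom (F : Ser) :
    atAM0 (sewHom F) = (dilHom 1).comp expNegBN (atAM0 F) := by
  rw [atAM0_eq, atAM0_eq, sewHom_apply, expNegAM_apply,
    cut_exp_eq_self isDegree_AM raising_AM, cut_dil, expNegBN_apply,
    cut_exp_comm isDegree_AM raising_BN, RingHom.comp_apply, dilHom_apply, expNegBN_apply]
  · exact cut_eq_self _ fun s e h => (hasBideg_gB s e h).1
  · exact cut_eq_self _ fun s e h => (hasBideg_gN s e h).1
  · exact cut_eq_zero _ fun s e h => by rw [(hasBideg_gA s e h).1]; exact one_ne_zero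
  · exact cut_eq_zero _ fun s e h => by rw [(hasBideg_gM s e h).1]; exact one_ne_zero

theorem atBN0_sewHom (F : Ser) :
    atBN0 (sewHom F) = expNegAM.comp (dilHom 1) (atBN0 F) := by
  rw [atBN0_eq, atBN0_eq, sewHom_apply, expNegAM_apply,
    cut_exp_comm isDegree_BN raising_AM, cut_dil, expNegBN_apply,
    cut_exp_eq_self isDegree_BN raising_BN, RingHom.comp_apply, dilHom_apply, expNegAM_apply]
  · exact cut_eq_zero _ fun s e h => by rw [(hasBideg_gB s e h).2]; exact one_ne_zero
  · exact cut_eq_zero _ fun s e h => by rw [(hasBideg_gN s e h).2]; exact one_ne_zero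
  · exact cut_eq_self _ fun s e h => (hasBideg_gA s e h).2
  · exact cut_eq_self _ fun s e h => (hasBideg_gM s e h).2

/-! ## The boundary values -/

theorem suppIn_of_approx {Q : Finset OddVar → ℤ → Prop} {G : Ser}
    (h : ∀ N, ∃ G', SuppIn Q G' ∧ Van N (G - G')) : SuppIn Q G := fun s e n hn => by
  obtain ⟨G', h1, h2⟩ := h (deg s e + 1)
  have := van_iff.1 h2 s e n (Nat.lt_succ_self _)
  rw [coef_sub, sub_eq_zero] at this
  exact h1 s e n (this ▸ hn)

theorem suppIn_expOp {Q : Finset OddVar → ℤ → Prop} {T : Ser →ₗ[ℂ] Ser} (hT : Raising T)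
    (hQ : ∀ G, SuppIn Q G → SuppIn Q (T G)) {F : Ser} (hF : SuppIn Q F) : SuppIn Q (expOp T F) :=
  expOp_mem hT (SuppIn Q) (fun _ => suppIn_of_approx) (fun _ _ => SuppIn.add)
    (fun c _ h => h.smul c) hF hQ

/-- F itself may violate the support condition, as x does for nonpositive powers; only T F has to
satisfy it. -/
theorem suppIn_expOp_sub {Q : Finset OddVar → ℤ → Prop} {T : Ser →ₗ[ℂ] Ser} (hT : Raising T)
    (hQ : ∀ G, SuppIn Q G → SuppIn Q (T G)) {F : Ser} (hF : SuppIn Q (T F)) :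
    SuppIn Q (expOp T F - F) := by
  have hit : ∀ n, SuppIn Q (expTerm T F (n + 1)) := fun n => by
    refine SuppIn.smul ?_ _
    induction n with
    | zero => exact hF
    | succ n ih => rw [Function.iterate_succ_apply']; exact hQ _ ih
  refine suppIn_of_approx fun N => ⟨∑ n ∈ range N, expTerm T F (n + 1), ?_, ?_⟩
  · exact sum_induction _ (SuppIn Q) (fun _ _ => SuppIn.add) (suppIn_zero Q) fun n _ => hit n
  · have := (expOp_sub_van hT F (N + 1)).mono (Nat.le_succ N)
    rw [sum_range_succ'] at this
    have h0 : expTerm T F 0 = F := by simp [expTerm]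
    rwa [h0, sub_add_eq_sub_sub, sub_right_comm] at this

theorem suppIn_gA : SuppIn (fun s n => OddVar.phi ∉ s ∧ 2 ≤ n) gA := fun s e n h => by
  obtain ⟨j, rfl, -, rfl⟩ := coef_gA_ne_zero h
  have := j.pos
  exact ⟨by simp, by omega⟩
theorem suppIn_gM : SuppIn (fun s n => OddVar.phi ∉ s ∧ 1 ≤ n) gM := fun s e n h => by
  obtain ⟨j, rfl, -, rfl⟩ := coef_gM_ne_zero h
  have := j.pos
  exact ⟨by simp, by omega⟩
theorem suppIn_gB : SuppIn (fun _ n => n ≤ 0) gB := fun s e n h => by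
  obtain ⟨j, rfl, -, rfl⟩ := coef_gB_ne_zero h
  have := j.pos
  omega
theorem suppIn_gN : SuppIn (fun _ n => n ≤ 0) gN := fun s e n h => by
  obtain ⟨j, rfl, -, rfl⟩ := coef_gN_ne_zero h
  have := j.pos
  omega

/-- The hypotheses concern the derivatives and not F, so that a multiple of x is allowed. -/
theorem vec_BN_nonpos {F : Ser} (h1 : SuppIn (fun _ n => n ≤ 0) (dx F))
    (h2 : SuppIn (fun _ n => n ≤ 0) (dphi F)) : SuppIn (fun _ n => n ≤ 0) (vec gB gN F) := by
  have hmul : ∀ {F G : Ser}, SuppIn (fun _ n => n ≤ 0) F → SuppIn (fun _ n => n ≤ 0) G →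
      SuppIn (fun _ n => n ≤ 0) (F * G) := fun hF hG => hF.mul hG fun s t m n _ h h' => by omega
  have hphi : ∀ {F : Ser}, SuppIn (fun _ n => n ≤ 0) F →
      SuppIn (fun _ n => n ≤ 0) (phi * F) := fun hF => hF.phi_mul fun s n _ h => h
  rw [vec_apply]
  exact (((hmul suppIn_gB h1).add ((hphi (hmul (suppIn_gB.dx fun s n _ h => by omega) h2)).smul
    _)).add (hmul suppIn_gN (h2.sub (hphi h1)))).neg

theorem neg_vec_BN_nonpos {F : Ser} (h : SuppIn (fun _ n => n ≤ 0) F) :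
    SuppIn (fun _ n => n ≤ 0) ((-vec gB gN : Ser →ₗ[ℂ] Ser) F) :=
  (vec_BN_nonpos (h.dx fun s n _ h => by omega) (h.dphi fun s n _ h => h)).neg

/-- `gA` starts at x² and `gM` at x¹, which makes up for the power lost in ∂/∂x and for the smaller
bound on terms with φ. -/
theorem vec_AM_pos {F : Ser} (h : SuppIn IsPos F) : SuppIn IsPos (vec gA gM F) := by
  have h1 : SuppIn (fun s n => OddVar.phi ∈ s ∧ -1 ≤ n ∨ OddVar.phi ∉ s ∧ 0 ≤ n) (dx F) :=
    h.dx fun s n _ h => by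
      rcases h with h | h
      · exact Or.inl ⟨h.1, by omega⟩
      · exact Or.inr ⟨h.1, by omega⟩
  have h2 : SuppIn (fun s n => OddVar.phi ∉ s ∧ 0 ≤ n) (dphi F) := fun s e n hn => by
    have hs : OddVar.phi ∉ s := fun hs => hn (by rw [coef_dphi, if_pos hs])
    rw [coef_dphi, if_neg hs] at hn
    rcases h _ e n hn with h | h
    · exact ⟨hs, h.2⟩
    · exact absurd (mem_insert_self _ _) h.1
  rw [vec_apply]
  refine (SuppIn.add (SuppIn.add ?_ (SuppIn.smul ?_ _)) ?_).neg
  · refine suppIn_gA.mul h1 fun s t m n _ h h' => ?_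
    rcases h' with h' | h'
    · exact Or.inl ⟨mem_union_right _ h'.1, by omega⟩
    · exact Or.inr ⟨by simp [h.1, h'.1], by omega⟩
  · refine SuppIn.phi_mul (Q := fun s n => 0 ≤ n) ?_ fun s n _ h =>
      Or.inl ⟨mem_insert_self _ _, h⟩
    exact (suppIn_gA.dx (Q' := fun _ n => 0 ≤ n) fun s n _ h => by omega).mul h2
      fun s t m n _ h h' => by have := h'.2; omega
  · refine suppIn_gM.mul (Q₂ := fun s n => 0 ≤ n) (SuppIn.sub (h2.mono fun s n h => h.2) ?_) ?_
    · refine SuppIn.phi_mul (Q := fun s n => OddVar.phi ∈ s ∨ 0 ≤ n)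
        (h1.mono fun s n h => ?_) fun s n hs h => h.resolve_left hs
      rcases h with h | h
      · exact Or.inl h.1
      · exact Or.inr h.2
    · intro s t m n _ h h'
      by_cases ht : OddVar.phi ∈ t
      · exact Or.inl ⟨mem_union_right _ ht, by have := h.2; omega⟩
      · exact Or.inr ⟨by simp [h.1, ht], by have := h.2; omega⟩

/-- `F̄⁽²⁾` at `(𝒜, ℳ) = 0`. -/
def dilPair : SFun := (dil (-1) (X 1), dil (-1) phi)

theorem dilPair_eq : dilPair = (sqrtAlpha (-2) * X 1, sqrtAlpha (-1) * phi) := by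
  rw [dilPair, dil_X, dil_phi]; rfl

/-- `F̄⁽¹⁾` at `(𝒜, ℳ) = 0`. -/
def boundary₁ : SFun := ((dilHom 1).comp expNegBN dilPair.1, (dilHom 1).comp expNegBN dilPair.2)

theorem boundary₁_eq : boundary₁ =
    onPair (fun F => dil 1 (expOp (fun E => -TBN E) (dil (-1) F))) idPair := by
  rw [boundary₁, RingHom.comp_apply, RingHom.comp_apply, dilHom_apply, dilHom_apply, neg_TBN_eq]
  rfl

/-! ### The boundary values are superconformal and normalized -/

theorem dil_zero (k : ℤ) : dil k 0 = 0 := by rw [← dilHom_apply, map_zero]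

theorem superD_X_one : superD (X 1) = phi := by
  rw [superD_apply, dphi_X, dx_X_one, mul_one, zero_add]

theorem superD_phi : superD phi = 1 := by
  rw [superD_apply, dphi_phi, dx_phi, mul_zero, add_zero]

theorem defect_dil (k : ℤ) (F : SFun) :
    defect (dil k F.1, dil k F.2) = sqrtAlpha k * dil k (defect F) := by
  rw [defect, defect, superD_dil, superD_dil, dil_sub, dil_mul, ser_mul_sub, ← mul_assoc (dil k F.2),
    ← sqrtAlpha_comm, mul_assoc]

theorem defect_expNegBN (F : SFun) :
    defect (expNegBN F.1, expNegBN F.2) = expOp (twist gB gN) (defect F) := by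
  have h := expOp_semiconj raising_twist_BN raising_BN.neg (fun _ _ => van_superD)
      (superD_neg_vec isEven_gB isOdd_gN dphi_gB dphi_gN)
  rw [defect, defect, expNegBN_apply, expNegBN_apply, h, h, expOp_sub raising_twist_BN,
    expOp_mul raising_twist_BN raising_BN.neg (twist_mul isEven_gB isOdd_gN)]

/-- The identity has defect zero, and dilations and e^{-T₋} transform defects linearly. -/
theorem defect_boundary₁ : defect boundary₁ = 0 := by
  have h0 : defect idPair = 0 := by
    rw [defect, idPair, superD_X_one, superD_phi, mul_one, sub_self]
  have h1 : defect dilPair = 0 := by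
    have := defect_dil (-1) idPair
    rw [h0, dil_zero, mul_zero] at this
    exact this
  have h2 := defect_dil 1 (expNegBN dilPair.1, expNegBN dilPair.2)
  rw [defect_expNegBN, h1, expOp_of_eq_zero raising_twist_BN (map_zero _), dil_zero, mul_zero] at h2
  rw [boundary₁, RingHom.comp_apply, RingHom.comp_apply, dilHom_apply, dilHom_apply]
  exact h2

theorem boundary₁_sub (F : Ser) : (dilHom 1).comp expNegBN (dil (-1) F) - F =
    dil 1 (expNegBN (dil (-1) F) - dil (-1) F) := by
  rw [dil_sub, dil_dil_neg, RingHom.comp_apply, dilHom_apply]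

theorem boundary₁_fst_sub : SuppIn (fun _ n => n ≤ 0) (boundary₁.1 - X 1) := by
  rw [boundary₁, dilPair, boundary₁_sub]
  refine (suppIn_expOp_sub raising_BN.neg (fun _ => neg_vec_BN_nonpos) ?_).dil 1
  refine (vec_BN_nonpos ?_ ?_).neg
  · exact ((suppIn_X (Q := fun _ n => n ≤ 1) le_rfl).dil (-1)).dx fun s n _ h => by omega
  · rw [dphi_dil, dphi_X, ← dilHom_apply, map_zero, mul_zero]
    exact suppIn_zero _

theorem boundary₁_snd_sub : SuppIn (fun _ n => n ≤ 0) (boundary₁.2 - phi) := by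
  rw [boundary₁, dilPair, boundary₁_sub]
  exact (suppIn_expOp_sub raising_BN.neg (fun _ => neg_vec_BN_nonpos)
    (neg_vec_BN_nonpos ((suppIn_phi le_rfl).dil (-1)))).dil 1

theorem van_boundary₁_snd_sub : Van 1 (boundary₁.2 - phi) := by
  rw [boundary₁, dilPair, boundary₁_sub]
  exact van_dil 1 (expNegBN_sub_van (van_zero _))

theorem gradeInv_dil (k : ℤ) (F : Ser) : gradeInv (dil k F) = dil k (gradeInv F) := by
  rw [← dilHom_apply, ← dilHom_apply, dilHom, gradeInv_phiDiag]

theorem isOdd_boundary₁ : IsOdd boundary₁.2 := by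
  rw [isOdd_iff]
  change gradeInv ((dilHom 1).comp expNegBN (dil (-1) phi)) =
    -((dilHom 1).comp expNegBN (dil (-1) phi))
  rw [RingHom.comp_apply, dilHom_apply, gradeInv_dil, gradeInv_expNegBN, gradeInv_dil,
    gradeInv_phi, dil_neg, map_neg, dil_neg]

theorem isNormal_boundary₁ : IsNormal boundary₁ := by
  obtain ⟨h1, h2⟩ := superconformal_eqs_of_defect isOdd_boundary₁ defect_boundary₁
  refine isNormal_of_superconformal h1 h2 ?_ ?_ ?_
  · rw [← noPhi_X 1, ← noPhi_sub]
    exact boundary₁_fst_sub.noPhi fun s n _ h => h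
  · have := boundary₁_snd_sub.noPhi (Q' := fun _ n => n ≤ 0) fun s n _ h => h
    rwa [noPhi_sub, noPhi_phi, sub_zero] at this
  · rw [← dphi_phi, ← dphi_sub]
    exact van_boundary₁_snd_sub.dphi

theorem isPos_X_one : SuppIn IsPos (X 1) := suppIn_X (Or.inr ⟨by simp, le_rfl⟩)

theorem isPos_phi : SuppIn IsPos phi := suppIn_phi (Or.inl ⟨by simp, le_rfl⟩)

/-- `F̄⁽²⁾` at `(ℬ, 𝒩) = 0`. -/
def boundary₂ : SFun :=
  (dil (-1) (expOp (vec gA gM) (X 1)), dil (-1) (expOp (vec gA gM) phi))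

theorem boundary₂_eq : boundary₂ = onPair (fun F => dil (-1) (expOp TAM F)) idPair := by
  rw [boundary₂, TAM_eq]; rfl

theorem expNegAM_boundary₂ (F : Ser) :
    expNegAM.comp (dilHom 1) (dil (-1) (expOp (vec gA gM) F)) = F := by
  rw [RingHom.comp_apply, dilHom_apply, dil_dil_neg]
  exact expOp_neg_expOp raising_AM F

theorem isNormal_idPair : IsNormal idPair := by
  have : constPart phi = 0 := coef_ext fun s e n => by
    rw [coef_constPart]
    split_ifs with h
    · rw [coef_eq, phi, oddVar, mono_apply, if_neg]
      · rfl
      · rintro ⟨rfl, -⟩; simp at h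
    · rfl
  constructor
  · rw [idPair, sub_self]; exact suppIn_zero _
  · rw [idPair, this, mul_zero, add_zero, sub_self]; exact suppIn_zero _

/-- At (𝒜, ℳ) = 0 the endomorphism `sewHom` becomes dilation ∘ e^{-T₋}. The truncation of F and the
inverse dilation are both normalized solutions for it, hence equal. -/
theorem boundary_AM {F : SFun} (h1 : SuppIn IsPos F.1) (h2 : SuppIn IsPos F.2)
    (h : IsNormal (sewHom F.1, sewHom F.2)) : onPair atAM0 F = dilPair := by
  refine eq_of_isNormal isDeform_dil_expNegBN ⟨?_, ?_⟩ ⟨isPos_X_one.dil _, isPos_phi.dil _⟩ ?_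
    isNormal_boundary₁
  · rw [onPair, atAM0_eq]; exact h1.cut _
  · rw [onPair, atAM0_eq, atAM0_eq]; exact h2.cut _
  · rw [onPair, ← atAM0_sewHom, ← atAM0_sewHom, atAM0_eq, atAM0_eq]
    exact h.cut _

/-- At (ℬ, 𝒩) = 0 there remains e^{-T₊} ∘ dilation, which can be inverted within the positive
powers; its normalized solution is the preimage of (x, φ). -/
theorem boundary_BN {F : SFun} (h1 : SuppIn IsPos F.1) (h2 : SuppIn IsPos F.2)
    (h : IsNormal (sewHom F.1, sewHom F.2)) : onPair atBN0 F = boundary₂ := by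
  have hpos : ∀ {G}, SuppIn IsPos G → SuppIn IsPos (expOp (vec gA gM) G) := fun hG =>
    suppIn_expOp raising_AM (fun _ => vec_AM_pos) hG
  refine eq_of_isNormal isDeform_expNegAM_dil ⟨?_, ?_⟩
    ⟨(hpos isPos_X_one).dil _, (hpos isPos_phi).dil _⟩ ?_ ?_
  · rw [onPair, atBN0_eq]; exact h1.cut _
  · rw [onPair, atBN0_eq, atBN0_eq]; exact h2.cut _
  · rw [onPair, ← atBN0_sewHom, ← atBN0_sewHom, atBN0_eq, atBN0_eq]
    exact h.cut _
  · rw [boundary₂, expNegAM_boundary₂, expNegAM_boundary₂]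
    exact isNormal_idPair

/-! ## Bihomogeneous parts -/

/-- The terms of degree `i` in `(𝒜, ℳ)` and `j` in `(ℬ, 𝒩)`. -/
def bihom (i j : ℕ) : Ser →ₗ[ℂ] Ser where
  toFun F := ofCf fun s e => if degAM s e = i ∧ degBN s e = j then cf F s e else 0
  map_add' F G := ser_ext fun s e => by
    rw [cf_add_apply, cf_ofCf, cf_ofCf, cf_ofCf, cf_add_apply]
    split_ifs
    · rfl
    · rw [add_zero]
  map_smul' c F := ser_ext fun s e => by
    rw [RingHom.id_apply, cf_smul_apply, cf_ofCf, cf_ofCf, cf_smul_apply]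
    split_ifs
    · rfl
    · rw [smul_zero]

theorem cf_bihom (i j : ℕ) (F : Ser) (s : Finset OddVar) (e : EvenVar →₀ ℕ) :
    cf (bihom i j F) s e = if degAM s e = i ∧ degBN s e = j then cf F s e else 0 := rfl

theorem coef_bihom (i j : ℕ) (F : Ser) (s : Finset OddVar) (e : EvenVar →₀ ℕ) (n : ℤ) :
    coef (bihom i j F) s e n = if degAM s e = i ∧ degBN s e = j then coef F s e n else 0 := by
  rw [coef_eq, cf_bihom]
  split_ifs <;> rfl

theorem bihom_dx (i j : ℕ) (F : Ser) : bihom i j (dx F) = dx (bihom i j F) :=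
  ser_ext fun s e => by
    rw [cf_bihom, cf_dx, cf_dx, cf_bihom]
    split_ifs
    · rfl
    · rw [derivLaur_zero]

theorem bihom_dphi (i j : ℕ) (F : Ser) : bihom i j (dphi F) = dphi (bihom i j F) :=
  ser_ext fun s e => by
    rw [cf_bihom, cf_dphi, cf_dphi, cf_bihom, degAM_insert_phi, degBN_insert_phi]
    split_ifs <;> rfl

theorem bihom_noPhi (i j : ℕ) (F : Ser) : bihom i j (noPhi F) = noPhi (bihom i j F) :=
  ser_ext fun s e => by
    rw [cf_bihom, cf_noPhi, cf_noPhi, cf_bihom]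
    split_ifs <;> rfl

theorem bihom_dil (i j : ℕ) (k : ℤ) (F : Ser) : bihom i j (dil k F) = dil k (bihom i j F) :=
  coef_ext fun s e n => by
    rw [coef_bihom, coef_dil, coef_dil, coef_bihom]
    split_ifs <;> simp

theorem HasBideg.bihom_mul {p q : ℕ} {G : Ser} (hG : HasBideg p q G) (i j : ℕ) (F : Ser) :
    bihom (i + p) (j + q) (G * F) = G * bihom i j F := ser_ext fun s e => by
  rw [cf_bihom, cf_mul_apply, cf_mul_apply]
  have key : ∀ t ∈ s.powerset, ∀ f ∈ antidiagonal e, cf G t f.1 ≠ 0 →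
      ((degAM s e = i + p ∧ degBN s e = j + q) ↔
        (degAM (s \ t) f.2 = i ∧ degBN (s \ t) f.2 = j)) := fun t ht f hf h => by
    have h1 := degAM_union (disjoint_sdiff (s := t) (t := s)) f.1 f.2
    have h2 := degBN_union (disjoint_sdiff (s := t) (t := s)) f.1 f.2
    rw [union_sdiff_of_subset (mem_powerset.1 ht), HasAntidiagonal.mem_antidiagonal.1 hf] at h1 h2
    obtain ⟨h3, h4⟩ := hG t f.1 h
    omega
  split_ifs with hs
  · refine sum_congr rfl fun t ht => sum_congr rfl fun f hf => ?_
    by_cases h : cf G t f.1 = 0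
    · simp only [h, zero_mul]
    · rw [cf_bihom, if_pos ((key t ht f hf h).1 hs)]
  · symm
    refine sum_eq_zero fun t ht => sum_eq_zero fun f hf => ?_
    by_cases h : cf G t f.1 = 0
    · simp only [h, zero_mul, mul_zero]
    · rw [cf_bihom, if_neg (fun h' => hs ((key t ht f hf h).2 h'))]
      simp only [mul_zero]

theorem HasBideg.bihom_mul_eq_zero {p q : ℕ} {G : Ser} (hG : HasBideg p q G) {i j : ℕ}
    (h : i < p ∨ j < q) (F : Ser) : bihom i j (G * F) = 0 := coef_ext fun s e n => by
  rw [coef_bihom]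
  split_ifs with hs
  · by_contra hne
    obtain ⟨t, u, e₁, e₂, a, b, hd, rfl, rfl, rfl, ha, hb⟩ := coef_mul_ne_zero hne
    rw [degAM_union hd, degBN_union hd] at hs
    have := hG t e₁ fun h0 => ha (by rw [coef_eq, h0]; rfl)
    omega
  · rfl

theorem HasBideg.dx {p q : ℕ} {F : Ser} (h : HasBideg p q F) : HasBideg p q (dx F) :=
  fun s e hs => h s e fun h0 => hs (by rw [cf_dx, h0, derivLaur_zero])

theorem hasBideg_phi : HasBideg 0 0 phi := fun s e h => by
  rw [phi, oddVar, mono_apply] at h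
  split_ifs at h with hs
  · rw [hs.1, hs.2]
    exact ⟨by simp [degAM], by simp [degBN]⟩
  · exact absurd rfl h

theorem hasBideg_X (n : ℤ) : HasBideg 0 0 (X n) := fun s e h => by
  rw [X, ofLaur_apply] at h
  split_ifs at h with hs
  · rw [hs.1, hs.2]
    exact ⟨by simp [degAM], by simp [degBN]⟩
  · exact absurd rfl h

theorem HasBideg.bihom_self {p q : ℕ} {F : Ser} (h : HasBideg p q F) : bihom p q F = F :=
  ser_ext fun s e => by
    rw [cf_bihom]
    split_ifs with hs
    · rfl
    · by_contra hc
      exact hs (h s e (Ne.symm hc))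

theorem HasBideg.bihom_eq_zero {p q : ℕ} {F : Ser} (h : HasBideg p q F) {i j : ℕ}
    (hij : i ≠ p ∨ j ≠ q) : bihom i j F = 0 :=
  ser_ext fun s e => by
    rw [cf_bihom]
    split_ifs with hs
    · by_contra hc
      have := h s e hc
      omega
    · rfl

theorem bihom_phi_mul (i j : ℕ) (F : Ser) : bihom i j (phi * F) = phi * bihom i j F :=
  hasBideg_phi.bihom_mul i j F

theorem bihom_vec {p q : ℕ} {a m : Ser} (ha : HasBideg p q a) (hm : HasBideg p q m) (i j : ℕ)
    (F : Ser) : bihom (i + p) (j + q) (vec a m F) = vec a m (bihom i j F) := by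
  rw [vec_apply, vec_apply, map_neg, map_add, map_add, map_smul, bihom_phi_mul, ha.bihom_mul,
    ha.dx.bihom_mul, hm.bihom_mul, map_sub, bihom_phi_mul, bihom_dx, bihom_dphi]

theorem bihom_vec_eq_zero {p q : ℕ} {a m : Ser} (ha : HasBideg p q a) (hm : HasBideg p q m)
    {i j : ℕ} (h : i < p ∨ j < q) (F : Ser) : bihom i j (vec a m F) = 0 := by
  rw [vec_apply, map_neg, map_add, map_add, map_smul, bihom_phi_mul, ha.bihom_mul_eq_zero h,
    ha.dx.bihom_mul_eq_zero h, hm.bihom_mul_eq_zero h, mul_zero, smul_zero, add_zero, add_zero,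
    neg_zero]

/-- Terms with n ≥ 3 are excluded by total degree; n = 2 is excluded by `h2`, as T will raise a
degree that is only 1. -/
theorem bihom_expOp {T : Ser →ₗ[ℂ] Ser} (hT : Raising T) {i j : ℕ} (h : i + j ≤ 2)
    (h2 : ∀ F, bihom i j (T (T F)) = 0) (F : Ser) :
    bihom i j (expOp T F) = bihom i j F + bihom i j (T F) := by
  have h1 : bihom i j (expOp T F) = bihom i j (∑ n ∈ range 3, expTerm T F n) :=
    ser_ext fun s e => by
      rw [cf_bihom, cf_bihom]
      split_ifs with hs
      · exact cf_expOp hT F (by rw [deg]; omega)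
      · rfl
  have t0 : expTerm T F 0 = F := by simp [expTerm]
  have t1 : expTerm T F 1 = T F := by simp [expTerm]
  have t2 : bihom i j (expTerm T F 2) = 0 := by
    rw [expTerm, map_smul]
    exact (congrArg _ (h2 F)).trans (smul_zero _)
  rw [h1, sum_range_succ, sum_range_succ, sum_range_succ, sum_range_zero, zero_add, map_add, map_add,
    t0, t1, t2, add_zero]

theorem bihom_vec_vec_AM (j : ℕ) (F : Ser) : bihom 1 j (vec gA gM (vec gA gM F)) = 0 :=
  (bihom_vec hasBideg_gA hasBideg_gM 0 j _).trans (by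
    rw [bihom_vec_eq_zero hasBideg_gA hasBideg_gM (Or.inl zero_lt_one), map_zero])

theorem bihom_vec_vec_BN (i : ℕ) (F : Ser) : bihom i 1 (vec gB gN (vec gB gN F)) = 0 :=
  (bihom_vec hasBideg_gB hasBideg_gN i 0 _).trans (by
    rw [bihom_vec_eq_zero hasBideg_gB hasBideg_gN (Or.inr zero_lt_one), map_zero])

theorem bihom_expOp_AM {j : ℕ} (hj : j ≤ 1) (F : Ser) :
    bihom 1 j (expOp (vec gA gM) F) = bihom 1 j F + vec gA gM (bihom 0 j F) := by
  rw [bihom_expOp raising_AM (by omega) (bihom_vec_vec_AM j)]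
  exact congrArg _ (bihom_vec hasBideg_gA hasBideg_gM 0 j F)

theorem bihom_expNegAM {j : ℕ} (hj : j ≤ 1) (F : Ser) :
    bihom 1 j (expNegAM F) = bihom 1 j F - vec gA gM (bihom 0 j F) := by
  have h2 : ∀ F, bihom 1 j ((-vec gA gM : Ser →ₗ[ℂ] Ser) ((-vec gA gM : Ser →ₗ[ℂ] Ser) F)) = 0 :=
    fun F => by
      rw [LinearMap.neg_apply, LinearMap.neg_apply, map_neg, map_neg, map_neg, neg_neg,
        bihom_vec_vec_AM]
  rw [expNegAM_apply, bihom_expOp raising_AM.neg (by omega) h2, LinearMap.neg_apply,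
    map_neg, ← sub_eq_add_neg]
  exact congrArg _ (bihom_vec hasBideg_gA hasBideg_gM 0 j F)

theorem bihom_expNegBN {i : ℕ} (hi : i ≤ 1) (F : Ser) :
    bihom i 1 (expNegBN F) = bihom i 1 F - vec gB gN (bihom i 0 F) := by
  have h2 : ∀ F, bihom i 1 ((-vec gB gN : Ser →ₗ[ℂ] Ser) ((-vec gB gN : Ser →ₗ[ℂ] Ser) F)) = 0 :=
    fun F => by
      rw [LinearMap.neg_apply, LinearMap.neg_apply, map_neg, map_neg, map_neg, neg_neg,
        bihom_vec_vec_BN]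
  rw [expNegBN_apply, bihom_expOp raising_BN.neg (by omega) h2, LinearMap.neg_apply,
    map_neg, ← sub_eq_add_neg]
  exact congrArg _ (bihom_vec hasBideg_gB hasBideg_gN i 0 F)

theorem bihom_atAM0 (j : ℕ) (F : Ser) : bihom 0 j (atAM0 F) = bihom 0 j F := ser_ext fun s e => by
  rw [cf_bihom, cf_bihom, atAM0_eq, cf_cut]
  split_ifs <;> simp_all

theorem bihom_atBN0 (i : ℕ) (F : Ser) : bihom i 0 (atBN0 F) = bihom i 0 F := ser_ext fun s e => by
  rw [cf_bihom, cf_bihom, atBN0_eq, cf_cut]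
  split_ifs <;> simp_all

/-! ### Conjugating vector fields by dilations -/

theorem dx_sqrtAlpha_mul (k : ℤ) (F : Ser) : dx (sqrtAlpha k * F) = sqrtAlpha k * dx F := by
  rw [dx_mul, sqrtAlpha, dx_ofLaur, derivLaur_C, ofLaur_zero, zero_mul, zero_add]

theorem mul_sqrtAlpha_mul (k : ℤ) (F G : Ser) :
    F * (sqrtAlpha k * G) = sqrtAlpha k * (F * G) := by
  rw [← mul_assoc, ← sqrtAlpha_comm, mul_assoc]

theorem sqrtAlpha_mul_sqrtAlpha_mul (k l : ℤ) (F : Ser) :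
    sqrtAlpha k * (sqrtAlpha l * F) = sqrtAlpha (k + l) * F := by
  rw [sqrtAlpha_add, mul_assoc]

theorem sqrtAlpha_neg_mul (k : ℤ) (F : Ser) : sqrtAlpha (-k) * (sqrtAlpha k * F) = F := by
  rw [sqrtAlpha_mul_sqrtAlpha_mul, neg_add_cancel, sqrtAlpha_zero, one_mul]

theorem dil_dx (k : ℤ) (F : Ser) : dil k (dx F) = sqrtAlpha (-(2 * k)) * dx (dil k F) := by
  rw [dx_dil, sqrtAlpha_neg_mul]

theorem dil_dphi (k : ℤ) (F : Ser) : dil k (dphi F) = sqrtAlpha (-k) * dphi (dil k F) := by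
  rw [dphi_dil, sqrtAlpha_neg_mul]

theorem dil_vec (k : ℤ) (a m F : Ser) : dil k (vec a m F) =
    vec (sqrtAlpha (-(2 * k)) * dil k a) (sqrtAlpha (-k) * dil k m) (dil k F) := by
  have h1 : dil k (a * dx F) = sqrtAlpha (-(2 * k)) * dil k a * dx (dil k F) := by
    rw [dil_mul, dil_dx, mul_sqrtAlpha_mul, mul_assoc]
  have h2 : dil k (phi * (dx a * dphi F)) =
      phi * (dx (sqrtAlpha (-(2 * k)) * dil k a) * dphi (dil k F)) := by
    rw [dil_mul, dil_mul, dil_phi, dil_dx, dil_dphi, dx_sqrtAlpha_mul, mul_sqrtAlpha_mul,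
      mul_sqrtAlpha_mul, mul_assoc, sqrtAlpha_neg_mul]
  have h3 : dil k (m * (dphi F - phi * dx F)) =
      sqrtAlpha (-k) * dil k m * (dphi (dil k F) - phi * dx (dil k F)) := by
    rw [dil_mul, dil_sub, dil_mul, dil_phi, dil_dx, dil_dphi, mul_sqrtAlpha_mul, mul_assoc,
      sqrtAlpha_mul_sqrtAlpha_mul, show -(2 * k) + k = -k by ring, ← ser_mul_sub, mul_sqrtAlpha_mul,
      mul_assoc]
  rw [vec_apply, vec_apply, dil_neg, dil_add, dil_add, dil_smul, h1, h2, h3]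

/-! ## The mixed quadratic terms -/

theorem noPhi_eq_self {F : Ser} (h : dphi F = 0) : noPhi F = F := by
  conv_rhs => rw [← noPhi_add_phi_mul_dphi F, h, mul_zero, add_zero]

theorem noPhi_smul (c : ℂ) (F : Ser) : noPhi (c • F) = c • noPhi F := by
  rw [smul_eq_ofLaur, smul_eq_ofLaur, noPhi_mul, noPhi_eq_self (dphi_ofLaur _)]

theorem noPhi_vec {a m : Ser} (ha : dphi a = 0) (hm : dphi m = 0) (F : Ser) :
    noPhi (vec a m F) = -(a * dx (noPhi F) + m * dphi F) := by
  rw [vec_apply, noPhi_neg, noPhi_add, noPhi_add, noPhi_smul, noPhi_phi_mul, noPhi_mul, noPhi_mul,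
    noPhi_sub, noPhi_phi_mul, noPhi_dphi, noPhi_dx, noPhi_eq_self ha, noPhi_eq_self hm, smul_zero,
    add_zero, sub_zero]

theorem vec_X_one {a m : Ser} (hm : IsOdd m) : vec a m (X 1) = -(a + phi * m) := by
  rw [vec_apply, dx_X_one, dphi_X, mul_zero, mul_zero, smul_zero, add_zero, mul_one, zero_sub,
    mul_one, ser_mul_neg, mul_phi_eq, isOdd_iff.1 hm, ser_mul_neg, neg_neg]

theorem vec_phi (a m : Ser) : vec a m phi = -(m + (1 / 2 : ℂ) • (phi * dx a)) := by
  rw [vec_apply, dx_phi, dphi_phi, mul_zero, mul_zero, mul_one, sub_zero, zero_add, mul_one, add_comm]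

theorem noPhi_vec_vec_X {a m b n : Ser} (ha : dphi a = 0) (hm : dphi m = 0) (hb : dphi b = 0)
    (hn : dphi n = 0) (hno : IsOdd n) :
    noPhi (vec a m (vec b n (X 1))) = a * dx b + m * n := by
  rw [noPhi_vec ha hm, vec_X_one hno, noPhi_neg, noPhi_add, noPhi_phi_mul, noPhi_eq_self hb, add_zero,
    dphi_neg, dphi_add, dphi_phi_mul, noPhi_eq_self hn, hb, zero_add, dx_neg, ser_mul_neg,
    ser_mul_neg, neg_add, neg_neg, neg_neg]

theorem noPhi_vec_vec_phi {a m b n : Ser} (ha : dphi a = 0) (hm : dphi m = 0) (hb : dphi b = 0)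
    (hn : dphi n = 0) :
    noPhi (vec a m (vec b n phi)) = a * dx n + (1 / 2 : ℂ) • (m * dx b) := by
  rw [noPhi_vec ha hm, vec_phi, noPhi_neg, noPhi_add, noPhi_smul, noPhi_phi_mul, noPhi_eq_self hn,
    smul_zero, add_zero, dphi_neg, dphi_add, dphi_smul, dphi_phi_mul, noPhi_dx, noPhi_eq_self hb, hn,
    zero_add, dx_neg, ser_mul_neg, ser_mul_neg, mul_smul_comm, neg_add, neg_neg, neg_neg]

/-- `g_ℬ` in the rescaled variable. -/
def dilB : Ser := sqrtAlpha (-2) * dil 1 gB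

/-- `g_𝒩` in the rescaled variable. -/
def dilN : Ser := sqrtAlpha (-1) * dil 1 gN

theorem dphi_sqrtAlpha_mul_dil {F : Ser} (h : dphi F = 0) (k l : ℤ) :
    dphi (sqrtAlpha k * dil l F) = 0 := by
  rw [dphi_mul, dphi_dil, h, dil_zero, mul_zero, mul_zero, sqrtAlpha, dphi_ofLaur, zero_mul,
    add_zero]

theorem dphi_dilB : dphi dilB = 0 := dphi_sqrtAlpha_mul_dil dphi_gB _ _

theorem dphi_dilN : dphi dilN = 0 := dphi_sqrtAlpha_mul_dil dphi_gN _ _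

theorem gradeInv_sqrtAlpha (k : ℤ) : gradeInv (sqrtAlpha k) = sqrtAlpha k := ser_ext fun s e => by
  rw [gradeInv_apply, sqrtAlpha, ofLaur_apply]
  split_ifs with h
  · rw [h.1, card_empty, pSign_even Even.zero, one_mul]
  · rw [mul_zero]

theorem isOdd_dilN : IsOdd dilN := by
  rw [isOdd_iff, dilN, map_mul, gradeInv_sqrtAlpha, gradeInv_dil, isOdd_iff.1 isOdd_gN, dil_neg,
    ser_mul_neg]

/-- The commutator which gives the mixed quadratic terms. -/
def mixed (F : Ser) : Ser := vec gA gM (vec dilB dilN F) - vec dilB dilN (vec gA gM F)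

theorem odd_mul_odd {F G : Ser} (hF : IsOdd F) (hG : IsOdd G) : F * G = -(G * F) := by
  rw [odd_mul_comm hF, isOdd_iff.1 hG, ser_neg_mul]

theorem noPhi_mixed_X : noPhi (mixed (X 1)) =
    gA * dx dilB - dilB * dx gA + (2 : ℂ) • (gM * dilN) := by
  rw [mixed, noPhi_sub, noPhi_vec_vec_X dphi_gA dphi_gM dphi_dilB dphi_dilN isOdd_dilN,
    noPhi_vec_vec_X dphi_dilB dphi_dilN dphi_gA dphi_gM isOdd_gM, odd_mul_odd isOdd_dilN isOdd_gM,
    two_smul]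
  abel

theorem noPhi_mixed_phi : noPhi (mixed phi) =
    gA * dx dilN - (1 / 2 : ℂ) • (dilN * dx gA) + ((1 / 2 : ℂ) • (gM * dx dilB) - dilB * dx gM) := by
  rw [mixed, noPhi_sub, noPhi_vec_vec_phi dphi_gA dphi_gM dphi_dilB dphi_dilN,
    noPhi_vec_vec_phi dphi_dilB dphi_dilN dphi_gA dphi_gM]
  abel

/-- The boundary values give the parts of F in bidegrees (0,0), (0,1), (1,0). Expanding both
exponentials to first order, the known parts contribute the products of the two fields in the two
orders with opposite signs. -/
theorem bihom_sewHom {F Z : Ser} (hZ : HasBideg 0 0 Z) (h1 : atAM0 F = dil (-1) Z)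
    (h2 : atBN0 F = dil (-1) (expOp (vec gA gM) Z)) :
    bihom 1 1 (sewHom F) = dil 1 (bihom 1 1 F) + mixed Z := by
  have b01 : bihom 0 1 F = 0 := by
    rw [← bihom_atAM0, h1, bihom_dil, hZ.bihom_eq_zero (Or.inr one_ne_zero), dil_zero]
  have b00 : bihom 0 0 F = dil (-1) Z := by
    rw [← bihom_atAM0, h1, bihom_dil, hZ.bihom_self]
  have b10 : bihom 1 0 F = dil (-1) (vec gA gM Z) := by
    rw [← bihom_atBN0, h2, bihom_dil, bihom_expOp_AM zero_le_one,
      hZ.bihom_eq_zero (Or.inl one_ne_zero), hZ.bihom_self, zero_add]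
  have hd : ∀ G, dil 1 (vec gB gN (dil (-1) G)) = vec dilB dilN G := fun G => by
    rw [dil_vec, dil_dil_neg]; rfl
  rw [sewHom_apply, bihom_expNegAM le_rfl, bihom_dil, bihom_dil, bihom_expNegBN le_rfl,
    bihom_expNegBN zero_le_one, b01, b00, b10, zero_sub, dil_sub, dil_neg, hd, hd, map_neg, mixed]
  abel

/-! ## Splitting into positive and nonpositive powers -/

theorem minusPart_eq (F : Ser) : minusPart F = proj (fun _ n => n ≤ 0) F := coef_ext fun s e n => by
  rw [coef_proj, coef_eq]
  refine (Finsupp.filter_apply _ _ _).trans ?_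
  split_ifs <;> rfl

theorem plusPart_eq (F : Ser) : plusPart F = proj (fun _ n => 1 ≤ n) F := coef_ext fun s e n => by
  rw [coef_proj, coef_eq]
  refine (Finsupp.filter_apply _ _ _).trans ?_
  split_ifs <;> rfl

theorem proj_add (Q : Finset OddVar → ℤ → Prop) (F G : Ser) :
    proj Q (F + G) = proj Q F + proj Q G := coef_ext fun s e n => by
  rw [coef_add, coef_proj, coef_proj, coef_proj, coef_add]
  split_ifs <;> simp

theorem proj_smul (Q : Finset OddVar → ℤ → Prop) (c : ℂ) (F : Ser) :
    proj Q (c • F) = c • proj Q F := coef_ext fun s e n => by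
  rw [coef_smul, coef_proj, coef_proj, coef_smul]
  split_ifs <;> simp

theorem proj_sqrtAlpha_mul (Q : Finset OddVar → ℤ → Prop) (k : ℤ) (F : Ser) :
    proj Q (sqrtAlpha k * F) = sqrtAlpha k * proj Q F := coef_ext fun s e n => by
  rw [coef_sqrtAlpha_mul, coef_proj, coef_proj, coef_sqrtAlpha_mul]
  split_ifs <;> simp

theorem proj_dil (Q : Finset OddVar → ℤ → Prop) (k : ℤ) (F : Ser) :
    proj Q (dil k F) = dil k (proj Q F) := coef_ext fun s e n => by
  rw [coef_dil, coef_proj, coef_proj, coef_dil]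
  split_ifs <;> simp

theorem proj_eq_self {Q : Finset OddVar → ℤ → Prop} {F : Ser} (h : SuppIn Q F) : proj Q F = F :=
  coef_ext fun s e n => by
    rw [coef_proj]
    split_ifs with hQ
    · rfl
    · by_contra hc
      exact hQ (h s e n (Ne.symm hc))

theorem proj_eq_zero {Q : Finset OddVar → ℤ → Prop} {F : Ser} (h : SuppIn (fun s n => ¬ Q s n) F) :
    proj Q F = 0 := coef_ext fun s e n => by
  rw [coef_proj]
  split_ifs with hQ
  · by_contra hc
    exact h s e n hc hQ
  · rfl

/-- The two differ only by the factor on φ; here F is free of φ. -/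
theorem scaleX_eq_dil {F : Ser} (h : dphi F = 0) (k : ℤ) : scaleX k F = dil k F :=
  ser_ext fun s e => by
    have : cf (scaleX k F) s e = scaleLaur k (cf F s e) := rfl
    rw [this, cf_dil]
    split_ifs with hs
    · rw [← noPhi_eq_self h, cf_noPhi, if_pos hs, ← scaleLaurHom_apply, map_zero, mul_zero]
    · rw [LaurentPolynomial.T_zero, map_one, one_mul]

/-- The prescribed quadratic terms are coefficients of the commutator of the 𝒜, ℳ field with the
dilated ℬ, 𝒩 field. -/
theorem quad1_fst : quad1.1 = minusPart (noPhi (mixed (X 1))) := by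
  rw [quad1, noPhi_mixed_X, scaleX_eq_dil dphi_gB, scaleX_eq_dil dphi_gN, dilB, dilN]
  simp only [minusPart_eq, proj_add, proj_smul, mul_sqrtAlpha_mul, dx_sqrtAlpha_mul,
    proj_sqrtAlpha_mul, mul_assoc]

theorem quad1_snd : quad1.2 = minusPart (noPhi (mixed phi)) := by
  rw [quad1, noPhi_mixed_phi, scaleX_eq_dil dphi_gB, scaleX_eq_dil dphi_gN, dilB, dilN]
  simp only [minusPart_eq, proj_add, proj_sub, proj_smul, mul_sqrtAlpha_mul, dx_sqrtAlpha_mul,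
    proj_sqrtAlpha_mul, mul_assoc, ser_mul_sub, mul_smul_comm]

theorem dil_sqrtAlpha_mul (k l : ℤ) (F : Ser) :
    dil k (sqrtAlpha l * F) = sqrtAlpha l * dil k F := coef_ext fun s e n => by
  rw [coef_dil, coef_sqrtAlpha_mul, coef_sqrtAlpha_mul, coef_dil]
  ring

theorem dil_neg_dx (F : Ser) : dil (-1) (dx F) = sqrtAlpha 2 * dx (dil (-1) F) := dil_dx (-1) F

theorem dil_neg_mul_dx_dilB (F : Ser) : dil (-1) (F * dx dilB) = dil (-1) F * dx gB := by
  rw [dil_mul, dil_neg_dx, dilB, dil_sqrtAlpha_mul, dil_neg_dil, dx_sqrtAlpha_mul,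
    sqrtAlpha_mul_sqrtAlpha_mul, add_neg_cancel, sqrtAlpha_zero, one_mul]

theorem dil_neg_mul_dx_dilN (F : Ser) :
    dil (-1) (F * dx dilN) = sqrtAlpha 1 * (dil (-1) F * dx gN) := by
  rw [dil_mul, dil_neg_dx, dilN, dil_sqrtAlpha_mul, dil_neg_dil, dx_sqrtAlpha_mul,
    sqrtAlpha_mul_sqrtAlpha_mul, mul_sqrtAlpha_mul]
  rfl

theorem dil_neg_dilB_mul_dx (F : Ser) : dil (-1) (dilB * dx F) = gB * dx (dil (-1) F) := by
  rw [dil_mul, dil_neg_dx, dilB, dil_sqrtAlpha_mul, dil_neg_dil, mul_sqrtAlpha_mul, mul_assoc,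
    sqrtAlpha_mul_sqrtAlpha_mul, add_neg_cancel, sqrtAlpha_zero, one_mul]

theorem dil_neg_dilN_mul_dx (F : Ser) :
    dil (-1) (dilN * dx F) = sqrtAlpha 1 * (gN * dx (dil (-1) F)) := by
  rw [dil_mul, dil_neg_dx, dilN, dil_sqrtAlpha_mul, dil_neg_dil, mul_sqrtAlpha_mul, mul_assoc,
    sqrtAlpha_mul_sqrtAlpha_mul]
  rfl

theorem dil_neg_mul_dilN (F : Ser) : dil (-1) (F * dilN) = sqrtAlpha (-1) * (dil (-1) F * gN) := by
  rw [dil_mul, dilN, dil_sqrtAlpha_mul, dil_neg_dil, mul_sqrtAlpha_mul]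

/-- Undoing the dilation moves the factors α₀ from `gB`, `gN` to `gA`, `gM`, which explains the
different scalings in the two expansions. -/
theorem quad2_fst : quad2.1 = -dil (-1) (plusPart (noPhi (mixed (X 1)))) := by
  rw [quad2, noPhi_mixed_X, scaleX_eq_dil dphi_gA, scaleX_eq_dil dphi_gM]
  simp only [plusPart_eq]
  rw [← proj_dil, dil_add, dil_sub, dil_smul, dil_neg_mul_dx_dilB, dil_neg_dilB_mul_dx,
    dil_neg_mul_dilN, proj_add, proj_sub, proj_sub, proj_smul, proj_sqrtAlpha_mul]
  abel

theorem quad2_snd : quad2.2 = -dil (-1) (plusPart (noPhi (mixed phi))) := by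
  rw [quad2, noPhi_mixed_phi, scaleX_eq_dil dphi_gA, scaleX_eq_dil dphi_gM]
  simp only [plusPart_eq]
  rw [← proj_dil, dil_add, dil_sub, dil_sub, dil_smul, dil_smul, dil_neg_mul_dx_dilB,
    dil_neg_dilB_mul_dx, dil_neg_mul_dx_dilN, dil_neg_dilN_mul_dx]
  simp only [proj_add, proj_sub, proj_smul, proj_sqrtAlpha_mul, ser_mul_sub, mul_smul_comm]
  abel

theorem noPhi_dil (k : ℤ) (F : Ser) : noPhi (dil k F) = dil k (noPhi F) := coef_ext fun s e n => by
  rw [coef_noPhi, coef_dil, coef_dil, coef_noPhi]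
  split_ifs <;> simp

theorem SuppIn.bihom {Q : Finset OddVar → ℤ → Prop} {F : Ser} (h : SuppIn Q F) (i j : ℕ) :
    SuppIn Q (bihom i j F) := fun s e n hn => h s e n fun h0 => hn (by
  rw [coef_bihom, h0, ite_self])

/-- In bidegree (1,1) the commutator is the difference of a series in nonpositive powers, coming
from F̄⁽¹⁾, and one in positive powers, coming from F̄⁽²⁾; this splitting determines both. -/
theorem noPhi_bihom_eq {F Z : Ser} (hZ : HasBideg 0 0 Z) (hF : SuppIn IsPos F)
    (hZF : SuppIn (fun _ n => n ≤ 0) (noPhi (sewHom F) - noPhi Z))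
    (h1 : atAM0 F = dil (-1) Z) (h2 : atBN0 F = dil (-1) (expOp (vec gA gM) Z)) :
    noPhi (bihom 1 1 (sewHom F)) = minusPart (noPhi (mixed Z)) ∧
      noPhi (bihom 1 1 F) = -dil (-1) (plusPart (noPhi (mixed Z))) := by
  have h := congrArg noPhi (bihom_sewHom hZ h1 h2)
  rw [noPhi_add, noPhi_dil] at h
  have hn : SuppIn (fun _ n => n ≤ 0) (noPhi (bihom 1 1 (sewHom F))) := by
    have := hZF.bihom 1 1
    rwa [map_sub, bihom_noPhi, bihom_noPhi, hZ.bihom_eq_zero (Or.inl one_ne_zero),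
      ← noPhiHom_apply 0, map_zero, sub_zero] at this
  have hp : SuppIn (fun _ n => 1 ≤ n) (dil 1 (noPhi (bihom 1 1 F))) :=
    ((hF.bihom 1 1).noPhi fun s n hs h => (h.resolve_left fun h' => hs h'.1).2).dil 1
  have e1 : noPhi (mixed Z) = noPhi (bihom 1 1 (sewHom F)) - dil 1 (noPhi (bihom 1 1 F)) := by
    rw [h]; abel
  constructor
  · rw [e1, minusPart_eq, proj_sub, proj_eq_self hn, proj_eq_zero (hp.mono fun s n h => by omega),
      sub_zero]
  · rw [e1, plusPart_eq, proj_sub, proj_eq_self hp, proj_eq_zero (hn.mono fun s n h => by omega),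
      zero_sub, dil_neg, dil_neg_dil, neg_neg]

/-! ## Parity of the normalized solution -/

theorem coef_gradeInv (F : Ser) (s : Finset OddVar) (e : EvenVar →₀ ℕ) (n : ℤ) :
    coef (gradeInv F) s e n = if Even s.card then coef F s e n else -coef F s e n := by
  rw [coef_eq, gradeInv_apply, pSign]
  split_ifs
  · rw [one_mul]; rfl
  · have : ∀ p : Laur, -1 * p = -p := fun p => by ring
    rw [this]; rfl

theorem SuppIn.gradeInv {Q : Finset OddVar → ℤ → Prop} {F : Ser} (h : SuppIn Q F) :
    SuppIn Q (gradeInv F) := fun s e n hn => h s e n fun h0 => hn (by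
  rw [coef_gradeInv, h0, neg_zero, ite_self])

theorem constPart_neg_gradeInv (F : Ser) :
    constPart (-gradeInv F) = -gradeInv (constPart F) := coef_ext fun s e n => by
  rw [coef_constPart, coef_neg, coef_neg, coef_gradeInv, coef_gradeInv, coef_constPart]
  split_ifs <;> simp

theorem IsNormal.gradeInv {F : SFun} (h : IsNormal F) :
    IsNormal (gradeInv F.1, -SuperSewing.gradeInv F.2) := by
  constructor
  · have := h.1.gradeInv.neg
    rwa [map_sub, gradeInv_phi, sub_neg_eq_add, neg_add, ← sub_eq_add_neg] at this
  · have := h.2.gradeInv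
    rw [map_sub, map_add, map_mul, gradeInv_phi, isEven_iff.1 (isEven_X 1)] at this
    rwa [constPart_neg_gradeInv, ser_mul_neg, ← ser_neg_mul]

theorem gradeInv_sewHom (F : Ser) : gradeInv (sewHom F) = sewHom (gradeInv F) := by
  rw [sewHom_apply, sewHom_apply, gradeInv_expNegAM, gradeInv_dil, gradeInv_expNegBN]

/-- With γ the grading involution, (γF⁰, −γF¹) is again a normalized solution, hence equals F. -/
theorem isSuperfunction_of_isNormal {F : SFun} (h1 : SuppIn IsPos F.1) (h2 : SuppIn IsPos F.2)
    (h : IsNormal (sewHom F.1, sewHom F.2)) : IsSuperfunction F := by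
  have h' := h.gradeInv
  rw [gradeInv_sewHom, gradeInv_sewHom, ← map_neg] at h'
  have := eq_of_isNormal isDeform_sewHom (F := (gradeInv F.1, -gradeInv F.2)) (G := F)
    ⟨h1.gradeInv, h2.gradeInv.neg⟩ ⟨h1, h2⟩ h' h
  refine ⟨isEven_iff.2 (congrArg Prod.fst this), isOdd_iff.2 ?_⟩
  rw [← neg_eq_iff_eq_neg]
  exact congrArg Prod.snd this

theorem isSuperfunction_sewHom {F : SFun} (h : IsSuperfunction F) :
    IsSuperfunction (sewHom F.1, sewHom F.2) := by
  refine ⟨isEven_iff.2 ?_, isOdd_iff.2 ?_⟩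
  · rw [gradeInv_sewHom, isEven_iff.1 h.1]
  · rw [gradeInv_sewHom, isOdd_iff.1 h.2, map_neg]

/-! ## Low-order expansions -/

theorem IsNormal.fst_nonpos {F : SFun} (h : IsNormal F) :
    SuppIn (fun _ n => n ≤ 0) (noPhi F.1 - noPhi (X 1)) := by
  have := h.2.noPhi (Q' := fun _ n => n ≤ 0) fun s n hs h =>
    ((isNeg_iff.1 h).resolve_left fun h' => hs h'.1).2
  rwa [noPhi_sub, noPhi_add, noPhi_phi_mul, add_zero] at this

theorem IsNormal.snd_nonpos {F : SFun} (h : IsNormal F) :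
    SuppIn (fun _ n => n ≤ 0) (noPhi F.2 - noPhi phi) := by
  have := h.1.noPhi (Q' := fun _ n => n ≤ 0) fun s n hs h =>
    ((isNeg_iff.1 h).resolve_left fun h' => hs h'.1).2
  rwa [noPhi_sub] at this

theorem suppIn_le_one_of_isNeg {F : Ser} (h : SuppIn IsNeg F) : SuppIn (fun _ n => n ≤ 1) F :=
  h.mono fun s n h => by rcases isNeg_iff.1 h with h | h <;> omega

theorem IsNormal.inClass1 {F : SFun} (h : IsNormal F) : InClass1 F.1 ∧ InClass1 F.2 := by
  have hphi : SuppIn (fun _ n => n ≤ 1) phi := suppIn_phi zero_le_one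
  constructor
  · have h1 := suppIn_le_one_of_isNeg h.2
    have hc : SuppIn (fun _ n => n ≤ 1) (phi * constPart F.2) := by
      refine SuppIn.phi_mul (Q := fun _ n => n ≤ 1) (fun s e n hn => ?_) fun s n _ h => h
      rw [coef_constPart] at hn
      split_ifs at hn with hs
      · omega
      · exact absurd rfl hn
    have := h1.add ((suppIn_X (m := 1) le_rfl).add hc)
    rwa [sub_add_cancel] at this
  · have := (suppIn_le_one_of_isNeg h.1).add hphi
    rwa [sub_add_cancel] at this

theorem coef_atAM0 (F : Ser) (s : Finset OddVar) (e : EvenVar →₀ ℕ) (n : ℤ) :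
    coef (atAM0 F) s e n = if degAM s e = 0 then coef F s e n else 0 := by
  rw [atAM0_eq, coef_cut]

theorem coef_atBN0 (F : Ser) (s : Finset OddVar) (e : EvenVar →₀ ℕ) (n : ℤ) :
    coef (atBN0 F) s e n = if degBN s e = 0 then coef F s e n else 0 := by
  rw [atBN0_eq, coef_cut]

theorem HasBideg.coef_eq_zero {p q : ℕ} {F : Ser} (h : HasBideg p q F) {s : Finset OddVar}
    {e : EvenVar →₀ ℕ} (hs : degAM s e ≠ p ∨ degBN s e ≠ q) (n : ℤ) : coef F s e n = 0 := by
  have : cf F s e = 0 := not_not.1 fun h0 => by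
    have := h s e h0
    omega
  rw [coef_eq, this]; rfl

theorem HasBideg.dil {p q : ℕ} {F : Ser} (h : HasBideg p q F) (k : ℤ) : HasBideg p q (dil k F) :=
  fun s e hs => h s e fun h0 => by
    obtain ⟨n, hn⟩ := exists_coef_ne_zero hs
    exact coef_dil_ne_zero.1 hn (by rw [coef_eq, h0]; rfl)

/-- F′ removes the terms of degree zero in one of the two groups, the bidegree (1,1) part removes
the mixed quadratic ones; every other monomial has total degree at least three. -/
theorem isRemainder_sub {S : Set ℤ} {F F' : Ser}
    (h0 : ∀ s e n, degAM s e = 0 ∨ degBN s e = 0 → coef F' s e n = coef F s e n)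
    (h1 : ∀ s e n, degAM s e = 1 → degBN s e = 1 → coef F' s e n = 0)
    (hS : SuppIn (fun _ n => n ∈ S) (noPhi F - noPhi F' - noPhi (bihom 1 1 F))) :
    IsRemainder S (noPhi F - noPhi F' - noPhi (bihom 1 1 F)) := fun s e n hn => by
  have hn' := hn
  rw [coef_sub, coef_sub, coef_noPhi, coef_noPhi, coef_noPhi, coef_bihom] at hn'
  by_cases hs : OddVar.phi ∈ s
  · simp [hs] at hn'
  simp only [hs, if_false] at hn'
  by_cases h00 : degAM s e = 0 ∨ degBN s e = 0
  · rw [h0 s e n h00, if_neg (by omega), sub_self, sub_zero] at hn'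
    exact absurd rfl hn'
  by_cases h11 : degAM s e = 1 ∧ degBN s e = 1
  · rw [h1 s e n h11.1 h11.2, if_pos h11, sub_zero, sub_self] at hn'
    exact absurd rfl hn'
  exact ⟨hs, hS s e n hn, by omega, by omega, by omega⟩

theorem phi_mul_expansion (F F' Q : Ser) :
    phi * F = phi * F' + phi * noPhi Q + phi * (noPhi F - noPhi F' - noPhi Q) := by
  rw [ser_mul_sub, ser_mul_sub, phi_mul_noPhi F, phi_mul_noPhi F']
  abel

/-- Terms of degree zero in (ℬ, 𝒩) cancel too: by the other boundary condition, such terms of F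
already have bidegree (0,0). -/
theorem isRemainder_atAM0 {F Z : Ser} (hZ : HasBideg 0 0 Z) (h1 : atBN0 F = Z)
    (h2 : SuppIn (fun _ n => n ≤ 0) (noPhi F - noPhi Z))
    (h3 : SuppIn (fun _ n => n ≤ 0) (noPhi (atAM0 F) - noPhi Z))
    (h4 : SuppIn (fun _ n => n ≤ 0) (noPhi (bihom 1 1 F))) :
    IsRemainder (Set.Iic 0) (noPhi F - noPhi (atAM0 F) - noPhi (bihom 1 1 F)) := by
  refine isRemainder_sub (fun s e n h => ?_) (fun s e n h _ => ?_) ?_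
  · rw [coef_atAM0]
    split_ifs with hs
    · rfl
    · have hb : degBN s e = 0 := h.resolve_left hs
      have := coef_atBN0 F s e n
      rw [if_pos hb, h1, hZ.coef_eq_zero (Or.inl hs)] at this
      exact this
  · rw [coef_atAM0, if_neg (by omega)]
  · have := (h2.sub h3).sub h4
    rwa [sub_sub_sub_cancel_right] at this

theorem isRemainder_atBN0 {F Z : Ser} (hZ : HasBideg 0 0 Z) (h1 : atAM0 F = Z)
    (hF : SuppIn IsPos F) :
    IsRemainder (Set.Ici 0) (noPhi F - noPhi (atBN0 F) - noPhi (bihom 1 1 F)) := by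
  have hpos : ∀ {G}, SuppIn IsPos G → SuppIn (fun _ n => n ∈ Set.Ici 0) (noPhi G) := fun hG =>
    hG.noPhi fun s n _ h => by
      rw [Set.mem_Ici]
      rcases h with h | h <;> omega
  refine isRemainder_sub (fun s e n h => ?_) (fun s e n _ h => ?_) ?_
  · rw [coef_atBN0]
    split_ifs with hs
    · rfl
    · have hb : degAM s e = 0 := h.resolve_right hs
      have := coef_atAM0 F s e n
      rw [if_pos hb, h1, hZ.coef_eq_zero (Or.inr hs)] at this
      exact this
  · rw [coef_atBN0, if_neg (by omega)]
  · refine ((hpos hF).sub (hpos ?_)).sub (hpos (hF.bihom 1 1))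
    rw [atBN0_eq]
    exact hF.cut _

/-! ## The normalized solution is admissible -/

theorem ser_one_ne_zero : (1 : Ser) ≠ 0 := fun h => by
  have := congrArg (fun F => cf F ∅ 0) h
  simp only [cf_one_apply, and_self, if_true] at this
  exact one_ne_zero this

/-- Its φ-free part in bidegree (0,0) is the unit (α₀^{1/2})^k. -/
theorem conformal_factor_ne_zero {H : SFun} {k : ℤ} (h : bihom 0 0 H.2 = dil k phi) :
    dphi H.2 + phi * dx (noPhi H.2) ≠ 0 := fun h0 => by
  have h1 := congrArg (fun F => bihom 0 0 (noPhi F)) h0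
  simp only [noPhi_add, noPhi_phi_mul, add_zero, noPhi_dphi, bihom_dphi, h, dphi_dil, dphi_phi]
    at h1
  rw [← noPhiHom_apply, map_zero, map_zero, ← dilHom_apply, map_one, mul_one] at h1
  have h2 := sqrtAlpha_neg_mul k 1
  rw [mul_one, h1, mul_zero] at h2
  exact ser_one_ne_zero h2.symm

theorem admissible_of_isNormal {F : SFun} (h1 : SuppIn IsPos F.1) (h2 : SuppIn IsPos F.2)
    (h : IsNormal (sewHom F.1, sewHom F.2)) : Admissible (sewHom F.1, sewHom F.2) F := by
  have hA := boundary_AM h1 h2 h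
  have hB := boundary_BN h1 h2 h
  have hA1 : atAM0 F.1 = dil (-1) (X 1) := congrArg Prod.fst hA
  have hA2 : atAM0 F.2 = dil (-1) phi := congrArg Prod.snd hA
  have hB1 : atBN0 F.1 = dil (-1) (expOp (vec gA gM) (X 1)) := congrArg Prod.fst hB
  have hB2 : atBN0 F.2 = dil (-1) (expOp (vec gA gM) phi) := congrArg Prod.snd hB
  have hA1' : atAM0 (sewHom F.1) = boundary₁.1 := by rw [atAM0_sewHom, hA1]; rfl
  have hA2' : atAM0 (sewHom F.2) = boundary₁.2 := by rw [atAM0_sewHom, hA2]; rfl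
  have hB1' : atBN0 (sewHom F.1) = X 1 := by rw [atBN0_sewHom, hB1, expNegAM_boundary₂]
  have hB2' : atBN0 (sewHom F.2) = phi := by rw [atBN0_sewHom, hB2, expNegAM_boundary₂]
  have hs := isSuperfunction_of_isNormal h1 h2 h
  have hs' := isSuperfunction_sewHom hs
  have hd := defect_eq_zero h1 h2 h
  have hd' : defect (sewHom F.1, sewHom F.2) = 0 := by
    -- `sewTwist` is a bare function, so its value at zero is obtained from 0 − 0.
    have := sewTwist_sub 0 0
    rwa [sub_self, sub_self, ← hd, ← defect_sewHom, hd] at this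
  obtain ⟨q1, q2⟩ := noPhi_bihom_eq (hasBideg_X 1) h1 h.fst_nonpos hA1 hB1
  obtain ⟨q3, q4⟩ := noPhi_bihom_eq hasBideg_phi h2 h.snd_nonpos hA2 hB2
  rw [← quad1_fst] at q1
  rw [← quad2_fst] at q2
  rw [← quad1_snd] at q3
  rw [← quad2_snd] at q4
  have hb := superconformal_eqs_of_defect hs.2 hd
  have hb' := superconformal_eqs_of_defect hs'.2 hd'
  refine
    { mem₁ := h.inClass1
      mem₂ := ⟨inClass2_iff.2 h1, inClass2_iff.2 h2⟩
      superconformal₁ := ⟨hs', hb'.1, hb'.2, conformal_factor_ne_zero (k := 0) ?_⟩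
      superconformal₂ := ⟨hs, hb.1, hb.2, conformal_factor_ne_zero (k := -1) ?_⟩
      boundary₁_AM := ?_
      boundary₁_BN := Prod.ext hB1' hB2'
      boundary₂_AM := ?_
      boundary₂_BN := ?_
      expansion₁ := ?_
      expansion₂ := ?_ }
  · change bihom 0 0 (sewHom F.2) = _
    rw [← bihom_atBN0, hB2', hasBideg_phi.bihom_self, dil_zero_left]
  · rw [← bihom_atAM0, hA2, bihom_dil, hasBideg_phi.bihom_self]
  · rw [← boundary₁_eq]; exact Prod.ext hA1' hA2'
  · rw [← dilPair_eq]; exact hA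
  · rw [← boundary₂_eq]; exact hB
  · refine ⟨(_, _), isRemainder_atAM0 (F := sewHom F.1) (hasBideg_X 1) hB1' h.fst_nonpos ?_ ?_,
      isRemainder_atAM0 (F := sewHom F.2) hasBideg_phi hB2' h.snd_nonpos ?_ ?_, Prod.ext ?_ ?_⟩
    · rw [hA1', ← noPhi_sub]
      exact boundary₁_fst_sub.noPhi fun s n _ h => h
    · rw [q1, quad1_fst, minusPart_eq]
      exact suppIn_proj _ _
    · rw [hA2', ← noPhi_sub]
      exact boundary₁_snd_sub.noPhi fun s n _ h => h
    · rw [q3, quad1_snd, minusPart_eq]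
      exact suppIn_proj _ _
    · have := phi_mul_expansion (sewHom F.1) (atAM0 (sewHom F.1)) (bihom 1 1 (sewHom F.1))
      nth_rewrite 1 [q1] at this
      exact this
    · have := phi_mul_expansion (sewHom F.2) (atAM0 (sewHom F.2)) (bihom 1 1 (sewHom F.2))
      nth_rewrite 1 [q3] at this
      exact this
  · refine ⟨(_, _), isRemainder_atBN0 ((hasBideg_X 1).dil (-1)) hA1 h1,
      isRemainder_atBN0 (hasBideg_phi.dil (-1)) hA2 h2, Prod.ext ?_ ?_⟩
    · have := phi_mul_expansion F.1 (atBN0 F.1) (bihom 1 1 F.1)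
      nth_rewrite 1 [q2] at this
      exact this
    · have := phi_mul_expansion F.2 (atBN0 F.2) (bihom 1 1 F.2)
      nth_rewrite 1 [q4] at this
      exact this

/-! ## Admissible pairs are normalized -/

theorem noPhi_eq_of_phi_mul {F F' Q R : Ser} (h : phi * F = phi * F' + phi * Q + phi * R) :
    noPhi F = noPhi F' + noPhi Q + noPhi R := by
  have := congrArg dphi h
  rwa [dphi_add, dphi_add, dphi_phi_mul, dphi_phi_mul, dphi_phi_mul, dphi_phi_mul] at this

theorem IsRemainder.suppIn {S : Set ℤ} {R : Ser} (h : IsRemainder S R) :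
    SuppIn (fun _ n => n ∈ S) R := fun s e n hn => (h s e n hn).2.1

/-- Multiplying by φ makes the expansion a statement on φ-free parts only, and there all terms but x
have nonpositive powers. The φ-parts follow from superconformality, with the root g = 1 + … selected
by the value at (ℬ, 𝒩) = 0. -/
theorem Admissible.isNormal {F₁ F₂ : SFun} (h : Admissible F₁ F₂) : IsNormal F₁ := by
  obtain ⟨-, hξ, hg, -⟩ := h.superconformal₁
  obtain ⟨R, hR1, hR2, hR⟩ := h.expansion₁
  have hb := h.boundary₁_AM
  rw [← boundary₁_eq] at hb
  have hb1 : atAM0 F₁.1 = boundary₁.1 := congrArg Prod.fst hb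
  have hb2 : atAM0 F₁.2 = boundary₁.2 := congrArg Prod.snd hb
  have e1 : noPhi F₁.1 = noPhi (atAM0 F₁.1) + noPhi quad1.1 + noPhi R.1 :=
    noPhi_eq_of_phi_mul (congrArg Prod.fst hR)
  have e2 : noPhi F₁.2 = noPhi (atAM0 F₁.2) + noPhi quad1.2 + noPhi R.2 :=
    noPhi_eq_of_phi_mul (congrArg Prod.snd hR)
  have hno : ∀ {G}, SuppIn (fun _ n => n ≤ 0) G → SuppIn (fun _ n => n ≤ 0) (noPhi G) := fun hG =>
    hG.noPhi fun s n _ h => h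
  refine isNormal_of_superconformal hξ hg ?_ ?_ ?_
  · have e3 : noPhi F₁.1 - X 1 = noPhi (boundary₁.1 - X 1) + noPhi quad1.1 + noPhi R.1 := by
      rw [e1, hb1, noPhi_sub, noPhi_X]
      abel
    rw [e3]
    refine ((hno boundary₁_fst_sub).add (hno ?_)).add (hno hR1.suppIn)
    rw [quad1_fst, minusPart_eq]
    exact suppIn_proj _ _
  · have e3 : noPhi F₁.2 = noPhi (boundary₁.2 - phi) + noPhi quad1.2 + noPhi R.2 := by
      rw [e2, hb2, noPhi_sub, noPhi_phi, sub_zero]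
    rw [e3]
    refine ((hno boundary₁_snd_sub).add (hno ?_)).add (hno hR2.suppIn)
    rw [quad1_snd, minusPart_eq]
    exact suppIn_proj _ _
  · rw [← dphi_phi, ← dphi_sub]
    refine Van.dphi (van_iff.2 fun s e n hs => ?_)
    have hbn : atBN0 F₁.2 = phi := congrArg Prod.snd h.boundary₁_BN
    have := coef_atBN0 F₁.2 s e n
    rw [deg] at hs
    rw [hbn, if_pos (by omega)] at this
    rw [coef_sub, this, sub_self]

/-- Admissible solutions and normalized solutions supported in `IsPos` are the same thing, and the
latter exist uniquely. -/
theorem exists_unique_admissible :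
    ∃! F : SFun × SFun, Admissible F.1 F.2 ∧ F.1 = (sewHom F.2.1, sewHom F.2.2) := by
  obtain ⟨F, h1, h2, h⟩ := exists_isNormal isDeform_sewHom
  refine ⟨((sewHom F.1, sewHom F.2), F), ⟨admissible_of_isNormal h1 h2 h, rfl⟩, ?_⟩
  rintro ⟨F₁, F₂⟩ ⟨ha, he⟩
  dsimp only at ha he
  have hn := ha.isNormal
  rw [he] at hn
  have : F₂ = F := eq_of_isNormal isDeform_sewHom
    ⟨inClass2_iff.1 ha.mem₂.1, inClass2_iff.1 ha.mem₂.2⟩ ⟨h1, h2⟩ hn h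
  rw [he, this]

end SuperSewing

end

/-! ### The formal sewing theorem -/

open SuperSewing in
theorem theorem3p3 :
    (∃! K : SFun, IsCompInverse H2 K) ∧
    ∀ K : SFun, IsCompInverse H2 K →
      CompExists inversion H1 ∧
      CompExists K (comp inversion H1) ∧
      (∀ F₁ F₂ : SFun, Admissible F₁ F₂ →
        CompExists F₂ (comp K (comp inversion H1))) ∧
      ∃! F : SFun × SFun,
        Admissible F.1 F.2 ∧
        InClass1 (comp F.2 (comp K (comp inversion H1))).1 ∧
        InClass1 (comp F.2 (comp K (comp inversion H1))).2 ∧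
        F.1 = comp F.2 (comp K (comp inversion H1)) := by
  refine ⟨⟨invH2, isCompInverse_invH2, fun K hK => eq_invH2 hK⟩, fun K hK => ?_⟩
  rw [eq_invH2 hK, comp_invH2_comp]
  refine ⟨?_, ?_, fun F₁ F₂ _ => isGood_sewHom.compExists _, ?_⟩
  · rw [H1_eq]; exact isGood_H1.compExists _
  · rw [comp_inversion_H1]; exact (isGood_H1.comp (isGood_invHom _)).compExists _
  · simp only [isGood_sewHom.comp_eq]
    obtain ⟨F, ⟨ha, he⟩, hu⟩ := exists_unique_admissible
    -- The support of the composite is that of F̄⁽¹⁾, transported along the sewing equation.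
    refine ⟨F, ⟨ha, ?_, ?_, he⟩, fun G hG => hu G ⟨hG.1, hG.2.2.2⟩⟩
    · have := ha.mem₁.1
      rwa [he] at this
    · have := ha.mem₁.2
      rwa [he] at this
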